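/- **Setting.** Let $T>0$, let $U$ be a nonempty compact metric space, let $B(0,R)\subset\mathbb R^d$ denote closed balls, and let $\mathcal P_c(\mathbb R^d)$ be the set of compactly supported Borel probability measures on $\mathbb R^d$; $\mathcal P(K)\subset\mathcal P_c(\mathbb R^d)$ is the set of those concentrated on the compact set $K$. For $\mu,\nu\in\mathcal P_c(\mathbb R^d)$ let $\Gamma(\mu,\nu)$ be the set of transport plans, $W_p(\mu,\nu)=\min_{\gamma\in\Gamma(\mu,\nu)}\big(\int|x-y|^p\,d\gamma\big)^{1/p}$, and $\Gamma_o(\mu,\nu)$ the set of plans attaining the minimum for $p=2$. For a plan $\gamma$ and $\lambda\in[0,1]$ put $\gamma_\lambda^{1\to2}:=((1-\lambda)\pi^1+\lambda\pi^2)_\#\gamma$. **Wasserstein gradients.** For $\phi:\mathcal P_c(\mathbb R^d)\to\mathbb R$ and $\mu\in\mathcal P_c(\mathbb R^d)$, a map $\xi\in L^2(\mu;\mathbb R^d)$ belongs to $\partial^-\phi(\mu)$ if for every $R>0$ and every $\nu$ concentrated on the $R$-fattening $\bigcup_{x\in\operatorname{supp}\mu}B(x,R)$, $$\phi(\nu)-\phi(\mu)\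 \ge\ \inf_{\gamma\in\Gamma_o(\mu,\nu)}\int\langle\xi(x),y-x\rangle\,d\gamma(x,y)+o_R(W_2(\mu,\nu)),$$ and $\xi\in\partial^+\phi(\mu)$ if $-\xi\in\partial^-(-\phi)(\mu)$. The functional $\phi$ is locally differentiable at $\mu$, with Wasserstein gradient $\nabla\phi(\mu)=\xi$, if $\xi\in\partial^-\phi(\mu)\cap\partial^+\phi(\mu)$ and $\xi$ lies in the $L^2(\mu)$-closure of $\{\nabla\psi:\psi\in C_c^\infty(\mathbb R^d)\}$ (such a $\xi$ is unique in $L^2(\mu)$). For vector-valued $\phi$ this is meant componentwise, and $D\phi(\mu)$ is the matrix field whose rows are the gradients of the components. **Hypotheses (OCP).** Let $v:[0,T]\times\mathcal P_c(\mathbb R^d)\times U\times\mathbb R^d\to\mathbb R^d$ and $\varphi:\mathcal P_c(\mathbb R^d)\to\mathbb R$ satisfy, for every $R>0$ and $K:=B(0,R)$: 1. $t\mapsto v(t,\mu,u,x)$ is Lebesgue measurable for all $(\mu,u,x)$, and there is $m\in L^1([0,T],\mathbb R_+)$, independent of $R$, such that for each $u\in U$, for a.e. $t\in[0,T]$ and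 all $(\mu,x)\in\mathcal P_c(\mathbb R^d)\times\mathbb R^d$, $|v(t,\mu,u,x)|\le m(t)\big(1+|x|+\int|y|\,d\mu(y)\big)$; 2. there are $l_K,L_K\in L^1([0,T],\mathbb R_+)$ such that for each $u\in U$ and a.e. $t$, $|v(t,\mu,u,x)-v(t,\mu,u,y)|\le l_K(t)|x-y|$ and $|v(t,\mu,u,x)-v(t,\nu,u,x)|\le L_K(t)W_1(\mu,\nu)$ for all $\mu,\nu\in\mathcal P(K)$ and $x,y\in K$; 3. for each $u\in U$ and a.e. $t$, $x\mapsto v(t,\mu,u,x)$ is Fréchet differentiable for every $\mu\in\mathcal P_c(\mathbb R^d)$, and $(\mu,x)\mapsto D_xv(t,\mu,u,x)$ is continuous on $(\mathcal P(K),W_1)\times K$; 4. for each $u\in U$ and a.e. $t$, $\mu\mapsto v(t,\mu,u,x)$ is locally differentiable at every $\mu\in\mathcal P_c(\mathbb R^d)$ for every $x\in\mathbb R^d$, and $(\mu,x,y)\mapsto D_\mu v(t,\mu,u,x)(y)$ has a version that is continuous on $(\mathcal P(K),W_1)\times K\times K$; 5. for a.e. $t$ and all $(\mu,x)$, $u\mapsto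 v(t,\mu,u,x)$ is continuous; 6. $\varphi$ is $W_1$-Lipschitz on $\mathcal P(K)$ and locally differentiable at every $\mu\in\mathcal P_c(\mathbb R^d)$, with a continuous version of $x\mapsto\nabla\varphi(\mu)(x)$. **Hypotheses (SC1).** For every $R>0$ and $K:=B(0,R)$: 1. there is $C_K\in L^1([0,T],\mathbb R_+)$ such that for all $u\in U$, $\mu_1,\mu_2\in\mathcal P(K)$, $\gamma\in\Gamma_o(\mu_1,\mu_2)$ and $x,y\in K$, for a.e. $t\in[0,T]$ and every $\lambda\in[0,1]$, $$\big|(1-\lambda)v(t,\mu_1,u,x)+\lambda v(t,\mu_2,u,y)-v(t,\gamma^{1\to2}_\lambda,u,(1-\lambda)x+\lambda y)\big|\le C_K(t)\,\lambda(1-\lambda)\big(|x-y|^2+W_2^2(\mu_1,\mu_2)\big);$$ 2. there is a constant $C>0$ (depending on $K$) such that for all $\mu_1,\mu_2\in\mathcal P(K)$, $\gamma\in\Gamma_o(\mu_1,\mu_2)$ and $\lambda\in[0,1]$, $(1-\lambda)\varphi(\mu_1)+\lambda\varphi(\mu_2)-\varphi(\gamma^{1\to2}_\lambda)\le C\,\lambda(1-\lambda)W_2^2(\mu_1,\mu_2)$.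 **Value function.** For $\tau\in[0,T]$ and $\mu_\tau\in\mathcal P_c(\mathbb R^d)$ let $$\mathcal V(\tau,\mu_\tau):=\inf\ \varphi(\mu(T)),$$ the infimum being over all Lebesgue measurable $u:[0,T]\to U$ and all $W_1$-continuous curves $\mu:[\tau,T]\to\mathcal P_c(\mathbb R^d)$ with $\mu(\tau)=\mu_\tau$ that solve $\partial_t\mu(t)+\operatorname{div}_x\big(v(t,\mu(t),u(t),\cdot)\,\mu(t)\big)=0$ in the sense of distributions on $(\tau,T)\times\mathbb R^d$. **Theorem.** Assume (OCP) and (SC1). Then the infimum defining $\mathcal V(\tau,\mu_\tau)$ is over a nonempty set that is bounded below, so that $\mathcal V$ is real-valued on $[0,T]\times\mathcal P_c(\mathbb R^d)$. Moreover, for every $K:=B(0,r)$ with $r>0$ there is a constant $\mathcal C_K>0$ such that for every $\tau\in[0,T]$, all $\mu_1,\mu_2\in\mathcal P(K)$, all $\lambda\in[0,1]$ and each $\gamma\in\Gamma_o(\mu_1,\mu_2)$, $$(1-\lambda)\mathcal V(\tau,\mu_1)+\lambda\mathcal V(\tau,\mu_2)-\mathcal V(\tau,\gamma^{1\to2}_\lambda)\le\mathcal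 C_K\,\lambda(1-\lambda)\,W_2^2(\mu_1,\mu_2).$$ -/

import Mathlib

open MeasureTheory Set Filter Topology
open scoped ContDiff Gradient

noncomputable section

namespace MeanFieldControl

/-- The Euclidean space `ℝ^d`. -/
abbrev E (d : ℕ) : Type := EuclideanSpace ℝ (Fin d)

/-- `𝒫_c(ℝ^d)`: the Borel probability measures on `ℝ^d` with compact support. -/
def Pc (d : ℕ) : Type :=
  {μ : ProbabilityMeasure (E d) // IsCompact (μ : Measure (E d)).support}

variable {d : ℕ}

/-- The underlying measure of an element of `𝒫_c(ℝ^d)`. -/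
def Pc.meas (μ : Pc d) : Measure (E d) := (μ.1 : Measure (E d))

/-- `𝒫(K)`, as a subset of `𝒫_c(ℝ^d)`: the measures concentrated on `K`. -/
def PcOn (K : Set (E d)) : Set (Pc d) := {μ | μ.meas Kᶜ = 0}

/-- The closed ball `B(0,R)` of `ℝ^d`. -/
abbrev ball0 (d : ℕ) (R : ℝ) : Set (E d) := Metric.closedBall (0 : E d) R

/-! ### Transport plans, Wasserstein distances, displacement interpolation -/

/-- `Γ(μ,ν)`: the transport plans between `μ` and `ν`. -/
def plans (μ ν : Pc d) : Set (ProbabilityMeasure (E d × E d)) :=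
  {γ | (γ : Measure (E d × E d)).map Prod.fst = μ.meas ∧
       (γ : Measure (E d × E d)).map Prod.snd = ν.meas}

/-- The transport cost `(∫ |x - y|^p dγ(x,y))^(1/p)` of a plan. -/
def planCost (p : ℝ) (γ : ProbabilityMeasure (E d × E d)) : ℝ :=
  (∫ z, ‖z.1 - z.2‖ ^ p ∂(γ : Measure (E d × E d))) ^ (1 / p)

/-- The Wasserstein distance `W_p(μ,ν)`. -/
def Wp (p : ℝ) (μ ν : Pc d) : ℝ := sInf (planCost p '' plans μ ν)

/-- `Γ_o(μ,ν)`: the `2`-optimal transport plans between `μ` and `ν`. -/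
def optPlans (μ ν : Pc d) : Set (ProbabilityMeasure (E d × E d)) :=
  {γ | γ ∈ plans μ ν ∧ planCost 2 γ = Wp 2 μ ν}

/-- The map `(1-l) π¹ + l π²`. -/
def interpMap (l : ℝ) (z : E d × E d) : E d := (1 - l) • z.1 + l • z.2

lemma continuous_interpMap (l : ℝ) : Continuous (interpMap (d := d) l) := by
  unfold interpMap; fun_prop

lemma isCompact_support_interp {μ ν : Pc d} {γ : ProbabilityMeasure (E d × E d)}
    (hγ : γ ∈ plans μ ν) (l : ℝ) :
    IsCompact ((γ.map (continuous_interpMap l).aemeasurable :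
      ProbabilityMeasure (E d)) : Measure (E d)).support := by
  set S : Set (E d × E d) := μ.meas.support ×ˢ ν.meas.support with hS
  have hSc : IsCompact S := μ.2.prod ν.2
  have hK : IsCompact (interpMap l '' S) := hSc.image (continuous_interpMap l)
  refine hK.of_isClosed_subset Measure.isClosed_support
    (Measure.support_subset_of_isClosed hK.isClosed ?_)
  rw [ProbabilityMeasure.toMeasure_map,
    mem_ae_map_iff (continuous_interpMap l).aemeasurable hK.measurableSet]
  have h1 : ∀ᵐ z ∂(γ : Measure (E d × E d)), z.1 ∈ μ.meas.support := by
    refine ae_of_ae_map (μ := (γ : Measure (E d × E d))) measurable_fst.aemeasurable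
      (p := fun x => x ∈ μ.meas.support) ?_
    rw [hγ.1]
    exact Measure.support_mem_ae
  have h2 : ∀ᵐ z ∂(γ : Measure (E d × E d)), z.2 ∈ ν.meas.support := by
    refine ae_of_ae_map (μ := (γ : Measure (E d × E d))) measurable_snd.aemeasurable
      (p := fun x => x ∈ ν.meas.support) ?_
    rw [hγ.2]
    exact Measure.support_mem_ae
  filter_upwards [h1, h2] with z hz1 hz2
  exact ⟨z, ⟨hz1, hz2⟩, rfl⟩

/-- The interpolation `γ_l^{1→2} = ((1-l) π¹ + l π²)_# γ` along a plan `γ ∈ Γ(μ,ν)`. -/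
def interp {μ ν : Pc d} {γ : ProbabilityMeasure (E d × E d)} (hγ : γ ∈ plans μ ν) (l : ℝ) :
    Pc d :=
  ⟨γ.map (continuous_interpMap l).aemeasurable, isCompact_support_interp hγ l⟩

/-- Local geodesic semiconcavity of a functional on `𝒫_c(ℝ^d)`. -/
def LocallyGeodesicallySemiconcave (φ : Pc d → ℝ) : Prop :=
  ∀ R > 0, ∃ C > 0, ∀ μ₁ ∈ PcOn (ball0 d R), ∀ μ₂ ∈ PcOn (ball0 d R),
    ∀ γ, ∀ hγ : γ ∈ optPlans μ₁ μ₂, ∀ l ∈ Icc (0 : ℝ) 1,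
      (1 - l) * φ μ₁ + l * φ μ₂ - φ (interp hγ.1 l) ≤ C * (l * (1 - l)) * Wp 2 μ₁ μ₂ ^ 2

/-- Continuity of a map `F` on `S × A`, with `S ⊆ 𝒫_c(ℝ^d)` endowed with the metric `W_1`. -/
def W1ContinuousOn {X Z : Type*} [PseudoMetricSpace X] [PseudoMetricSpace Z]
    (F : Pc d → X → Z) (S : Set (Pc d)) (A : Set X) : Prop :=
  ∀ μ ∈ S, ∀ x ∈ A, ∀ ε > 0, ∃ δ > 0, ∀ ν ∈ S, ∀ y ∈ A,
    Wp 1 μ ν < δ → dist x y < δ → dist (F μ x) (F ν y) < ε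

/-! ### Wasserstein gradients -/

/-- `ξ` belongs to the tangent space `Tan_μ 𝒫_2(ℝ^d)`, the closure in `L²(μ)` of the gradients
of smooth compactly supported functions. -/
def InTangent (μ : Pc d) (ξ : E d → E d) : Prop :=
  MemLp ξ 2 μ.meas ∧ ∀ ε : ENNReal, 0 < ε → ∃ ψ : E d → ℝ, ContDiff ℝ ∞ ψ ∧
    HasCompactSupport ψ ∧ eLpNorm (fun x => ξ x - ∇ ψ x) 2 μ.meas < ε

/-- The `R`-fattening `B_R(μ)` of the support of `μ`. -/
def fattening (μ : Pc d) (R : ℝ) : Set (E d) := ⋃ x ∈ μ.meas.support, Metric.closedBall x R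

/-- `ξ` belongs to the localised (classical) Fréchet subdifferential of `φ` at `μ`:
`φ(ν) - φ(μ) ≥ inf_{γ ∈ Γ_o(μ,ν)} ∫ ⟨ξ(x), y - x⟩ dγ(x,y) + o_R(W_2(μ,ν))` for every `R > 0` and
`ν ∈ 𝒫(B_R(μ))`. -/
def InSubdifferential (φ : Pc d → ℝ) (μ : Pc d) (ξ : E d → E d) : Prop :=
  MemLp ξ 2 μ.meas ∧ ∀ R > 0, ∀ ε > 0, ∃ δ > 0, ∀ ν ∈ PcOn (fattening μ R), Wp 2 μ ν < δ →
    sInf ((fun γ : ProbabilityMeasure (E d × E d) =>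
        ∫ z, inner ℝ (ξ z.1) (z.2 - z.1) ∂(γ : Measure (E d × E d))) '' optPlans μ ν)
      - ε * Wp 2 μ ν ≤ φ ν - φ μ

/-- The localised (classical) Fréchet superdifferential. -/
def InSuperdifferential (φ : Pc d → ℝ) (μ : Pc d) (ξ : E d → E d) : Prop :=
  InSubdifferential (fun ν => -φ ν) μ (fun x => -ξ x)

/-- `φ` is locally differentiable at `μ` and `ξ` is (a representative of) its Wasserstein gradient:
`ξ` is tangent and lies in both differentials. Such a `ξ` is unique in `L²(μ)`. -/
def IsWassersteinGradient (φ : Pc d → ℝ) (μ : Pc d) (ξ : E d → E d) : Prop :=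
  InTangent μ ξ ∧ InSubdifferential φ μ ξ ∧ InSuperdifferential φ μ ξ

/-! ### Assumptions on the data -/

/-- `f ∈ L¹([0,T], ℝ_+)`. -/
def IsL1Nonneg (T : ℝ) (f : ℝ → ℝ) : Prop :=
  IntegrableOn f (Icc 0 T) ∧ ∀ t ∈ Icc 0 T, 0 ≤ f t

/-- Lebesgue measure on `[0,T]`. -/
abbrev leb (T : ℝ) : Measure ℝ := volume.restrict (Icc 0 T)

variable {U : Type*}

/-- The hypotheses on the controlled non-local velocity field: for each `u`, measurability in time,
sublinearity, local Lipschitz regularity in space and measure (with bounds uniform in `u`), and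
differentiability in space and measure with continuous derivatives; and continuity in `u`. -/
structure VelocityHyp [TopologicalSpace U] (T : ℝ) (v : ℝ → Pc d → U → E d → E d) : Prop where
  measurable : ∀ u μ x, AEMeasurable (fun t => v t μ u x) (leb T)
  sublinear : ∃ m : ℝ → ℝ, IsL1Nonneg T m ∧ ∀ u, ∀ᵐ t ∂(leb T), ∀ μ x,
    ‖v t μ u x‖ ≤ m t * (1 + ‖x‖ + ∫ y, ‖y‖ ∂μ.meas)
  lipschitz : ∀ R > 0, ∃ l L : ℝ → ℝ, IsL1Nonneg T l ∧ IsL1Nonneg T L ∧ ∀ u, ∀ᵐ t ∂(leb T),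
    ∀ μ ∈ PcOn (ball0 d R), ∀ ν ∈ PcOn (ball0 d R), ∀ x ∈ ball0 d R, ∀ y ∈ ball0 d R,
      ‖v t μ u x - v t μ u y‖ ≤ l t * ‖x - y‖ ∧ ‖v t μ u x - v t ν u x‖ ≤ L t * Wp 1 μ ν
  diff_space : ∀ R > 0, ∀ u, ∀ᵐ t ∂(leb T), (∀ μ, Differentiable ℝ (v t μ u)) ∧
    W1ContinuousOn (fun μ x => fderiv ℝ (v t μ u) x) (PcOn (ball0 d R)) (ball0 d R)
  /- `G μ (x, y) i` is the `i`-th row of `D_μ v(t,μ,u,x)(y)`. -/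
  diff_measure : ∀ R > 0, ∀ u, ∀ᵐ t ∂(leb T), ∃ G : Pc d → E d × E d → Fin d → E d,
    (∀ μ x i, IsWassersteinGradient (fun ν => v t ν u x i) μ (fun y => G μ (x, y) i)) ∧
    W1ContinuousOn G (PcOn (ball0 d R)) (ball0 d R ×ˢ ball0 d R)
  continuous_control : ∀ᵐ t ∂(leb T), ∀ μ x, Continuous (fun u => v t μ u x)

/-- The hypotheses on the final cost: `W_1`-Lipschitz on each `𝒫(B(0,R))`, and locally
differentiable with continuous Wasserstein gradients. -/
structure CostHyp (φ : Pc d → ℝ) : Prop where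
  lipschitz : ∀ R > 0, ∃ L : ℝ, ∀ μ ∈ PcOn (ball0 d R), ∀ ν ∈ PcOn (ball0 d R),
    |φ μ - φ ν| ≤ L * Wp 1 μ ν
  diff : ∀ μ, ∃ ξ : E d → E d, Continuous ξ ∧ IsWassersteinGradient φ μ ξ

/-- The standing hypotheses on the optimal control problem. -/
structure OCP [TopologicalSpace U] (T : ℝ) (v : ℝ → Pc d → U → E d → E d) (φ : Pc d → ℝ) :
    Prop where
  velocity : VelocityHyp T v
  cost : CostHyp φ

/-- The geodesic semiconcavity hypotheses on the velocity field and the final cost. -/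
structure SC1 (T : ℝ) (v : ℝ → Pc d → U → E d → E d) (φ : Pc d → ℝ) : Prop where
  velocity : ∀ R > 0, ∃ C : ℝ → ℝ, IsL1Nonneg T C ∧
    ∀ u, ∀ μ₁ ∈ PcOn (ball0 d R), ∀ μ₂ ∈ PcOn (ball0 d R), ∀ γ, ∀ hγ : γ ∈ optPlans μ₁ μ₂,
      ∀ x ∈ ball0 d R, ∀ y ∈ ball0 d R, ∀ᵐ t ∂(leb T), ∀ l ∈ Icc (0 : ℝ) 1,
        ‖(1 - l) • v t μ₁ u x + l • v t μ₂ u y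
            - v t (interp hγ.1 l) u ((1 - l) • x + l • y)‖
          ≤ C t * (l * (1 - l)) * (‖x - y‖ ^ 2 + Wp 2 μ₁ μ₂ ^ 2)
  cost : LocallyGeodesicallySemiconcave φ

/-! ### The controlled continuity equation and the value function -/

/-- `μ(·)` is a `W_1`-continuous curve on `[τ,T]` with values in `𝒫_c(ℝ^d)` that solves
`∂_t μ(t) + div_x (w(t,μ(t)) μ(t)) = 0` on `(τ,T)` in the sense of distributions. -/
def SolvesContinuityEq (τ T : ℝ) (w : ℝ → Pc d → E d → E d) (μ : ℝ → Pc d) : Prop :=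
  (∀ t ∈ Icc τ T, Tendsto (fun s => Wp 1 (μ s) (μ t)) (𝓝[Icc τ T] t) (𝓝 0)) ∧
  ∀ ξ : ℝ × E d → ℝ, ContDiff ℝ ∞ ξ → HasCompactSupport ξ → tsupport ξ ⊆ Ioo τ T ×ˢ univ →
    ∫ t in Icc τ T, ∫ x, (deriv (fun s => ξ (s, x)) t
      + inner ℝ (∇ (fun y => ξ (t, y)) x) (w t (μ t) x)) ∂(μ t).meas = 0

/-- The values `φ(μ(T))` of the final cost over all trajectory-control pairs
`(μ(·),u(·))` with `μ(τ) = μτ`, where `u : [0,T] → U` is Lebesgue measurable. -/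
def attainableCosts [MeasurableSpace U] (T : ℝ) (v : ℝ → Pc d → U → E d → E d)
    (φ : Pc d → ℝ) (τ : ℝ) (μτ : Pc d) : Set ℝ :=
  {c | ∃ (u : ℝ → U) (μ : ℝ → Pc d), AEMeasurable u (leb T) ∧
    SolvesContinuityEq τ T (fun t ν x => v t ν (u t) x) μ ∧ μ τ = μτ ∧ c = φ (μ T)}

/-- The value function `𝒱(τ,μτ)` of the Mayer problem. -/
def valueFunction [MeasurableSpace U] (T : ℝ) (v : ℝ → Pc d → U → E d → E d)
    (φ : Pc d → ℝ) (τ : ℝ) (μτ : Pc d) : ℝ :=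
  sInf (attainableCosts T v φ τ μτ)

end MeanFieldControl

end

/-!
The proof is Lagrangian and probabilistic. For a probability space and a bounded random vector `A`
write `law A` for its distribution (`law`). Then `W_1(law A, law B) ≤ 𝔼|A - B|`, so that estimates
between measures become estimates between random vectors.

**Total semiconcavity.** The hypotheses give semiconcavity of `φ` and of `v(t,·,u,·)` along
*optimal* plans only, and these are not preserved by flows. Differentiability upgrades this to
arbitrary couplings:
`(1-l) φ(law A) + l φ(law B) - φ(law ((1-l)A + lB)) ≤ C l (1-l) 𝔼|A - B|²`.
For a finite probability space put `X_s = (1-s)A + sB`. If `s` is close to `s₀` then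
`(X_{s₀}, X_s)` is the only optimal plan between its marginals, as each point of `X_{s₀}` is sent to
a point to which it is nearest (`optPlans_eq_of_separated`). Hence `s ↦ φ(law X_s)` satisfies the
semiconcavity inequality on short intervals, and it is differentiable because `φ` has a Wasserstein
gradient (`IsWassersteinGradient.hasDerivAt_segConf`); a differentiable function with the local
inequality has the global one (`semiconcave_of_local`). Approximation by finitely supported vectors
gives the general case (`CostHyp.semiconcave`, `Carath.ae_semiconcave`).

**Flows.** For a control `u` and compactly supported initial data there is a flow `X` with
`∂_t X_t(z) = v(t, μ(t), u(t), X_t(z))` and `μ(t) = (X_t)_# μ(τ)` (`Carath.exists_isFlow`), and such a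
`μ` solves the continuity equation (`IsFlow.solvesContinuityEq`). Conversely, every solution is of
this form (`SolvesContinuityEq.exists_isFlow`). For this, a smooth function that is constant near
a set of discounted balls around characteristics, and increases along the equation, is tested: the
mass near a compact set `A` can only grow along the flow (`TestSolves.measure_avoid_le`), so that
`μ(τ)(A) ≤ μ(t)(X_t A)`, which forces equality of the measures. The same device, with a ball around
the origin, bounds the supports of a solution whose supports are not assumed to be uniformly
bounded (`TestSolves.exists_mem_PcOn_ball`).

**Conclusion.** Take `γ` optimal between `μ₁` and `μ₂`, and any competitor `(μ(·), u)` for the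
interpolation. Run the flows `X¹` and `X²` from `μ₁` and `μ₂` with the same `u`. On the probability
space `(ℝ^d × ℝ^d, γ)` the defect `(1-l) X¹_t(z₁) + l X²_t(z₂) - X_t((1-l)z₁ + l z₂)` vanishes at
`t = τ`, and total semiconcavity of `v` with Gronwall's inequality bounds its mean by
`C l (1-l) W_2²(μ₁,μ₂)` (`IsFlow.integral_defect_le`). Total semiconcavity and Lipschitz continuity
of `φ` then compare the three final costs (`IsFlow.cost_semiconcave`).
-/

noncomputable section

namespace MeanFieldControl

variable {d : ℕ}

/-! ### Absolutely continuous functions and Gronwall's inequality -/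

lemma absolutelyContinuousOnInterval_of_dist_le {X : Type*} [PseudoMetricSpace X] {f : ℝ → X}
    {N : ℝ → ℝ} {a b C : ℝ} (hN : AbsolutelyContinuousOnInterval N a b)
    (h : ∀ s ∈ uIcc a b, ∀ t ∈ uIcc a b, dist (f s) (f t) ≤ C * dist (N s) (N t)) :
    AbsolutelyContinuousOnInterval f a b := by
  unfold AbsolutelyContinuousOnInterval at hN ⊢
  have h0 := hN.const_mul C
  rw [mul_zero] at h0
  refine squeeze_zero' (Eventually.of_forall fun t => Finset.sum_nonneg fun i _ => dist_nonneg)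
    ?_ h0
  refine (eventually_inf_principal.2 (Eventually.of_forall fun I hI => ?_))
  rw [Finset.mul_sum]
  refine Finset.sum_le_sum fun i hi => ?_
  have := hI.1 i hi
  exact h _ this.1 _ this.2

lemma AbsolutelyContinuousOnInterval.le_of_deriv_nonpos {f f' : ℝ → ℝ} {a b : ℝ} (hab : a ≤ b)
    (hf : AbsolutelyContinuousOnInterval f a b)
    (hd : ∀ᵐ x, x ∈ Icc a b → HasDerivAt f (f' x) x ∧ f' x ≤ 0) : f b ≤ f a := by
  have h1 := hf.integral_deriv_eq_sub
  have h2 : ∫ x in a..b, deriv f x ≤ 0 := by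
    rw [intervalIntegral.integral_of_le hab]
    refine integral_nonpos_of_ae ?_
    rw [EventuallyLE, ae_restrict_iff' measurableSet_Ioc]
    filter_upwards [hd] with x hx hx2
    obtain ⟨h3, h4⟩ := hx (Ioc_subset_Icc_self hx2)
    rw [h3.deriv]; exact h4
  linarith

lemma AbsolutelyContinuousOnInterval.integral_eq_sub {f f' : ℝ → ℝ} {a b : ℝ} (hab : a ≤ b)
    (hf : AbsolutelyContinuousOnInterval f a b)
    (hd : ∀ᵐ x, x ∈ Icc a b → HasDerivAt f (f' x) x) : ∫ x in a..b, f' x = f b - f a := by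
  rw [← hf.integral_deriv_eq_sub]
  refine intervalIntegral.integral_congr_ae ?_
  filter_upwards [hd] with x hx hx2
  rw [uIoc_of_le hab] at hx2
  exact (hx (Ioc_subset_Icc_self hx2)).deriv.symm

/-- Gronwall's inequality with an integrable kernel. -/
lemma gronwall_integral {f l : ℝ → ℝ} {a b A : ℝ} (hab : a ≤ b) (hl : Integrable l)
    (hl0 : ∀ t, 0 ≤ l t) (hf : ContinuousOn f (Icc a b))
    (h : ∀ t ∈ Icc a b, f t ≤ A + ∫ s in a..t, l s * f s) :
    f b ≤ A * Real.exp (∫ s in a..b, l s) := by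
  have hlf : IntervalIntegrable (fun s => l s * f s) volume a b :=
    hl.intervalIntegrable.mul_continuousOn (by rwa [uIcc_of_le hab])
  have hli : IntervalIntegrable l volume a b := hl.intervalIntegrable
  -- The function `(A + y) * exp (-L)` is absolutely continuous with nonpositive derivative.
  set L : ℝ → ℝ := fun t => ∫ s in a..t, l s with hL
  set y : ℝ → ℝ := fun t => ∫ s in a..t, l s * f s with hy
  have hLac : AbsolutelyContinuousOnInterval L a b :=
    hli.absolutelyContinuousOnInterval_intervalIntegral left_mem_uIcc
  have hyac : AbsolutelyContinuousOnInterval y a b :=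
    hlf.absolutelyContinuousOnInterval_intervalIntegral left_mem_uIcc
  have hAac : AbsolutelyContinuousOnInterval (fun t => A + y t) a b :=
    absolutelyContinuousOnInterval_of_dist_le (C := 1) hyac (fun s _ t _ => by simp)
  have hL0 : ∀ t ∈ uIcc a b, 0 ≤ L t := fun t ht => by
    rw [uIcc_of_le hab] at ht
    exact intervalIntegral.integral_nonneg ht.1 (fun s _ => hl0 s)
  have hEac : AbsolutelyContinuousOnInterval (fun t => Real.exp (-L t)) a b := by
    refine absolutelyContinuousOnInterval_of_dist_le (C := 1) hLac (fun s hs t ht => ?_)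
    have key : ∀ x y : ℝ, 0 ≤ x → x ≤ y → Real.exp (-x) - Real.exp (-y) ≤ y - x := by
      intro x y hx hxy
      have h1 : Real.exp (-y) = Real.exp (-x) * Real.exp (x - y) := by
        rw [← Real.exp_add]; ring_nf
      have h2 := Real.add_one_le_exp (x - y)
      have h3 : Real.exp (-x) ≤ 1 := Real.exp_le_one_iff.2 (by linarith)
      have h4 := Real.exp_pos (-x)
      nlinarith
    rw [one_mul, Real.dist_eq, Real.dist_eq]
    rcases le_total (L s) (L t) with hst | hst
    · have := key _ _ (hL0 s hs) hst
      have h5 : Real.exp (-L t) ≤ Real.exp (-L s) := Real.exp_le_exp.2 (by linarith)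
      rw [abs_of_nonneg (by linarith), abs_of_nonpos (by linarith)]; linarith
    · have := key _ _ (hL0 t ht) hst
      have h5 : Real.exp (-L s) ≤ Real.exp (-L t) := Real.exp_le_exp.2 (by linarith)
      rw [abs_of_nonpos (by linarith), abs_of_nonneg (by linarith)]; linarith
  have hw := hAac.fun_mul hEac
  have hfin := AbsolutelyContinuousOnInterval.le_of_deriv_nonpos
    (f' := fun t => (l t * f t) * Real.exp (-L t) + (A + y t) * (Real.exp (-L t) * (-(l t))))
    hab hw ?_
  · have h0 : y a = 0 := by simp [hy]
    have h1 : L a = 0 := by simp [hL]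
    simp only [h0, h1, neg_zero, Real.exp_zero, mul_one, add_zero] at hfin
    have h2 := h b (right_mem_Icc.2 hab)
    have h3 : Real.exp (-L b) * Real.exp (L b) = 1 := by rw [← Real.exp_add]; simp
    calc f b ≤ A + y b := h2
      _ = (A + y b) * Real.exp (-L b) * Real.exp (L b) := by rw [mul_assoc, h3, mul_one]
      _ ≤ A * Real.exp (L b) := by gcongr
  · filter_upwards [hlf.ae_hasDerivAt_integral, hli.ae_hasDerivAt_integral] with t h1 h2 ht
    have ht' : t ∈ uIcc a b := by rwa [uIcc_of_le hab]
    have h3 := h1 ht' a left_mem_uIcc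
    have h4 := h2 ht' a left_mem_uIcc
    refine ⟨(h3.const_add A).mul h4.neg.exp, ?_⟩
    have h5 := h t ht
    have h6 : l t * f t ≤ l t * (A + y t) := mul_le_mul_of_nonneg_left h5 (hl0 t)
    have h7 := Real.exp_pos (-L t)
    have : l t * f t * Real.exp (-L t) ≤ l t * (A + y t) * Real.exp (-L t) := by gcongr
    linarith

/-- A function whose increments are dominated by the square of the increments of a continuous
monotone function is nonincreasing. -/
lemma le_of_increment_le_sq {F N : ℝ → ℝ} {a b C : ℝ} (hab : a ≤ b) (hN : ContinuousOn N (Icc a b))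
    (hNm : MonotoneOn N (Icc a b)) (hC : 0 ≤ C)
    (h : ∀ s ∈ Icc a b, ∀ t ∈ Icc a b, s ≤ t → F t - F s ≤ C * (N t - N s) ^ 2) : F b ≤ F a := by
  refine le_of_forall_pos_le_add fun ε hε => ?_
  set M := C * (N b - N a) + 1 with hM
  have hNab : N a ≤ N b := hNm (left_mem_Icc.2 hab) (right_mem_Icc.2 hab) hab
  have hMpos : 0 < M := by have := mul_nonneg hC (sub_nonneg.2 hNab); linarith
  obtain ⟨δ, hδ, hδ2⟩ := Metric.uniformContinuousOn_iff.1
    (isCompact_Icc.uniformContinuousOn_of_continuous hN) (ε / M) (by positivity)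
  obtain ⟨n, hn⟩ := exists_nat_gt ((b - a) / δ)
  have hn0 : (0 : ℝ) < n := lt_of_le_of_lt (div_nonneg (by linarith) hδ.le) hn
  -- Sum the increments over a uniform partition of mesh `(b - a) / n`.
  set p : ℕ → ℝ := fun k => a + k * ((b - a) / n) with hp
  have hstep : 0 ≤ (b - a) / n := div_nonneg (by linarith) hn0.le
  have hp0 : p 0 = a := by simp [hp]
  have hpn : p n = b := by simp only [hp]; field_simp; ring
  have hpm : ∀ k ≤ n, p k ∈ Icc a b := fun k hk => by
    refine ⟨by simp only [hp]; have := mul_nonneg (Nat.cast_nonneg (α := ℝ) k) hstep; linarith, ?_⟩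
    rw [← hpn]
    simp only [hp]
    have : (k : ℝ) ≤ n := by exact_mod_cast hk
    gcongr
  have key : ∀ k ≤ n, F (p k) - F a ≤ C * (ε / M) * (N (p k) - N a) := by
    intro k
    induction k with
    | zero => intro _; simp [hp0]
    | succ k ih =>
      intro hk
      have h1 := ih (by omega)
      have hk1 := hpm k (by omega)
      have hk2 := hpm (k + 1) hk
      have hle : p k ≤ p (k + 1) := by simp only [hp]; push_cast; linarith
      have h2 := h _ hk1 _ hk2 hle
      have h3 := hNm hk1 hk2 hle
      have h4 : N (p (k + 1)) - N (p k) ≤ ε / M := by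
        have := hδ2 (p (k + 1)) hk2 (p k) hk1 (by
          rw [Real.dist_eq, abs_of_nonneg (by linarith)]
          have : p (k + 1) - p k = (b - a) / n := by simp only [hp]; push_cast; ring
          rw [this, div_lt_iff₀ hn0]
          rwa [div_lt_iff₀ hδ, mul_comm] at hn)
        rw [Real.dist_eq] at this
        exact (le_abs_self _).trans this.le
      have h5 : C * (N (p (k + 1)) - N (p k)) ^ 2
          ≤ C * (ε / M) * (N (p (k + 1)) - N (p k)) := by
        rw [sq, mul_assoc]
        exact mul_le_mul_of_nonneg_left (mul_le_mul_of_nonneg_right h4 (by linarith)) hC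
      linarith
  have h6 := key n le_rfl
  rw [hpn] at h6
  have h7 : C * (ε / M) * (N b - N a) ≤ ε := by
    have : C * (ε / M) * (N b - N a) = ε * ((C * (N b - N a)) / M) := by ring
    rw [this]
    refine mul_le_of_le_one_right hε.le ?_
    rw [div_le_one hMpos]; linarith
  linarith

/-! ### Laws of bounded random variables and upper bounds for the Wasserstein distances -/

instance (μ : Pc d) : IsProbabilityMeasure μ.meas := by unfold Pc.meas; infer_instance

lemma Pc.ext_meas {μ ν : Pc d} (h : μ.meas = ν.meas) : μ = ν :=
  Subtype.ext (Subtype.ext h)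

lemma isCompact_support_of_ae_norm_le {m : Measure (E d)} {R : ℝ} (h : ∀ᵐ x ∂m, ‖x‖ ≤ R) :
    IsCompact m.support := by
  refine (isCompact_closedBall (0 : E d) R).of_isClosed_subset Measure.isClosed_support
    (Measure.support_subset_of_isClosed Metric.isClosed_closedBall ?_)
  filter_upwards [h] with x hx
  simpa using hx

section law

variable {Ω : Type*} [MeasurableSpace Ω]

/-- `X` is a random variable with values in the closed ball of radius `R`, almost surely. -/
structure BddRV (P : Measure Ω) (X : Ω → E d) (R : ℝ) : Prop where
  aemeas : AEMeasurable X P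
  bdd : ∀ᵐ o ∂P, ‖X o‖ ≤ R

/-- The element of `𝒫_c(ℝ^d)` given by a compactly supported Borel probability measure. -/
def Pc.mk (m : Measure (E d)) (hm : IsProbabilityMeasure m) (h : IsCompact m.support) : Pc d :=
  ⟨⟨m, hm⟩, h⟩

open Classical in
/-- The law of the essentially bounded random variable `X` on the probability space `(Ω, P)`, as an
element of `𝒫_c(ℝ^d)`; by convention the Dirac mass at `0` if `X` is not such a variable. -/
def law (P : Measure Ω) (X : Ω → E d) : Pc d :=
  if h : IsProbabilityMeasure P ∧ ∃ R, BddRV P X R then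
    Pc.mk (P.map X) (haveI := h.1; Measure.isProbabilityMeasure_map h.2.choose_spec.aemeas)
      (isCompact_support_of_ae_norm_le (R := h.2.choose) (by
        rw [ae_map_iff h.2.choose_spec.aemeas (measurableSet_le (by fun_prop) (by fun_prop))]
        exact h.2.choose_spec.bdd))
  else Pc.mk (Measure.dirac 0) inferInstance (isCompact_support_of_ae_norm_le (R := 0) (by
    rw [ae_dirac_iff (measurableSet_le (by fun_prop) (by fun_prop))]
    simp))

variable {P : Measure Ω} {X Y : Ω → E d} {R : ℝ}

lemma BddRV.mono {R' : ℝ} (h : BddRV P X R) (hR : R ≤ R') : BddRV P X R' :=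
  ⟨h.1, by filter_upwards [h.2] with x hx using hx.trans hR⟩

lemma norm_convexComb_le {x y : E d} {l : ℝ} (hl : l ∈ Icc (0 : ℝ) 1) (hx : ‖x‖ ≤ R)
    (hy : ‖y‖ ≤ R) : ‖(1 - l) • x + l • y‖ ≤ R := by
  have := convex_closedBall (0 : E d) R (mem_closedBall_zero_iff.2 hx)
    (mem_closedBall_zero_iff.2 hy) (sub_nonneg.2 hl.2) hl.1 (by ring)
  simpa using this

lemma BddRV.convexComb {l : ℝ} (hl : l ∈ Icc (0 : ℝ) 1) (hX : BddRV P X R) (hY : BddRV P Y R) :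
    BddRV P (fun o => (1 - l) • X o + l • Y o) R :=
  ⟨(continuous_interpMap l).measurable.comp_aemeasurable (hX.1.prodMk hY.1), by
    filter_upwards [hX.2, hY.2] with o h1 h2 using norm_convexComb_le hl h1 h2⟩

lemma BddRV.affine (l : ℝ) (hX : BddRV P X R) (hY : BddRV P Y R) :
    BddRV P (fun o => (1 - l) • X o + l • Y o) (|1 - l| * R + |l| * R) :=
  ⟨(continuous_interpMap l).measurable.comp_aemeasurable (hX.1.prodMk hY.1), by
    filter_upwards [hX.2, hY.2] with o h1 h2
    refine (norm_add_le _ _).trans ?_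
    rw [norm_smul, norm_smul, Real.norm_eq_abs, Real.norm_eq_abs]
    gcongr⟩

variable [IsProbabilityMeasure P]

lemma BddRV.law_meas (h : BddRV P X R) : (law P X).meas = P.map X := by
  have : IsProbabilityMeasure P ∧ ∃ R, BddRV P X R := ⟨inferInstance, R, h⟩
  rw [law, dif_pos this]
  rfl

lemma mem_PcOn_ball {μ : Pc d} : μ ∈ PcOn (ball0 d R) ↔ ∀ᵐ x ∂μ.meas, ‖x‖ ≤ R := by
  simp only [PcOn, ball0, Set.mem_ofPred_eq, ae_iff]
  congr! 2
  ext x; simp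

lemma PcOn_ball_mono {R R' : ℝ} (h : R ≤ R') : PcOn (ball0 d R) ⊆ PcOn (ball0 d R') := by
  intro μ hμ
  rw [mem_PcOn_ball] at *
  filter_upwards [hμ] with x hx using hx.trans h

lemma BddRV.law_mem (h : BddRV P X R) : law P X ∈ PcOn (ball0 d R) := by
  rw [mem_PcOn_ball, h.law_meas,
    ae_map_iff h.aemeas (measurableSet_le (by fun_prop) (by fun_prop))]
  exact h.bdd

lemma exists_mem_PcOn_ball (μ : Pc d) : ∃ R > 0, μ ∈ PcOn (ball0 d R) := by
  obtain ⟨R, hR⟩ := μ.2.isBounded.subset_closedBall (0 : E d)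
  refine ⟨max R 1, by positivity, ?_⟩
  rw [mem_PcOn_ball]
  have : ∀ᵐ x ∂μ.meas, x ∈ μ.meas.support := Measure.support_mem_ae
  filter_upwards [this] with x hx
  have := hR hx
  rw [mem_closedBall_zero_iff] at this
  exact this.trans (le_max_left _ _)

lemma BddRV.integrable (h : BddRV P X R) : Integrable X P :=
  Integrable.of_bound h.1.aestronglyMeasurable R h.2

lemma BddRV.integral_law {F : Type*} [NormedAddCommGroup F] [NormedSpace ℝ F] (h : BddRV P X R)
    {f : E d → F} (hf : AEStronglyMeasurable f (law P X).meas) :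
    ∫ x, f x ∂(law P X).meas = ∫ o, f (X o) ∂P := by
  rw [h.law_meas] at *
  exact integral_map h.1 hf

lemma law_congr (h : X =ᵐ[P] Y) (hX : BddRV P X R) : law P X = law P Y := by
  have hY : BddRV P Y R := ⟨hX.1.congr h, by filter_upwards [h, hX.2] with x h1 h2 using h1 ▸ h2⟩
  exact Pc.ext_meas (by rw [hX.law_meas, hY.law_meas, Measure.map_congr h])

lemma law_map {Ω' : Type*} [MeasurableSpace Ω'] {π : Ω' → Ω} {P' : Measure Ω'}
    [IsProbabilityMeasure P'] (hπ : AEMeasurable π P') (hP : P'.map π = P)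
    (hX : BddRV P X R) : BddRV P' (X ∘ π) R ∧ law P' (X ∘ π) = law P X := by
  subst hP
  have h : BddRV P' (X ∘ π) R := ⟨hX.1.comp_aemeasurable hπ, ae_of_ae_map hπ hX.2⟩
  exact ⟨h, Pc.ext_meas (by
    rw [h.law_meas, hX.law_meas, AEMeasurable.map_map_of_aemeasurable hX.1 hπ])⟩

lemma bddRV_id {μ : Pc d} (h : μ ∈ PcOn (ball0 d R)) : BddRV μ.meas (fun x => x) R :=
  ⟨aemeasurable_id', mem_PcOn_ball.1 h⟩

lemma law_id (μ : Pc d) : law μ.meas (fun x => x) = μ := by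
  obtain ⟨R, -, hR⟩ := exists_mem_PcOn_ball μ
  exact Pc.ext_meas (by rw [(bddRV_id hR).law_meas, Measure.map_id'])

/-! #### Plans -/

/-- The joint law of two bounded random variables. -/
def jointLaw (P : Measure Ω) [IsProbabilityMeasure P] (X Y : Ω → E d)
    (hX : AEMeasurable X P) (hY : AEMeasurable Y P) : ProbabilityMeasure (E d × E d) :=
  ⟨P.map (fun o => (X o, Y o)), Measure.isProbabilityMeasure_map (hX.prodMk hY)⟩

lemma jointLaw_mem_plans (hX : BddRV P X R) (hY : BddRV P Y R) :
    jointLaw P X Y hX.1 hY.1 ∈ plans (law P X) (law P Y) := by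
  constructor
  · simp only [jointLaw, ProbabilityMeasure.coe_mk]
    rw [hX.law_meas, AEMeasurable.map_map_of_aemeasurable measurable_fst.aemeasurable
      (hX.1.prodMk hY.1)]
    rfl
  · simp only [jointLaw, ProbabilityMeasure.coe_mk]
    rw [hY.law_meas, AEMeasurable.map_map_of_aemeasurable measurable_snd.aemeasurable
      (hX.1.prodMk hY.1)]
    rfl

lemma integral_jointLaw {F : Type*} [NormedAddCommGroup F] [NormedSpace ℝ F]
    (hX : AEMeasurable X P) (hY : AEMeasurable Y P) {f : E d × E d → F} (hf : Continuous f) :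
    ∫ z, f z ∂(jointLaw P X Y hX hY : Measure (E d × E d)) = ∫ o, f (X o, Y o) ∂P := by
  simp only [jointLaw, ProbabilityMeasure.coe_mk]
  rw [integral_map (hX.prodMk hY) (hf.stronglyMeasurable.aestronglyMeasurable)]

lemma planCost_nonneg (p : ℝ) (γ : ProbabilityMeasure (E d × E d)) : 0 ≤ planCost p γ :=
  Real.rpow_nonneg (integral_nonneg fun z => by positivity) _

lemma Wp_nonneg (p : ℝ) (μ ν : Pc d) : 0 ≤ Wp p μ ν :=
  Real.sInf_nonneg (by rintro _ ⟨γ, -, rfl⟩; exact planCost_nonneg p γ)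

lemma Wp_le_planCost {p : ℝ} {μ ν : Pc d} {γ : ProbabilityMeasure (E d × E d)}
    (h : γ ∈ plans μ ν) : Wp p μ ν ≤ planCost p γ :=
  csInf_le ⟨0, by rintro _ ⟨γ, -, rfl⟩; exact planCost_nonneg p γ⟩ ⟨γ, h, rfl⟩

lemma planCost_one (γ : ProbabilityMeasure (E d × E d)) :
    planCost 1 γ = ∫ z, ‖z.1 - z.2‖ ∂(γ : Measure (E d × E d)) := by
  simp [planCost]

lemma planCost_two_sq (γ : ProbabilityMeasure (E d × E d)) :
    planCost 2 γ ^ 2 = ∫ z, ‖z.1 - z.2‖ ^ 2 ∂(γ : Measure (E d × E d)) := by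
  have h0 : 0 ≤ ∫ z, ‖z.1 - z.2‖ ^ 2 ∂(γ : Measure (E d × E d)) :=
    integral_nonneg fun z => by positivity
  have : planCost 2 γ = (∫ z, ‖z.1 - z.2‖ ^ 2 ∂(γ : Measure (E d × E d))) ^ ((1 : ℝ) / 2) := by
    simp [planCost]
  rw [this, ← Real.sqrt_eq_rpow, Real.sq_sqrt h0]

lemma Wp_one_law_le (hX : BddRV P X R) (hY : BddRV P Y R) :
    Wp 1 (law P X) (law P Y) ≤ ∫ o, ‖X o - Y o‖ ∂P := by
  refine (Wp_le_planCost (jointLaw_mem_plans hX hY)).trans_eq ?_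
  rw [planCost_one, integral_jointLaw hX.1 hY.1 (f := fun z => ‖z.1 - z.2‖) (by fun_prop)]

lemma Wp_one_law_le_of_le {D : ℝ} (hX : BddRV P X R) (hY : BddRV P Y R)
    (h : ∀ᵐ o ∂P, ‖X o - Y o‖ ≤ D) : Wp 1 (law P X) (law P Y) ≤ D := by
  refine (Wp_one_law_le hX hY).trans ?_
  calc ∫ o, ‖X o - Y o‖ ∂P ≤ ∫ o, D ∂P :=
        integral_mono_ae (hX.integrable.sub hY.integrable).norm (integrable_const _) h
    _ = D := by simp

lemma plans_nonempty (μ ν : Pc d) : (plans μ ν).Nonempty :=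
  ⟨⟨μ.meas.prod ν.meas, inferInstance⟩, by
    exact ⟨by simp [Measure.map_fst_prod], by simp [Measure.map_snd_prod]⟩⟩

lemma plans_ae_fst {μ ν : Pc d} {γ : ProbabilityMeasure (E d × E d)} (h : γ ∈ plans μ ν)
    {p : E d → Prop} (hp : ∀ᵐ x ∂μ.meas, p x) : ∀ᵐ z ∂(γ : Measure (E d × E d)), p z.1 := by
  rw [← h.1] at hp
  exact ae_of_ae_map measurable_fst.aemeasurable hp

lemma plans_ae_snd {μ ν : Pc d} {γ : ProbabilityMeasure (E d × E d)} (h : γ ∈ plans μ ν)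
    {p : E d → Prop} (hp : ∀ᵐ x ∂ν.meas, p x) : ∀ᵐ z ∂(γ : Measure (E d × E d)), p z.2 := by
  rw [← h.2] at hp
  exact ae_of_ae_map measurable_snd.aemeasurable hp

lemma bddRV_fst {μ ν : Pc d} {γ : ProbabilityMeasure (E d × E d)} (h : γ ∈ plans μ ν)
    (hμ : μ ∈ PcOn (ball0 d R)) : BddRV (γ : Measure (E d × E d)) (fun z => z.1) R :=
  ⟨measurable_fst.aemeasurable, plans_ae_fst h (mem_PcOn_ball.1 hμ)⟩

lemma bddRV_snd {μ ν : Pc d} {γ : ProbabilityMeasure (E d × E d)} (h : γ ∈ plans μ ν)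
    (hν : ν ∈ PcOn (ball0 d R)) : BddRV (γ : Measure (E d × E d)) (fun z => z.2) R :=
  ⟨measurable_snd.aemeasurable, plans_ae_snd h (mem_PcOn_ball.1 hν)⟩

lemma interp_jointLaw (hX : BddRV P X R) (hY : BddRV P Y R) (l : ℝ) {μ ν : Pc d}
    (h : jointLaw P X Y hX.1 hY.1 ∈ plans μ ν) :
    interp h l = law P (fun o => (1 - l) • X o + l • Y o) := by
  refine Pc.ext_meas ?_
  rw [(BddRV.affine l hX hY).law_meas]
  simp only [Pc.meas, interp, ProbabilityMeasure.toMeasure_map]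
  rw [jointLaw, ProbabilityMeasure.coe_mk, AEMeasurable.map_map_of_aemeasurable
    (continuous_interpMap l).aemeasurable (hX.1.prodMk hY.1)]
  rfl

lemma interp_eq_law {μ ν : Pc d} {γ : ProbabilityMeasure (E d × E d)} (h : γ ∈ plans μ ν)
    (l : ℝ) : interp h l = law (γ : Measure (E d × E d)) (interpMap l) := by
  obtain ⟨R, -, hR⟩ := exists_mem_PcOn_ball μ
  obtain ⟨R', -, hR'⟩ := exists_mem_PcOn_ball ν
  have h1 := BddRV.affine l ((bddRV_fst h hR).mono (le_max_left R R'))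
    ((bddRV_snd h hR').mono (le_max_right R R'))
  exact Pc.ext_meas (by
    rw [show interpMap l = fun z : E d × E d => (1 - l) • z.1 + l • z.2 from rfl, h1.law_meas]; rfl)

/-- The easy half of Kantorovich duality. -/
lemma abs_integral_sub_le_Wp_one {μ ν : Pc d} {S : Set (E d)} {f : E d → ℝ} {L : ℝ} (hL : 0 ≤ L)
    (hμ : ∀ᵐ x ∂μ.meas, x ∈ S) (hν : ∀ᵐ x ∂ν.meas, x ∈ S)
    (hf : ∀ x ∈ S, ∀ y ∈ S, |f x - f y| ≤ L * ‖x - y‖)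
    (hfμ : Integrable f μ.meas) (hfν : Integrable f ν.meas) :
    |∫ x, f x ∂μ.meas - ∫ x, f x ∂ν.meas| ≤ L * Wp 1 μ ν := by
  have key : ∀ γ ∈ plans μ ν, |∫ x, f x ∂μ.meas - ∫ x, f x ∂ν.meas| ≤ L * planCost 1 γ := by
    intro γ hγ
    have i1 : Integrable (fun z : E d × E d => f z.1) (γ : Measure (E d × E d)) := by
      rw [← hγ.1] at hfμ
      exact hfμ.comp_aemeasurable measurable_fst.aemeasurable
    have i2 : Integrable (fun z : E d × E d => f z.2) (γ : Measure (E d × E d)) := by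
      rw [← hγ.2] at hfν
      exact hfν.comp_aemeasurable measurable_snd.aemeasurable
    have e1 : ∫ x, f x ∂μ.meas = ∫ z, f z.1 ∂(γ : Measure (E d × E d)) := by
      rw [← hγ.1] at hfμ ⊢
      exact integral_map measurable_fst.aemeasurable hfμ.1
    have e2 : ∫ x, f x ∂ν.meas = ∫ z, f z.2 ∂(γ : Measure (E d × E d)) := by
      rw [← hγ.2] at hfν ⊢
      exact integral_map measurable_snd.aemeasurable hfν.1
    obtain ⟨R, -, hR⟩ := exists_mem_PcOn_ball μ
    obtain ⟨R', -, hR'⟩ := exists_mem_PcOn_ball ν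
    have i3 : Integrable (fun z : E d × E d => ‖z.1 - z.2‖) (γ : Measure (E d × E d)) :=
      ((bddRV_fst hγ hR).integrable.sub (bddRV_snd hγ hR').integrable).norm
    rw [e1, e2, ← integral_sub i1 i2, planCost_one, ← integral_const_mul]
    refine (abs_integral_le_integral_abs).trans (integral_mono_ae (i1.sub i2).abs
      (i3.const_mul L) ?_)
    filter_upwards [plans_ae_fst hγ hμ, plans_ae_snd hγ hν] with z h1 h2 using hf _ h1 _ h2
  rcases hL.eq_or_lt with rfl | hL
  · obtain ⟨γ, hγ⟩ := plans_nonempty μ ν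
    simpa using key γ hγ
  rw [← div_le_iff₀' hL]
  refine le_csInf ((plans_nonempty μ ν).image _) ?_
  rintro _ ⟨γ, hγ, rfl⟩
  rw [div_le_iff₀' hL]
  exact key γ hγ

lemma Wp_two_sq_of_optPlans {μ ν : Pc d} {γ : ProbabilityMeasure (E d × E d)}
    (h : γ ∈ optPlans μ ν) : Wp 2 μ ν ^ 2 = ∫ z, ‖z.1 - z.2‖ ^ 2 ∂(γ : Measure (E d × E d)) := by
  rw [← h.2, planCost_two_sq]

end law

/-! ### Measurability of Carathéodory compositions -/

/-- If `f p` is measurable for every parameter `p` and `f` is continuous in the parameter, then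
`a ↦ f (y a) a` is measurable. -/
lemma aestronglyMeasurable_comp_of_continuousWithinAt {A Y Z : Type*} [MeasurableSpace A]
    {m : Measure A} [PseudoEMetricSpace Y] [MeasurableSpace Y] [OpensMeasurableSpace Y]
    [SecondCountableTopology Y] [TopologicalSpace Z] [TopologicalSpace.PseudoMetrizableSpace Z]
    {f : Y → A → Z} {y : A → Y} (hy : AEMeasurable y m) {s : Set Y} (hys : ∀ᵐ a ∂m, y a ∈ s)
    (hf : ∀ p ∈ s, AEStronglyMeasurable (f p) m)
    (hc : ∀ᵐ a ∂m, ContinuousWithinAt (fun p => f p a) s (y a)) :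
    AEStronglyMeasurable (fun a => f (y a) a) m := by
  rcases s.eq_empty_or_nonempty with rfl | ⟨y0, h0⟩
  · have : m = 0 := by
      rw [← ae_eq_bot]
      simpa using hys
    subst this
    exact aestronglyMeasurable_zero_measure _
  set y' := hy.mk y with hy'
  have hmeas : Measurable y' := hy.measurable_mk
  set Φ := fun n => SimpleFunc.approxOn y' hmeas s y0 h0 n with hΦ
  have hΦs : ∀ n a, Φ n a ∈ s := fun n a => SimpleFunc.approxOn_mem hmeas h0 n a
  refine aestronglyMeasurable_of_tendsto_ae atTop (f := fun n a => f (Φ n a) a) (fun n => ?_) ?_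
  · have huniv : (⋃ c : (Φ n).range, (Φ n) ⁻¹' {(c : Y)}) = univ := by
      refine eq_univ_of_forall fun a => mem_iUnion.2 ⟨⟨Φ n a, (Φ n).mem_range_self a⟩, ?_⟩
      simp
    rw [← Measure.restrict_univ (μ := m), ← huniv, aestronglyMeasurable_iUnion_iff]
    rintro ⟨c, hc'⟩
    obtain ⟨a0, rfl⟩ := SimpleFunc.mem_range.1 hc'
    refine ((hf _ (hΦs n a0)).restrict).congr ?_
    rw [EventuallyEq, ae_restrict_iff' ((Φ n).measurableSet_fiber _)]
    exact Eventually.of_forall fun a ha => by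
      have ha' : Φ n a = Φ n a0 := ha
      rw [ha']
  · filter_upwards [hys, hc, hy.ae_eq_mk] with a h1 h2 h3
    have h4 : Tendsto (fun n => Φ n a) atTop (𝓝 (y a)) := by
      rw [h3]
      refine SimpleFunc.tendsto_approxOn hmeas h0 (subset_closure ?_)
      rw [hy', ← h3]; exact h1
    exact h2.tendsto.comp (tendsto_nhdsWithin_iff.2
      ⟨h4, Eventually.of_forall fun n => hΦs n a⟩)

/-! ### Uniform bounds on the velocity field at almost every time -/

section velocity

variable {U : Type*} [MetricSpace U]

/-- The properties of the velocity field `w = v(t,·,·,·)` that hold at almost every time `t`,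
uniformly in the control; `l n` is a Lipschitz constant over the ball of radius `n`. -/
structure GoodTime (w : Pc d → U → E d → E d) (m : ℝ) (l : ℕ → ℝ) : Prop where
  growth : ∀ u μ x, ‖w μ u x‖ ≤ m * (1 + ‖x‖ + ∫ y, ‖y‖ ∂μ.meas)
  lip : ∀ (n : ℕ) u, ∀ μ ∈ PcOn (ball0 d n), ∀ ν ∈ PcOn (ball0 d n), ∀ x y, ‖x‖ ≤ n → ‖y‖ ≤ n →
    ‖w μ u x - w ν u y‖ ≤ l n * (‖x - y‖ + Wp 1 μ ν)
  cont : ∀ μ x, Continuous (fun u => w μ u x)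

/-- A Carathéodory velocity field: measurable in time, and satisfying the growth and Lipschitz
bounds of `GoodTime` for almost every time, with constants integrable in time. -/
structure Carath (T : ℝ) (v : ℝ → Pc d → U → E d → E d) (m : ℝ → ℝ) (l : ℕ → ℝ → ℝ) : Prop where
  meas : ∀ u μ x, AEMeasurable (fun t => v t μ u x) (leb T)
  m_int : Integrable m
  m_nonneg : ∀ t, 0 ≤ m t
  l_int : ∀ n, Integrable (l n)
  l_nonneg : ∀ n t, 0 ≤ l n t
  good : ∀ᵐ t ∂(leb T), GoodTime (v t) (m t) (fun n => l n t)

/-- A dense sequence of controls and the continuity in the control make the exceptional null set of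
times independent of the control. -/
lemma VelocityHyp.exists_carath [CompactSpace U] [Nonempty U] {T : ℝ}
    {v : ℝ → Pc d → U → E d → E d} (h : VelocityHyp T v) : ∃ m l, Carath T v m l := by
  obtain ⟨m, hm, hmb⟩ := h.sublinear
  have hl : ∀ n : ℕ, ∃ k : ℝ → ℝ, IsL1Nonneg T k ∧ ∀ u, ∀ᵐ t ∂(leb T),
      ∀ μ ∈ PcOn (ball0 d n), ∀ ν ∈ PcOn (ball0 d n), ∀ x y, ‖x‖ ≤ n → ‖y‖ ≤ n →
      ‖v t μ u x - v t ν u y‖ ≤ k t * (‖x - y‖ + Wp 1 μ ν) := by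
    intro n
    obtain ⟨l, L, hl, hL, h1⟩ := h.lipschitz (n + 1) (by positivity)
    refine ⟨fun t => l t + L t, ⟨hl.1.add hL.1, fun t ht => add_nonneg (hl.2 t ht) (hL.2 t ht)⟩,
      fun u => ?_⟩
    filter_upwards [h1 u, ae_restrict_mem measurableSet_Icc] with t h2 ht μ hμ ν hν x y hx hy
    have hμ' := PcOn_ball_mono (by linarith : (n : ℝ) ≤ n + 1) hμ
    have hν' := PcOn_ball_mono (by linarith : (n : ℝ) ≤ n + 1) hν
    have hx' : x ∈ ball0 d (n + 1) := by simp only [ball0, mem_closedBall_zero_iff]; linarith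
    have hy' : y ∈ ball0 d (n + 1) := by simp only [ball0, mem_closedBall_zero_iff]; linarith
    have h3 := (h2 μ hμ' ν hν' x hx' y hy').1
    have h4 := (h2 μ hμ' ν hν' y hy' x hx').2
    have h5 := norm_sub_le_norm_sub_add_norm_sub (v t μ u x) (v t μ u y) (v t ν u y)
    have h6 := mul_nonneg (hL.2 t ht) (norm_nonneg (x - y))
    have h7 := mul_nonneg (hl.2 t ht) (Wp_nonneg 1 μ ν)
    nlinarith
  choose k hk hkb using hl
  have hind : ∀ f : ℝ → ℝ, IsL1Nonneg T f → Integrable ((Icc 0 T).indicator f) ∧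
      ∀ t, 0 ≤ (Icc 0 T).indicator f t := fun f hf =>
    ⟨(integrable_indicator_iff measurableSet_Icc).2 hf.1, indicator_nonneg hf.2⟩
  refine ⟨(Icc 0 T).indicator m, fun n => (Icc 0 T).indicator (k n), h.measurable, (hind m hm).1,
    (hind m hm).2, fun n => (hind _ (hk n)).1, fun n => (hind _ (hk n)).2, ?_⟩
  have e1 := ae_all_iff.2 fun i => hmb (TopologicalSpace.denseSeq U i)
  have e2 := ae_all_iff.2 fun n => ae_all_iff.2 fun i => hkb n (TopologicalSpace.denseSeq U i)
  filter_upwards [e1, e2, h.continuous_control, ae_restrict_mem measurableSet_Icc]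
    with t h1 h2 h3 ht
  refine ⟨fun u μ x => ?_, fun n u μ hμ ν hν x y hx hy => ?_, h3⟩
  · rw [indicator_of_mem ht]
    exact (TopologicalSpace.denseRange_denseSeq U).induction_on
      (p := fun u => ‖v t μ u x‖ ≤ m t * (1 + ‖x‖ + ∫ y, ‖y‖ ∂μ.meas)) u
      (isClosed_le (h3 μ x).norm continuous_const) (fun i => h1 i μ x)
  · simp only [indicator_of_mem ht]
    exact (TopologicalSpace.denseRange_denseSeq U).induction_on
      (p := fun u => ‖v t μ u x - v t ν u y‖ ≤ k n t * (‖x - y‖ + Wp 1 μ ν)) u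
      (isClosed_le ((h3 μ x).sub (h3 ν y)).norm continuous_const)
      (fun i => h2 n i μ hμ ν hν x y hx hy)

lemma integral_norm_le {μ : Pc d} {R : ℝ} (h : μ ∈ PcOn (ball0 d R)) :
    ∫ y, ‖y‖ ∂μ.meas ≤ R := by
  calc ∫ y, ‖y‖ ∂μ.meas ≤ ∫ _, R ∂μ.meas :=
        integral_mono_ae (bddRV_id h).integrable.norm (integrable_const _) (mem_PcOn_ball.1 h)
    _ = R := by simp

variable {w : Pc d → U → E d → E d} {m : ℝ} {l : ℕ → ℝ}

lemma GoodTime.norm_le (h : GoodTime w m l) (hm : 0 ≤ m) {R : ℝ} {μ : Pc d}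
    (hμ : μ ∈ PcOn (ball0 d R)) {x : E d} (hx : ‖x‖ ≤ R) (u : U) :
    ‖w μ u x‖ ≤ m * (1 + 2 * R) :=
  (h.growth u μ x).trans (mul_le_mul_of_nonneg_left
    (by have := integral_norm_le hμ; linarith) hm)

lemma Wp_one_self (μ : Pc d) : Wp 1 μ μ = 0 := by
  refine le_antisymm ?_ (Wp_nonneg _ _ _)
  obtain ⟨R, -, hR⟩ := exists_mem_PcOn_ball μ
  have := Wp_one_law_le (bddRV_id hR) (bddRV_id hR)
  simpa [law_id] using this

lemma GoodTime.lip_space (h : GoodTime w m l) {n : ℕ} {μ : Pc d}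
    (hμ : μ ∈ PcOn (ball0 d n)) {x y : E d} (hx : ‖x‖ ≤ n) (hy : ‖y‖ ≤ n) (u : U) :
    ‖w μ u x - w μ u y‖ ≤ l n * ‖x - y‖ := by
  simpa [Wp_one_self] using h.lip n u μ hμ μ hμ x y hx hy

lemma GoodTime.tendsto (h : GoodTime w m l) {ι : Type*} {F : Filter ι} {n : ℕ} {νs : ι → Pc d}
    {ν : Pc d} {us : ι → U} {u : U} {xs : ι → E d} {x : E d}
    (hνs : ∀ᶠ i in F, νs i ∈ PcOn (ball0 d n)) (hν : ν ∈ PcOn (ball0 d n))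
    (hxs : ∀ᶠ i in F, ‖xs i‖ ≤ n) (hx : ‖x‖ ≤ n)
    (h1 : Tendsto (fun i => Wp 1 (νs i) ν) F (𝓝 0)) (h2 : Tendsto us F (𝓝 u))
    (h3 : Tendsto xs F (𝓝 x)) :
    Tendsto (fun i => w (νs i) (us i) (xs i)) F (𝓝 (w ν u x)) := by
  have h4 : Tendsto (fun i => w ν (us i) x) F (𝓝 (w ν u x)) := ((h.cont ν x).tendsto u).comp h2
  have h5 : Tendsto (fun i => w (νs i) (us i) (xs i) - w ν (us i) x) F (𝓝 0) := by
    refine squeeze_zero_norm' (a := fun i => l n * (‖xs i - x‖ + Wp 1 (νs i) ν)) ?_ ?_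
    · filter_upwards [hνs, hxs] with i hi1 hi2
      exact h.lip n _ _ hi1 _ hν _ _ hi2 hx
    · have : Tendsto (fun i => ‖xs i - x‖) F (𝓝 0) := by
        have := (h3.sub_const x).norm
        simpa using this
      simpa using (this.add h1).const_mul (l n)
  simpa using h5.add h4

lemma GoodTime.aestronglyMeasurable (h : GoodTime w m l) {n : ℕ} {μ : Pc d}
    (hμ : μ ∈ PcOn (ball0 d n)) (u : U) {ν : Pc d} (hν : ν ∈ PcOn (ball0 d n)) :
    AEStronglyMeasurable (w μ u) ν.meas := by
  have hc : ContinuousOn (w μ u) (ball0 d n) := by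
    refine (LipschitzOnWith.of_dist_le_mul (K := (l n).toNNReal) fun x hx y hy => ?_).continuousOn
    rw [dist_eq_norm, dist_eq_norm]
    refine (h.lip_space hμ (by simpa using hx) (by simpa using hy) u).trans ?_
    gcongr; exact Real.le_coe_toNNReal _
  have hr : ν.meas.restrict (ball0 d n) = ν.meas := by
    refine Measure.restrict_eq_self_of_ae_mem ?_
    filter_upwards [mem_PcOn_ball.1 hν] with x hx
    simpa using hx
  rw [← hr]
  exact hc.aestronglyMeasurable Metric.isClosed_closedBall.measurableSet

/-- Continuity of the pairing `∫ ⟨β, w(ν,u,·)⟩ dν` with respect to the measure and the control. -/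
lemma GoodTime.tendsto_integral_inner (h : GoodTime w m l) (hm : 0 ≤ m) (hl : ∀ n, 0 ≤ l n)
    {ι : Type*} {F : Filter ι}
    [F.IsCountablyGenerated] {n : ℕ} {νs : ι → Pc d} {ν : Pc d} {us : ι → U} {u : U}
    (hνs : ∀ᶠ i in F, νs i ∈ PcOn (ball0 d n)) (hν : ν ∈ PcOn (ball0 d n))
    (h1 : Tendsto (fun i => Wp 1 (νs i) ν) F (𝓝 0)) (h2 : Tendsto us F (𝓝 u))
    {β : E d → E d} {B : ℝ} (hβc : Continuous β) (hβB : ∀ x, ‖β x‖ ≤ B)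
    (hβL : ∀ x y, ‖β x - β y‖ ≤ B * ‖x - y‖) :
    Tendsto (fun i => ∫ x, inner ℝ (β x) (w (νs i) (us i) x) ∂(νs i).meas) F
      (𝓝 (∫ x, inner ℝ (β x) (w ν u x) ∂ν.meas)) := by
  have hB : 0 ≤ B := (norm_nonneg _).trans (hβB 0)
  have hint : ∀ μ ∈ PcOn (ball0 d n), ∀ ν ∈ PcOn (ball0 d n), ∀ u : U,
      Integrable (fun x => inner ℝ (β x) (w μ u x)) ν.meas := by
    intro μ hμ ν hν u
    refine Integrable.of_bound (hβc.aestronglyMeasurable.inner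
      (h.aestronglyMeasurable hμ u hν)) (B * (m * (1 + 2 * n))) ?_
    filter_upwards [mem_PcOn_ball.1 hν] with x hx
    refine (norm_inner_le_norm _ _).trans ?_
    exact mul_le_mul (hβB x) (h.norm_le hm hμ hx u) (norm_nonneg _) hB
  have t1 : Tendsto (fun i => ∫ x, inner ℝ (β x) (w ν (us i) x) ∂ν.meas) F
      (𝓝 (∫ x, inner ℝ (β x) (w ν u x) ∂ν.meas)) := by
    refine tendsto_integral_filter_of_dominated_convergence (fun _ => B * (m * (1 + 2 * n)))
      (Eventually.of_forall fun i => (hint ν hν ν hν (us i)).1) (Eventually.of_forall fun i => ?_)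
      (integrable_const _) (Eventually.of_forall fun x => ?_)
    · filter_upwards [mem_PcOn_ball.1 hν] with x hx
      refine (norm_inner_le_norm _ _).trans ?_
      exact mul_le_mul (hβB x) (h.norm_le hm hν hx _) (norm_nonneg _) hB
    · exact tendsto_const_nhds.inner (((h.cont ν x).tendsto u).comp h2)
  have t2 : Tendsto (fun i => ∫ x, inner ℝ (β x) (w (νs i) (us i) x) ∂(νs i).meas
      - ∫ x, inner ℝ (β x) (w ν (us i) x) ∂ν.meas) F (𝓝 0) := by
    refine squeeze_zero_norm' (a := fun i =>
      (B * (l n) + (B * (m * (1 + 2 * n)) + B * l n)) * Wp 1 (νs i) ν) ?_ ?_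
    · filter_upwards [hνs] with i hi
      have e1 : ‖∫ x, inner ℝ (β x) (w (νs i) (us i) x) ∂(νs i).meas
          - ∫ x, inner ℝ (β x) (w ν (us i) x) ∂(νs i).meas‖ ≤ B * (l n) * Wp 1 (νs i) ν := by
        rw [← integral_sub (hint _ hi _ hi _) (hint _ hν _ hi _)]
        have := norm_integral_le_of_norm_le_const (μ := (νs i).meas)
          (f := fun x => inner ℝ (β x) (w (νs i) (us i) x) - inner ℝ (β x) (w ν (us i) x))
          (C := B * (l n) * Wp 1 (νs i) ν) (by
            filter_upwards [mem_PcOn_ball.1 hi] with x hx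
            rw [← inner_sub_right]
            refine (norm_inner_le_norm _ _).trans ?_
            have := h.lip n (us i) _ hi _ hν x x hx hx
            rw [sub_self, norm_zero, zero_add] at this
            rw [mul_assoc]
            exact mul_le_mul (hβB x) this (norm_nonneg _) hB)
        simpa using this
      have e2 : |∫ x, inner ℝ (β x) (w ν (us i) x) ∂(νs i).meas
          - ∫ x, inner ℝ (β x) (w ν (us i) x) ∂ν.meas|
          ≤ (B * (m * (1 + 2 * n)) + B * l n) * Wp 1 (νs i) ν := by
        have hn := hl n
        refine abs_integral_sub_le_Wp_one (S := ball0 d n) (by positivity)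
          (by filter_upwards [mem_PcOn_ball.1 hi] with x hx; simpa using hx)
          (by filter_upwards [mem_PcOn_ball.1 hν] with x hx; simpa using hx) ?_
          (hint _ hν _ hi _) (hint _ hν _ hν _)
        intro x hx y hy
        have hx' : ‖x‖ ≤ n := by simpa using hx
        have hy' : ‖y‖ ≤ n := by simpa using hy
        have e3 : inner ℝ (β x) (w ν (us i) x) - inner ℝ (β y) (w ν (us i) y)
            = inner ℝ (β x - β y) (w ν (us i) x)
              + inner ℝ (β y) (w ν (us i) x - w ν (us i) y) := by
          rw [inner_sub_left, inner_sub_right]; ring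
        rw [e3]
        refine (abs_add_le _ _).trans ?_
        have e4 := (abs_real_inner_le_norm (β x - β y) (w ν (us i) x)).trans
          (mul_le_mul (hβL x y) (h.norm_le hm hν hx' (us i)) (norm_nonneg _) (by positivity))
        have e5 := (abs_real_inner_le_norm (β y) (w ν (us i) x - w ν (us i) y)).trans
          (mul_le_mul (hβB y) (h.lip_space hν hx' hy' (us i)) (norm_nonneg _) hB)
        nlinarith
      calc _ = ‖(∫ x, inner ℝ (β x) (w (νs i) (us i) x) ∂(νs i).meas
          - ∫ x, inner ℝ (β x) (w ν (us i) x) ∂(νs i).meas) +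
          (∫ x, inner ℝ (β x) (w ν (us i) x) ∂(νs i).meas
          - ∫ x, inner ℝ (β x) (w ν (us i) x) ∂ν.meas)‖ := by rw [sub_add_sub_cancel]
        _ ≤ _ := (norm_add_le _ _).trans (by rw [Real.norm_eq_abs] at *; rw [Real.norm_eq_abs]; linarith)
    · simpa using h1.const_mul _
  simpa using t2.add t1

/-- The hypotheses on a curve of measures used for measurability: on the set `S` of times, the
measures are concentrated on the ball of radius `n`, and the curve is `W_1`-continuous. -/
structure BddCurve (S : Set ℝ) (n : ℕ) (ν : ℝ → Pc d) : Prop where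
  mem : ∀ s ∈ S, ν s ∈ PcOn (ball0 d n)
  cont : ∀ t ∈ S, Tendsto (fun s => Wp 1 (ν s) (ν t)) (𝓝[S] t) (𝓝 0)

lemma tendsto_fst_prod_univ {S : Set ℝ} (p : ℝ × U) :
    Tendsto Prod.fst (𝓝[S ×ˢ (univ : Set U)] p) (𝓝[S] p.1) := by
  rcases p with ⟨a, b⟩
  rw [nhdsWithin_prod_eq]
  exact tendsto_fst

variable [MeasurableSpace U] [BorelSpace U] [SecondCountableTopology U]
  {T : ℝ} {v : ℝ → Pc d → U → E d → E d} {m : ℝ → ℝ} {l : ℕ → ℝ → ℝ}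

lemma Carath.aestronglyMeasurable_comp (hC : Carath T v m l) {S : Set ℝ} (hS : MeasurableSet S)
    (hST : S ⊆ Icc 0 T) {u : ℝ → U} (hu : AEMeasurable u (leb T)) {n : ℕ} {ν : ℝ → Pc d}
    (hν : BddCurve S n ν) {x : ℝ → E d} (hx : ContinuousOn x S) (hxn : ∀ s ∈ S, ‖x s‖ ≤ n) :
    AEStronglyMeasurable (fun t => v t (ν t) (u t) (x t)) (volume.restrict S) := by
  have hle : volume.restrict S ≤ leb T := Measure.restrict_mono hST le_rfl
  refine aestronglyMeasurable_comp_of_continuousWithinAt (Y := ℝ × U)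
    (f := fun p t => v t (ν p.1) p.2 (x p.1)) (y := fun t => (t, u t)) (s := S ×ˢ univ)
    (aemeasurable_id.prodMk (hu.mono_measure hle)) ?_ ?_ ?_
  · filter_upwards [ae_restrict_mem hS] with t ht using ⟨ht, mem_univ _⟩
  · rintro ⟨s, u'⟩ hs
    exact ((hC.meas u' (ν s) (x s)).mono_measure hle).aestronglyMeasurable
  · filter_upwards [ae_mono hle hC.good, ae_restrict_mem hS] with t ht htS
    have hfst := tendsto_fst_prod_univ (S := S) (t, u t)
    refine ht.tendsto (n := n) ?_ (hν.mem t htS) ?_ (hxn t htS) ((hν.cont t htS).comp hfst) ?_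
      ((hx t htS).tendsto.comp hfst)
    · filter_upwards [self_mem_nhdsWithin] with p hp using hν.mem _ hp.1
    · filter_upwards [self_mem_nhdsWithin] with p hp using hxn _ hp.1
    · exact (continuous_snd.tendsto (t, u t)).mono_left nhdsWithin_le_nhds

lemma Carath.aestronglyMeasurable_prod (hC : Carath T v m l) {S : Set ℝ} (hST : S ⊆ Icc 0 T)
    {n : ℕ} {μ : Pc d} (hμ : μ ∈ PcOn (ball0 d n)) (u : U) :
    AEStronglyMeasurable (fun z : ℝ × E d => v z.1 μ u z.2)
      ((volume.restrict S).prod μ.meas) := by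
  have hle : volume.restrict S ≤ leb T := Measure.restrict_mono hST le_rfl
  refine aestronglyMeasurable_comp_of_continuousWithinAt (Y := E d)
    (f := fun p (z : ℝ × E d) => v z.1 μ u p) (y := fun z => z.2) (s := ball0 d n)
    measurable_snd.aemeasurable ?_ ?_ ?_
  · refine Measure.quasiMeasurePreserving_snd.ae ?_
    filter_upwards [mem_PcOn_ball.1 hμ] with x hx
    simpa using hx
  · intro x _
    exact ((hC.meas u μ x).mono_measure hle).aestronglyMeasurable.comp_fst
  · have h1 : ∀ᵐ z ∂((volume.restrict S).prod μ.meas), GoodTime (v z.1) (m z.1)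
        (fun n => l n z.1) := Measure.quasiMeasurePreserving_fst.ae (ae_mono hle hC.good)
    have h2 : ∀ᵐ z ∂((volume.restrict S).prod μ.meas), ‖z.2‖ ≤ n :=
      Measure.quasiMeasurePreserving_snd.ae (mem_PcOn_ball.1 hμ)
    filter_upwards [h1, h2] with z hz1 hz2
    refine hz1.tendsto (n := n) (νs := fun _ => μ) (us := fun _ => u)
      (Eventually.of_forall fun _ => hμ) hμ ?_ hz2
      (by simp only [Wp_one_self]; exact tendsto_const_nhds) tendsto_const_nhds
      (tendsto_id.mono_left nhdsWithin_le_nhds)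
    filter_upwards [self_mem_nhdsWithin] with p hp
    simpa using hp

lemma Carath.aestronglyMeasurable_integral_inner (hC : Carath T v m l) {S : Set ℝ}
    (hS : MeasurableSet S) (hST : S ⊆ Icc 0 T) {u : ℝ → U} (hu : AEMeasurable u (leb T)) {n : ℕ}
    {ν : ℝ → Pc d} (hν : BddCurve S n ν) {β : E d → E d} {B : ℝ} (hβc : Continuous β)
    (hβB : ∀ x, ‖β x‖ ≤ B) (hβL : ∀ x y, ‖β x - β y‖ ≤ B * ‖x - y‖) :
    AEStronglyMeasurable (fun t => ∫ x, inner ℝ (β x) (v t (ν t) (u t) x) ∂(ν t).meas)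
      (volume.restrict S) := by
  have hle : volume.restrict S ≤ leb T := Measure.restrict_mono hST le_rfl
  refine aestronglyMeasurable_comp_of_continuousWithinAt (Y := ℝ × U)
    (f := fun p t => ∫ x, inner ℝ (β x) (v t (ν p.1) p.2 x) ∂(ν p.1).meas)
    (y := fun t => (t, u t)) (s := S ×ˢ univ)
    (aemeasurable_id.prodMk (hu.mono_measure hle)) ?_ ?_ ?_
  · filter_upwards [ae_restrict_mem hS] with t ht using ⟨ht, mem_univ _⟩
  · rintro ⟨s, u'⟩ hs
    have := hC.aestronglyMeasurable_prod hST (hν.mem s hs.1) u'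
    have h2 : AEStronglyMeasurable (fun z : ℝ × E d => inner ℝ (β z.2) (v z.1 (ν s) u' z.2))
        ((volume.restrict S).prod (ν s).meas) :=
      (hβc.aestronglyMeasurable.comp_snd).inner this
    exact h2.integral_prod_right'
  · filter_upwards [ae_mono hle hC.good, ae_restrict_mem hS] with t ht htS
    have hfst := tendsto_fst_prod_univ (S := S) (t, u t)
    refine ht.tendsto_integral_inner (n := n) (hC.m_nonneg t) (fun n => hC.l_nonneg n t) ?_
      (hν.mem t htS) ((hν.cont t htS).comp hfst) ?_ hβc hβB hβL
    · filter_upwards [self_mem_nhdsWithin] with p hp using hν.mem _ hp.1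
    · exact (continuous_snd.tendsto (t, u t)).mono_left nhdsWithin_le_nhds

end velocity

/-! ### From distributions to absolutely continuous pairings -/

lemma contDiff_smoothStep (n : ℕ) (s : ℝ) :
    ContDiff ℝ ∞ (fun r : ℝ => Real.smoothTransition ((n + 1) * (r - s))) :=
  Real.smoothTransition.contDiff.comp (by fun_prop)

lemma tendsto_smoothStep {s r : ℝ} (h : s < r) :
    ∀ᶠ n : ℕ in atTop, Real.smoothTransition ((n + 1) * (r - s)) = 1 := by
  obtain ⟨N, hN⟩ := exists_nat_gt (1 / (r - s))
  filter_upwards [eventually_ge_atTop N] with n hn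
  refine Real.smoothTransition.one_of_one_le ?_
  have h0 : 0 < r - s := sub_pos.2 h
  rw [div_lt_iff₀ h0] at hN
  have : (N : ℝ) ≤ n := by exact_mod_cast hn
  nlinarith

lemma smoothStep_eq_zero {s r : ℝ} (n : ℕ) (h : r ≤ s) :
    Real.smoothTransition ((n + 1) * (r - s)) = 0 :=
  Real.smoothTransition.zero_of_nonpos
    (mul_nonpos_of_nonneg_of_nonpos (by positivity) (by linarith))

/-- The derivatives of the smooth steps at `s` are an approximation of the Dirac mass at `s`. -/
lemma tendsto_integral_deriv_smoothStep {f : ℝ → ℝ} {a b s : ℝ} (hs : s ∈ Ioo a b)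
    (hf : ContinuousOn f (Icc a b)) :
    Tendsto (fun n : ℕ => ∫ r in Icc a b,
      deriv (fun r : ℝ => Real.smoothTransition ((n + 1) * (r - s))) r * f r) atTop (𝓝 (f s)) := by
  have hab : a ≤ b := (hs.1.trans hs.2).le
  refine tendsto_setIntegral_peak_smul_of_integrableOn_of_tendsto (t := Icc a b)
    (x₀ := s) measurableSet_Icc measurableSet_Icc subset_rfl self_mem_nhdsWithin
    measure_Icc_lt_top.ne ?_ ?_ ?_ ?_ (hf.integrableOn_Icc) (hf s (Ioo_subset_Icc_self hs))
  · refine Eventually.of_forall fun n x _ => Monotone.deriv_nonneg ?_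
    exact Real.smoothTransition.monotone.comp fun x y hxy => by gcongr
  · intro u hu hsu
    obtain ⟨δ, hδ, hδu⟩ := Metric.isOpen_iff.1 hu s hsu
    obtain ⟨N, hN⟩ := exists_nat_gt (1 / δ)
    refine Metric.tendstoUniformlyOn_iff.2 fun ε hε => ?_
    filter_upwards [eventually_ge_atTop N] with n hn x hx
    have hNn : (N : ℝ) ≤ n := by exact_mod_cast hn
    have hn1 : 1 < (n + 1) * δ := by
      rw [div_lt_iff₀ hδ] at hN; nlinarith
    have hxs : δ ≤ |x - s| := by
      by_contra hcon
      exact hx.2 (hδu (by rw [Metric.mem_ball, Real.dist_eq]; exact not_le.1 hcon))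
    have h0 : deriv (fun r : ℝ => Real.smoothTransition ((n + 1) * (r - s))) x = 0 := by
      rcases le_total 0 (x - s) with h | h
      · rw [abs_of_nonneg h] at hxs
        have : (fun r : ℝ => Real.smoothTransition ((n + 1) * (r - s))) =ᶠ[𝓝 x] fun _ => 1 := by
          have hc : Continuous fun r : ℝ => ((n : ℝ) + 1) * (r - s) := by fun_prop
          have h2 : (1 : ℝ) < (n + 1) * (x - s) := by nlinarith
          filter_upwards [hc.continuousAt.eventually_const_lt h2] with r hr
          exact Real.smoothTransition.one_of_one_le hr.le
        rw [this.deriv_eq]; simp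
      · rw [abs_of_nonpos h] at hxs
        have : (fun r : ℝ => Real.smoothTransition ((n + 1) * (r - s))) =ᶠ[𝓝 x] fun _ => 0 := by
          filter_upwards [eventually_lt_nhds (by linarith : x < s)] with r hr
          exact smoothStep_eq_zero n hr.le
        rw [this.deriv_eq]; simp
    rw [h0]; simpa using hε
  · refine tendsto_const_nhds.congr' ?_
    filter_upwards [tendsto_smoothStep hs.2] with n hn
    have hc := contDiff_smoothStep n s
    rw [integral_Icc_eq_integral_Ioc, ← intervalIntegral.integral_of_le hab,
      intervalIntegral.integral_deriv_eq_sub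
        (fun x _ => (hc.differentiable (by simp)).differentiableAt)
        ((hc.continuous_deriv (by simp)).intervalIntegrable _ _), hn,
      smoothStep_eq_zero n hs.1.le, sub_zero]
  · exact Eventually.of_forall fun n =>
      ((contDiff_smoothStep n s).continuous_deriv (by simp)).aestronglyMeasurable

/-- A continuous function with an integrable distributional derivative is its primitive. -/
lemma sub_eq_integral_of_weak_deriv {f g : ℝ → ℝ} {a b : ℝ}
    (hf : ContinuousOn f (Icc a b)) (hg : IntegrableOn g (Icc a b))
    (h : ∀ η : ℝ → ℝ, ContDiff ℝ ∞ η → HasCompactSupport η → tsupport η ⊆ Ioo a b →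
      ∫ r in Icc a b, (deriv η r * f r + η r * g r) = 0)
    {s t : ℝ} (hs : s ∈ Icc a b) (ht : t ∈ Icc a b) : f t - f s = ∫ r in s..t, g r := by
  rcases eq_or_lt_of_le (hs.1.trans hs.2) with hab | hab
  · have e1 : s = a := le_antisymm (hs.2.trans hab.ge) hs.1
    have e2 : t = a := le_antisymm (ht.2.trans hab.ge) ht.1
    subst e1; subst e2; simp
  have hgi : ∀ x ∈ Icc a b, ∀ y ∈ Icc a b, IntervalIntegrable g volume x y := fun x hx y hy =>
    (hg.mono_set (by rw [uIcc_of_le hab.le]) :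
      IntegrableOn g (uIcc a b) volume).intervalIntegrable.mono_set
      (by rw [uIcc_of_le hab.le]; exact uIcc_subset_Icc hx hy)
  -- The difference of two smooth steps approximates the indicator function of `Ioc s t`.
  have key : ∀ s ∈ Ioo a b, ∀ t ∈ Ioo a b, s < t → f t - f s = ∫ r in s..t, g r := by
    intro s hs t ht hst
    set θ : ℕ → ℝ → ℝ → ℝ := fun n s r => Real.smoothTransition ((n + 1) * (r - s)) with hθ
    have hθc : ∀ n s, ContDiff ℝ ∞ (θ n s) := fun n s => contDiff_smoothStep n s
    have hθd : ∀ n s, Differentiable ℝ (θ n s) := fun n s => (hθc n s).differentiable (by simp)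
    have h1 := tendsto_integral_deriv_smoothStep hs hf
    have h2 := tendsto_integral_deriv_smoothStep ht hf
    have h3 : Tendsto (fun n : ℕ => ∫ r in Icc a b, (θ n s r - θ n t r) * g r) atTop
        (𝓝 (∫ r in Icc a b, (Ioc s t).indicator g r)) := by
      refine tendsto_integral_of_dominated_convergence (fun r => 2 * ‖g r‖) (fun n => ?_)
        (hg.norm.const_mul 2) (fun n => Eventually.of_forall fun r => ?_)
        (Eventually.of_forall fun r => ?_)
      · exact ((hθc n s).continuous.sub (hθc n t).continuous).aestronglyMeasurable.mul hg.1
      · rw [norm_mul]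
        refine mul_le_mul_of_nonneg_right ?_ (norm_nonneg _)
        have e1 := Real.smoothTransition.nonneg ((n + 1) * (r - s))
        have e2 := Real.smoothTransition.nonneg ((n + 1) * (r - t))
        have e3 := Real.smoothTransition.le_one ((n + 1) * (r - s))
        have e4 := Real.smoothTransition.le_one ((n + 1) * (r - t))
        simp only [hθ]
        rw [Real.norm_eq_abs, abs_le]; constructor <;> linarith
      · refine tendsto_const_nhds.congr' ?_
        rcases le_or_gt r s with hr | hr
        · refine Eventually.of_forall fun n => ?_
          simp only [hθ]
          rw [smoothStep_eq_zero n hr, smoothStep_eq_zero n (hr.trans hst.le),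
            indicator_of_notMem (by simp [hr])]
          simp
        rcases le_or_gt r t with hrt | hrt
        · filter_upwards [tendsto_smoothStep hr] with n hn
          simp only [hθ]
          have hmem : r ∈ Ioc s t := ⟨hr, hrt⟩
          rw [hn, smoothStep_eq_zero n hrt, indicator_of_mem hmem]
          simp
        · filter_upwards [tendsto_smoothStep hr, tendsto_smoothStep hrt] with n hn hn2
          simp only [hθ]
          rw [hn, hn2, indicator_of_notMem (by simp [hrt])]
          simp
    have h4 : ∀ᶠ n : ℕ in atTop, (∫ r in Icc a b, deriv (θ n s) r * f r)
        - (∫ r in Icc a b, deriv (θ n t) r * f r)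
        + ∫ r in Icc a b, (θ n s r - θ n t r) * g r = 0 := by
      set t' := (t + b) / 2 with ht'
      have htt' : t < t' := by rw [ht']; linarith [ht.2]
      have ht'b : t' < b := by rw [ht']; linarith [ht.2]
      filter_upwards [tendsto_smoothStep htt', tendsto_smoothStep (hst.trans htt')] with n hn hn2
      have hsupp : tsupport (fun r => θ n s r - θ n t r) ⊆ Icc s t' := by
        refine closure_minimal (fun r hr => ?_) isClosed_Icc
        by_contra hcon
        refine hr ?_
        simp only [hθ]
        rcases lt_or_ge r s with h | h
        · rw [smoothStep_eq_zero n h.le, smoothStep_eq_zero n (h.le.trans hst.le), sub_self]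
        · have hrt : t' < r := by
            by_contra h'; exact hcon ⟨h, not_lt.1 h'⟩
          have mono : ∀ x, Real.smoothTransition ((n + 1) * (t' - x)) = 1 →
              Real.smoothTransition ((n + 1) * (r - x)) = 1 := fun x hx =>
            le_antisymm (Real.smoothTransition.le_one _)
              (hx.symm.le.trans (Real.smoothTransition.monotone
                (mul_le_mul_of_nonneg_left (by linarith) (by positivity))))
          rw [mono _ hn, mono _ hn2, sub_self]
      have h5 := h (fun r => θ n s r - θ n t r) ((hθc n s).sub (hθc n t))
        (HasCompactSupport.of_support_subset_isCompact isCompact_Icc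
          ((subset_tsupport _).trans hsupp))
        (hsupp.trans (Icc_subset_Ioo hs.1 ht'b))
      have i1 : ∀ s, IntegrableOn (fun r => deriv (θ n s) r * f r) (Icc a b) := fun s =>
        (((hθc n s).continuous_deriv (by simp)).continuousOn.mul hf).integrableOn_Icc
      have i2 : IntegrableOn (fun r => (θ n s r - θ n t r) * g r) (Icc a b) :=
        hg.continuousOn_mul ((hθc n s).continuous.sub (hθc n t).continuous).continuousOn
          isCompact_Icc
      have i3 := integral_add ((i1 s).sub (i1 t)) i2
      simp only [Pi.sub_apply] at i3
      rw [← integral_sub (i1 s) (i1 t), ← i3, ← h5]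
      refine integral_congr_ae (Eventually.of_forall fun r => ?_)
      simp only
      rw [deriv_fun_sub (hθd n s r) (hθd n t r)]
      ring
    have h5 := ((h1.sub h2).add h3)
    have h6 := tendsto_nhds_unique h5 (tendsto_const_nhds.congr' (h4.mono fun n hn => hn.symm))
    rw [integral_indicator measurableSet_Ioc, Measure.restrict_restrict measurableSet_Ioc,
      inter_eq_left.2 (Ioc_subset_Icc_self.trans (Icc_subset_Icc hs.1.le ht.2.le)),
      ← intervalIntegral.integral_of_le hst.le] at h6
    linarith
  set F : ℝ → ℝ := fun t => f t - ∫ r in a..t, g r with hF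
  have haI : a ∈ Icc a b := left_mem_Icc.2 hab.le
  have hFc : ContinuousOn F (Icc a b) := by
    refine hf.sub ?_
    have := intervalIntegral.continuousOn_primitive_interval (a := a) (b := b) (f := g)
      (μ := volume) (by rwa [uIcc_of_le hab.le])
    rwa [uIcc_of_le hab.le] at this
  set c := (a + b) / 2 with hc
  have hcI : c ∈ Ioo a b := ⟨by rw [hc]; linarith, by rw [hc]; linarith⟩
  have hconst : EqOn F (fun _ => F c) (Ioo a b) := by
    intro r hr
    have hadd : ∀ x ∈ Icc a b, ∀ y ∈ Icc a b,
        (∫ z in a..x, g z) + ∫ z in x..y, g z = ∫ z in a..y, g z := fun x hx y hy =>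
      intervalIntegral.integral_add_adjacent_intervals (hgi a haI x hx) (hgi x hx y hy)
    simp only [hF]
    rcases lt_trichotomy r c with h1 | h1 | h1
    · have := key r hr c hcI h1
      have := hadd r (Ioo_subset_Icc_self hr) c (Ioo_subset_Icc_self hcI)
      linarith
    · rw [h1]
    · have := key c hcI r hr h1
      have := hadd c (Ioo_subset_Icc_self hcI) r (Ioo_subset_Icc_self hr)
      linarith
  have hconst2 : EqOn F (fun _ => F c) (Icc a b) :=
    hconst.of_subset_closure hFc continuousOn_const Ioo_subset_Icc_self
      (by rw [closure_Ioo hab.ne])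
  have h1 := hconst2 hs
  have h2 := hconst2 ht
  simp only [hF] at h1 h2
  have := intervalIntegral.integral_add_adjacent_intervals (hgi a haI s hs) (hgi s hs t ht)
  linarith

/-! ### Integrals along a continuous curve of measures -/

lemma integrable_of_continuous (μ : Pc d) {F : Type*} [NormedAddCommGroup F]
    {f : E d → F} (hf : Continuous f) : Integrable f μ.meas := by
  obtain ⟨R, -, hR⟩ := exists_mem_PcOn_ball μ
  obtain ⟨C, hC⟩ := (isCompact_closedBall (0 : E d) R).exists_bound_of_continuousOn hf.continuousOn
  refine Integrable.of_bound hf.aestronglyMeasurable C ?_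
  filter_upwards [mem_PcOn_ball.1 hR] with x hx
  exact hC x (by simpa using hx)

lemma continuousOn_integral_of_lipschitz {S : Set ℝ} {μ : ℝ → Pc d}
    (hμ : ∀ t ∈ S, Tendsto (fun s => Wp 1 (μ s) (μ t)) (𝓝[S] t) (𝓝 0)) {f : E d → ℝ}
    (hfc : Continuous f) {L : ℝ} (hL : 0 ≤ L) (hf : ∀ x y, |f x - f y| ≤ L * ‖x - y‖) :
    ContinuousOn (fun t => ∫ x, f x ∂(μ t).meas) S := by
  intro t ht
  refine tendsto_iff_norm_sub_tendsto_zero.2 ?_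
  refine squeeze_zero (g := fun s => L * Wp 1 (μ s) (μ t)) (fun _ => norm_nonneg _)
    (fun s => ?_) (by simpa using (hμ t ht).const_mul L)
  exact abs_integral_sub_le_Wp_one (S := univ) hL (by simp) (by simp)
    (fun x _ y _ => hf x y) (integrable_of_continuous _ hfc) (integrable_of_continuous _ hfc)

lemma ContDiff.exists_lipschitz_of_hasCompactSupport {V W : Type*} [NormedAddCommGroup V]
    [NormedSpace ℝ V] [NormedAddCommGroup W] [NormedSpace ℝ W] {f : V → W} (hf : ContDiff ℝ ∞ f)
    (hc : HasCompactSupport f) : ∃ L : ℝ, 0 ≤ L ∧ ∀ x y, ‖f x - f y‖ ≤ L * ‖x - y‖ := by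
  obtain ⟨K, hK⟩ := ContDiff.lipschitzWith_of_hasCompactSupport (𝕂 := ℝ) hc hf (by simp)
  exact ⟨K, K.2, fun x y => by simpa [dist_eq_norm] using hK.dist_le_mul x y⟩

/-- Concentration on the ball means that the integral of the Lipschitz function `max (‖x‖ - R) 0`
vanishes. -/
lemma isClosed_setOf_mem_PcOn {a b R : ℝ} {μ : ℝ → Pc d}
    (hμ : ∀ t ∈ Icc a b, Tendsto (fun s => Wp 1 (μ s) (μ t)) (𝓝[Icc a b] t) (𝓝 0)) :
    IsClosed {t | t ∈ Icc a b ∧ μ t ∈ PcOn (ball0 d R)} := by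
  have hfc : Continuous (fun x : E d => max (‖x‖ - R) 0) := by fun_prop
  have h1 := continuousOn_integral_of_lipschitz hμ hfc zero_le_one (fun x y => by
    have h1 : |max (‖x‖ - R) 0 - max (‖y‖ - R) 0| ≤ |‖x‖ - R - (‖y‖ - R)| := by
      refine (abs_max_sub_max_le_max _ _ _ _).trans ?_
      simp
    rw [one_mul]
    refine h1.trans ?_
    rw [sub_sub_sub_cancel_right]
    exact abs_norm_sub_norm_le x y)
  have h2 := h1.preimage_isClosed_of_isClosed isClosed_Icc (isClosed_singleton (x := (0 : ℝ)))
  convert h2 using 1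
  ext t
  simp only [mem_ofPred_eq, mem_inter_iff, mem_preimage, mem_singleton_iff]
  refine and_congr_right fun _ => ?_
  have h3 := integral_eq_zero_iff_of_nonneg (f := fun x : E d => max (‖x‖ - R) 0)
    (fun x => le_max_right _ _) (integrable_of_continuous (μ t) hfc)
  rw [h3, mem_PcOn_ball]
  refine ⟨fun h => ?_, fun h => ?_⟩
  · filter_upwards [h] with x hx
    simp only [Pi.zero_apply]
    exact max_eq_right (by linarith)
  · filter_upwards [h] with x hx
    simp only [Pi.zero_apply] at hx
    have := le_max_left (‖x‖ - R) 0
    linarith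

/-! ### The weak formulation tested against functions of the space variable -/

/-- `μ` solves the continuity equation driven by `w`, tested against functions of `x` only. -/
structure TestSolves (a b : ℝ) (w : ℝ → E d → E d) (μ : ℝ → Pc d) : Prop where
  integrable : ∀ ψ : E d → ℝ, ContDiff ℝ ∞ ψ → HasCompactSupport ψ →
    IntegrableOn (fun r => ∫ x, fderiv ℝ ψ x (w r x) ∂(μ r).meas) (Icc a b)
  eq : ∀ ψ : E d → ℝ, ContDiff ℝ ∞ ψ → HasCompactSupport ψ → ∀ s ∈ Icc a b, ∀ t ∈ Icc a b,
    ∫ x, ψ x ∂(μ t).meas - ∫ x, ψ x ∂(μ s).meas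
      = ∫ r in s..t, ∫ x, fderiv ℝ ψ x (w r x) ∂(μ r).meas

section test

variable {U : Type*} [MetricSpace U] [MeasurableSpace U] [BorelSpace U]
  [SecondCountableTopology U] {T : ℝ} {v : ℝ → Pc d → U → E d → E d} {m : ℝ → ℝ}
  {l : ℕ → ℝ → ℝ} {τ : ℝ} {u : ℝ → U} {μ : ℝ → Pc d}

lemma SolvesContinuityEq.exists_moment_bound {w : ℝ → Pc d → E d → E d}
    (hμ : SolvesContinuityEq τ T w μ) :
    ∃ M, 0 ≤ M ∧ ∀ t ∈ Icc τ T, ∫ y, ‖y‖ ∂(μ t).meas ≤ M := by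
  have h1 := continuousOn_integral_of_lipschitz hμ.1 continuous_norm zero_le_one
    (fun x y => by rw [one_mul]; exact abs_norm_sub_norm_le x y)
  obtain ⟨M, hM⟩ := isCompact_Icc.exists_bound_of_continuousOn h1
  refine ⟨max M 0, le_max_right _ _, fun t ht => ?_⟩
  exact (le_abs_self _).trans ((hM t ht).trans (le_max_left _ _))

/-- The continuity equation is tested with products `η t * ψ x`. Measurability in time is proved on
the closed sets of times at which the measure is concentrated on a given ball, as no common bound on
the supports is available yet. -/
lemma Carath.testSolves (hC : Carath T v m l) (hτ : 0 ≤ τ) (hu : AEMeasurable u (leb T))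
    (hμ : SolvesContinuityEq τ T (fun t ν x => v t ν (u t) x) μ) :
    TestSolves τ T (fun t x => v t (μ t) (u t) x) μ := by
  obtain ⟨M, hM0, hM⟩ := hμ.exists_moment_bound
  have hsub : Icc τ T ⊆ Icc 0 T := Icc_subset_Icc_left hτ
  have hle : volume.restrict (Icc τ T) ≤ leb T := Measure.restrict_mono hsub le_rfl
  have hint : ∀ ψ : E d → ℝ, ContDiff ℝ ∞ ψ → HasCompactSupport ψ →
      ∀ᵐ t ∂(volume.restrict (Icc τ T)),
        Integrable (fun x => fderiv ℝ ψ x (v t (μ t) (u t) x)) (μ t).meas := by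
    intro ψ hψ hψc
    filter_upwards [ae_mono hle hC.good] with t ht
    obtain ⟨R, -, hR⟩ := exists_mem_PcOn_ball (μ t)
    obtain ⟨n, hn⟩ := exists_nat_ge R
    have hR' := PcOn_ball_mono hn hR
    have hfc : Continuous (fderiv ℝ ψ) := hψ.continuous_fderiv (by simp)
    obtain ⟨C, hCb⟩ := (hψc.fderiv (𝕜 := ℝ)).exists_bound_of_continuous hfc
    refine Integrable.of_bound (C := C * (m t * (1 + 2 * n))) ?_ ?_
    · exact isBoundedBilinearMap_apply.continuous.comp_aestronglyMeasurable
        (hfc.aestronglyMeasurable.prodMk (ht.aestronglyMeasurable hR' (u t) hR'))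
    · filter_upwards [mem_PcOn_ball.1 hR'] with x hx
      refine (ContinuousLinearMap.le_opNorm _ _).trans ?_
      exact mul_le_mul (hCb x) (ht.norm_le (hC.m_nonneg t) hR' hx _) (norm_nonneg _)
        ((norm_nonneg _).trans (hCb x))
  have hI : ∀ ψ : E d → ℝ, ContDiff ℝ ∞ ψ → HasCompactSupport ψ →
      IntegrableOn (fun r => ∫ x, fderiv ℝ ψ x (v r (μ r) (u r) x) ∂(μ r).meas) (Icc τ T) := by
    intro ψ hψ hψc
    have hfc : Continuous (fderiv ℝ ψ) := hψ.continuous_fderiv (by simp)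
    have hgs : ContDiff ℝ ∞ (fderiv ℝ ψ) := hψ.fderiv_right (by simp)
    obtain ⟨C1, hC1⟩ := (hψc.fderiv (𝕜 := ℝ)).exists_bound_of_continuous hfc
    obtain ⟨C2, hC20, hC2⟩ := ContDiff.exists_lipschitz_of_hasCompactSupport hgs (hψc.fderiv (𝕜 := ℝ))
    have hgn : ∀ x, ‖∇ ψ x‖ = ‖fderiv ℝ ψ x‖ := fun x => by
      rw [← toDual_gradient]; exact ((InnerProductSpace.toDual ℝ (E d)).norm_map _).symm
    have hgn2 : ∀ x y, ‖∇ ψ x - ∇ ψ y‖ = ‖fderiv ℝ ψ x - fderiv ℝ ψ y‖ := fun x y => by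
      rw [← toDual_gradient, ← toDual_gradient, ← map_sub]
      exact ((InnerProductSpace.toDual ℝ (E d)).norm_map _).symm
    have hgc : Continuous (∇ ψ) :=
      ((InnerProductSpace.toDual ℝ (E d)).symm.continuous).comp hfc
    have hmeas : AEStronglyMeasurable
        (fun r => ∫ x, fderiv ℝ ψ x (v r (μ r) (u r) x) ∂(μ r).meas)
        (volume.restrict (Icc τ T)) := by
      have hcov : (⋃ n : ℕ, {t | t ∈ Icc τ T ∧ μ t ∈ PcOn (ball0 d n)}) = Icc τ T := by
        refine subset_antisymm (iUnion_subset fun n t ht => ht.1) fun t ht => ?_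
        obtain ⟨R, -, hR⟩ := exists_mem_PcOn_ball (μ t)
        obtain ⟨n, hn⟩ := exists_nat_ge R
        exact mem_iUnion.2 ⟨n, ht, PcOn_ball_mono hn hR⟩
      rw [← hcov, aestronglyMeasurable_iUnion_iff]
      intro n
      have hSc := isClosed_setOf_mem_PcOn (R := n) hμ.1
      have := hC.aestronglyMeasurable_integral_inner (n := n) hSc.measurableSet
        (fun t ht => hsub ht.1) hu (ν := μ) ⟨fun s hs => hs.2, fun t ht =>
          (hμ.1 t ht.1).mono_left (nhdsWithin_mono _ fun s hs => hs.1)⟩ (β := ∇ ψ)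
        (B := max C1 C2) hgc (fun x => by rw [hgn]; exact (hC1 x).trans (le_max_left _ _))
        (fun x y => by
          rw [hgn2]
          exact (hC2 x y).trans (mul_le_mul_of_nonneg_right (le_max_right _ _) (norm_nonneg _)))
      simpa only [inner_gradient_left] using this
    obtain ⟨C, hCb⟩ := (hψc.fderiv (𝕜 := ℝ)).norm.mul_right
      (f' := fun x : E d => 1 + ‖x‖ + M) |>.exists_bound_of_continuous
      (hfc.norm.mul (by fun_prop))
    refine Integrable.mono' (hC.m_int.integrableOn.const_mul C) hmeas ?_
    filter_upwards [ae_mono hle hC.good, ae_restrict_mem measurableSet_Icc] with t ht htI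
    have := norm_integral_le_of_norm_le_const (μ := (μ t).meas)
      (f := fun x => fderiv ℝ ψ x (v t (μ t) (u t) x)) (C := C * m t)
      (Eventually.of_forall fun x => by
        have h1 := (ContinuousLinearMap.le_opNorm (fderiv ℝ ψ x) (v t (μ t) (u t) x))
        have h2 := ht.growth (u t) (μ t) x
        have h3 := hM t htI
        have h4 : ‖fderiv ℝ ψ x‖ * (1 + ‖x‖ + M) ≤ C := (le_abs_self _).trans (hCb x)
        have h5 := hC.m_nonneg t
        calc _ ≤ ‖fderiv ℝ ψ x‖ * (m t * (1 + ‖x‖ + M)) := by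
              refine h1.trans (mul_le_mul_of_nonneg_left (h2.trans ?_) (norm_nonneg _))
              gcongr
          _ = (‖fderiv ℝ ψ x‖ * (1 + ‖x‖ + M)) * m t := by ring
          _ ≤ C * m t := mul_le_mul_of_nonneg_right h4 h5)
    simpa using this
  refine ⟨hI, fun ψ hψ hψc s hs t ht => ?_⟩
  obtain ⟨L, hL0, hL⟩ := ContDiff.exists_lipschitz_of_hasCompactSupport hψ hψc
  refine sub_eq_integral_of_weak_deriv (f := fun t => ∫ x, ψ x ∂(μ t).meas) (a := τ) (b := T)
    (continuousOn_integral_of_lipschitz hμ.1 hψ.continuous hL0 hL) (hI ψ hψ hψc) ?_ hs ht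
  intro η hη hηc hηs
  have hfst : tsupport (fun p : ℝ × E d => η p.1 * ψ p.2) ⊆ Prod.fst ⁻¹' (tsupport η) :=
    closure_minimal (fun q hq => subset_tsupport _ (left_ne_zero_of_mul hq))
      ((isClosed_tsupport η).preimage continuous_fst)
  have h1 := hμ.2 (fun p => η p.1 * ψ p.2) ((hη.comp contDiff_fst).mul (hψ.comp contDiff_snd))
    (HasCompactSupport.of_support_subset_isCompact (hηc.prod hψc) (fun p hp => by
      have : η p.1 * ψ p.2 ≠ 0 := hp
      exact ⟨subset_tsupport _ (left_ne_zero_of_mul this),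
        subset_tsupport _ (right_ne_zero_of_mul this)⟩))
    (fun p hp => ⟨hηs (hfst hp), mem_univ _⟩)
  rw [← h1]
  refine integral_congr_ae ?_
  filter_upwards [hint ψ hψ hψc] with r hr
  have e1 : ∀ x, deriv (fun s => η s * ψ x) r
      + inner ℝ (∇ (fun y => η r * ψ y) x) (v r (μ r) (u r) x)
      = deriv η r * ψ x + η r * fderiv ℝ ψ x (v r (μ r) (u r) x) := by
    intro x
    rw [inner_gradient_left, deriv_mul_const ((hη.differentiable (by simp)) r),
      fderiv_const_mul ((hψ.differentiable (by simp)) x)]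
    simp
  simp only [e1]
  rw [integral_add ((integrable_of_continuous _ hψ.continuous).const_mul _) (hr.const_mul _),
    integral_const_mul, integral_const_mul]

end test

/-! ### Test functions transported along absolutely continuous parameters -/

lemma exists_norm_mul_le_of_hasCompactSupport {V W : Type*} [TopologicalSpace V]
    [NormedAddCommGroup W] {f : V → W} (hf : Continuous f) (hc : HasCompactSupport f) {g : V → ℝ}
    (hg : Continuous g) : ∃ C, ∀ z, ‖f z‖ * g z ≤ C := by
  have h1 : HasCompactSupport (fun z => ‖f z‖ * g z) := hc.norm.mul_right
  obtain ⟨C, hC⟩ := h1.exists_bound_of_continuous (hf.norm.mul hg)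
  exact ⟨C, fun z => (Real.le_norm_self _).trans (hC z)⟩

lemma exists_norm_fderiv_mul_le_of_hasCompactSupport {V W : Type*} [NormedAddCommGroup V]
    [NormedSpace ℝ V] [NormedAddCommGroup W] [NormedSpace ℝ W] {f : V → W} (hf : ContDiff ℝ ∞ f)
    (hc : HasCompactSupport f) {g : V → ℝ} (hg : Continuous g) :
    ∃ C, ∀ z, ‖fderiv ℝ f z‖ * g z ≤ C :=
  exists_norm_mul_le_of_hasCompactSupport (hf.continuous_fderiv (by simp))
    (hc.fderiv (𝕜 := ℝ)) hg

lemma TestSolves.abs_sub_le {a b : ℝ} {w : ℝ → E d → E d} {μ : ℝ → Pc d}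
    (h : TestSolves a b w μ) {κ : ℝ → ℝ} (hκ : Integrable κ)
    (hw : ∀ᵐ r ∂(volume.restrict (Icc a b)), ∀ x, ‖w r x‖ ≤ κ r * (1 + ‖x‖))
    {ψ : E d → ℝ} (hψ : ContDiff ℝ ∞ ψ) (hψc : HasCompactSupport ψ) {B : ℝ}
    (hB : ∀ x, ‖fderiv ℝ ψ x‖ * (1 + ‖x‖) ≤ B) {s t : ℝ} (hs : s ∈ Icc a b) (ht : t ∈ Icc a b)
    (hst : s ≤ t) :
    |∫ x, ψ x ∂(μ t).meas - ∫ x, ψ x ∂(μ s).meas| ≤ B * ∫ r in s..t, κ r := by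
  rw [h.eq ψ hψ hψc s hs t ht, ← intervalIntegral.integral_const_mul, ← Real.norm_eq_abs]
  refine intervalIntegral.norm_integral_le_of_norm_le hst ?_ (hκ.intervalIntegrable.const_mul B)
  have h2 := (ae_restrict_iff' measurableSet_Icc).1 hw
  filter_upwards [h2] with r hr hrI
  have hr' := hr ⟨hs.1.trans hrI.1.le, hrI.2.trans ht.2⟩
  have := norm_integral_le_of_norm_le_const (μ := (μ r).meas)
    (f := fun x => fderiv ℝ ψ x (w r x)) (C := B * κ r) (Eventually.of_forall fun x => by
      calc _ ≤ ‖fderiv ℝ ψ x‖ * ‖w r x‖ := ContinuousLinearMap.le_opNorm _ _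
        _ ≤ ‖fderiv ℝ ψ x‖ * (κ r * (1 + ‖x‖)) := by gcongr; exact hr' x
        _ = (‖fderiv ℝ ψ x‖ * (1 + ‖x‖)) * κ r := by ring
        _ ≤ B * κ r := by
          refine mul_le_mul_of_nonneg_right (hB x) ?_
          have h3 := (norm_nonneg _).trans (hr' 0)
          simpa using h3)
  simpa using this

set_option maxHeartbeats 1600000 in
/-- If the smooth function `q` of a parameter and of the point is nondecreasing along the parameter
curve `c` and the field `w`, then its integral against a solution of the continuity equation driven
by `w` is nondecreasing in time. The parameter is only absolutely continuous in time; the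
increment over a short interval is nonnegative up to an error of second order. -/
theorem TestSolves.integral_le_of_deriv_nonneg {A : Type*} [NormedAddCommGroup A]
    [NormedSpace ℝ A] [CompleteSpace A] {a b : ℝ} (hab : a ≤ b) {w : ℝ → E d → E d}
    {μ : ℝ → Pc d} (h : TestSolves a b w μ) {κ : ℝ → ℝ} (hκ : Integrable κ) (hκ0 : ∀ t, 0 ≤ κ t)
    (hw : ∀ᵐ r ∂(volume.restrict (Icc a b)), ∀ x, ‖w r x‖ ≤ κ r * (1 + ‖x‖))
    (hwm : ∀ᵐ r ∂(volume.restrict (Icc a b)), AEStronglyMeasurable (w r) (μ r).meas)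
    {q : A × E d → ℝ} (hq : ContDiff ℝ ∞ q) (hqc : HasCompactSupport q)
    {c α : ℝ → A} (hα : Integrable α)
    (hc : ∀ s ∈ Icc a b, ∀ t ∈ Icc a b, c t - c s = ∫ r in s..t, α r)
    (hpos : ∀ᵐ r ∂(volume.restrict (Icc a b)), ∀ᵐ x ∂(μ r).meas,
      0 ≤ fderiv ℝ q (c r, x) (α r, w r x)) :
    ∫ x, q (c a, x) ∂(μ a).meas ≤ ∫ x, q (c b, x) ∂(μ b).meas := by
  set D := fderiv ℝ q with hD
  have hDs : ContDiff ℝ ∞ D := hq.fderiv_right (by simp)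
  have hDc : HasCompactSupport D := hqc.fderiv (𝕜 := ℝ)
  have hDcont : Continuous D := hDs.continuous
  obtain ⟨L0, hL0, hL⟩ := ContDiff.exists_lipschitz_of_hasCompactSupport hDs hDc
  have hgc : Continuous fun z : A × E d => 1 + ‖z.2‖ :=
    continuous_const.add continuous_snd.norm
  obtain ⟨C1, hC1'⟩ := exists_norm_mul_le_of_hasCompactSupport hDcont hDc hgc
  obtain ⟨C3, hC3'⟩ := exists_norm_fderiv_mul_le_of_hasCompactSupport hDs hDc hgc
  obtain ⟨ρ, hρ⟩ := hqc.isCompact.isBounded.subset_closedBall (0 : A × E d)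
  have hq0 : ∀ a' x, ρ < ‖x‖ → (a', x) ∉ tsupport q := fun a' x hx hmem => by
    have h1 := hρ hmem
    rw [mem_closedBall_zero_iff] at h1
    exact absurd ((norm_snd_le (a', x)).trans h1) (not_le.2 hx)
  have hD0 : ∀ a' x, ρ < ‖x‖ → D (a', x) = 0 := fun a' x hx => by
    by_contra hne
    exact hq0 a' x hx (support_fderiv_subset ℝ hne)
  set L := (1 + |ρ|) * L0 with hLdef
  have hLnn : 0 ≤ L := by positivity
  have hLw : ∀ a1 a2 x, ‖D (a1, x) - D (a2, x)‖ * (1 + ‖x‖) ≤ L * ‖a1 - a2‖ := by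
    intro a1 a2 x
    rcases le_or_gt ‖x‖ ρ with hx | hx
    · have h1 := hL (a1, x) (a2, x)
      have h2 : ‖((a1, x) - (a2, x) : A × E d)‖ = ‖a1 - a2‖ := by simp [Prod.norm_def]
      rw [h2] at h1
      have h3 : 1 + ‖x‖ ≤ 1 + |ρ| := by linarith [le_abs_self ρ]
      calc _ ≤ (L0 * ‖a1 - a2‖) * (1 + |ρ|) := by gcongr
        _ = _ := by rw [hLdef]; ring
    · rw [hD0 _ _ hx, hD0 _ _ hx]; simp only [sub_zero, norm_zero, zero_mul]; positivity
  have hC3nn : 0 ≤ C3 := le_trans (by positivity) (hC3' 0)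
  have hsec : ∀ a', ∀ x, ρ < ‖x‖ → q (a', x) = 0 := fun a' x hx =>
    image_eq_zero_of_notMem_tsupport (hq0 a' x hx)
  have hcomp : ∀ f : E d → ℝ, (∀ x, ρ < ‖x‖ → f x = 0) → HasCompactSupport f := fun f hf =>
    HasCompactSupport.of_support_subset_isCompact (isCompact_closedBall (0 : E d) ρ) fun x hx => by
      by_contra hcon
      exact hx (hf x (by simpa using hcon))
  -- `N` measures time so that both the parameter and the field have bounded speed.
  set N : ℝ → ℝ := fun t => ∫ r in a..t, (κ r + ‖α r‖) with hN
  have hNi : Integrable (fun r => κ r + ‖α r‖) := hκ.add hα.norm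
  have hNsub : ∀ s t, N t - N s = ∫ r in s..t, (κ r + ‖α r‖) := fun s t =>
    intervalIntegral.integral_interval_sub_left hNi.intervalIntegrable hNi.intervalIntegrable
  have hNκ : ∀ s t, s ≤ t → ∫ r in s..t, κ r ≤ N t - N s := fun s t hst => by
    rw [hNsub]
    exact intervalIntegral.integral_mono_on hst hκ.intervalIntegrable hNi.intervalIntegrable
      (fun r _ => le_add_of_nonneg_right (norm_nonneg _))
  have hNc : ∀ s ∈ Icc a b, ∀ t ∈ Icc a b, s ≤ t → ‖c t - c s‖ ≤ N t - N s :=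
    fun s hs t ht hst => by
    rw [hNsub, hc s hs t ht]
    exact intervalIntegral.norm_integral_le_of_norm_le hst
      (Eventually.of_forall fun r _ => le_add_of_nonneg_left (hκ0 r)) hNi.intervalIntegrable
  have hNmono : ∀ s t, s ≤ t → N s ≤ N t := fun s t hst => by
    have := hNsub s t
    have h2 : 0 ≤ ∫ r in s..t, (κ r + ‖α r‖) := intervalIntegral.integral_nonneg hst
      fun r _ => add_nonneg (hκ0 r) (norm_nonneg _)
    linarith
  have hNcont : ContinuousOn N (Icc a b) :=
    (intervalIntegral.continuous_primitive (fun _ _ => hNi.intervalIntegrable) a).continuousOn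
  refine neg_le_neg_iff.1 (le_of_increment_le_sq (F := fun t => -∫ x, q (c t, x) ∂(μ t).meas)
    (N := N) (C := L + C3 + L0) hab hNcont (fun s _ t _ hst => hNmono s t hst) (by positivity) ?_)
  intro s hs t ht hst
  set Δ := N t - N s with hΔ
  have hΔ0 : 0 ≤ Δ := sub_nonneg.2 (hNmono s t hst)
  have hqs : ∀ a', Continuous fun x => q (a', x) := fun a' => hq.continuous.comp (Continuous.prodMk_right a')
  have hemb : ∀ a' : A, ContDiff ℝ ∞ (fun x : E d => (a', x)) := fun a' =>
    contDiff_prodMk_right a'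
  have hembd : ∀ (a' : A) x, HasFDerivAt (fun x : E d => (a', x)) (ContinuousLinearMap.inr ℝ A (E d)) x :=
    fun a' x => hasFDerivAt_prodMk_right a' x
  -- the increment of the solution, tested against the section of `q` at the final parameter
  have hψd : ∀ x y, fderiv ℝ (fun x => q (c t, x)) x y = D (c t, x) (0, y) := fun x y => by
    have h1 : HasFDerivAt (fun x => q (c t, x)) ((D (c t, x)).comp
        (ContinuousLinearMap.inr ℝ A (E d))) x :=
      ((hq.differentiable (by simp)) (c t, x)).hasFDerivAt.comp x (hembd _ x)
    rw [h1.fderiv]; simp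
  have e1 := h.eq (fun x => q (c t, x)) (hq.comp (hemb _)) (hcomp _ (hsec _)) s hs t ht
  have i1 := h.integrable (fun x => q (c t, x)) (hq.comp (hemb _)) (hcomp _ (hsec _))
  simp only [hψd] at e1 i1
  set T1 : ℝ → ℝ := fun r => ∫ x, D (c t, x) (0, w r x) ∂(μ r).meas with hT1
  -- the increment of the parameter
  set ℓ : A →L[ℝ] ℝ := ∫ x, (D (c t, x)).comp (ContinuousLinearMap.inl ℝ A (E d)) ∂(μ s).meas
    with hℓ
  have hGc : Continuous fun x => (D (c t, x)).comp (ContinuousLinearMap.inl ℝ A (E d)) :=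
    (hDcont.comp (Continuous.prodMk_right (c t))).clm_comp continuous_const
  have hℓa : ∀ β, ℓ β = ∫ x, D (c t, x) (β, 0) ∂(μ s).meas := fun β => by
    rw [hℓ, ContinuousLinearMap.integral_apply (integrable_of_continuous _ hGc)]
    simp
  have hDapp : ∀ a' β, Continuous fun x => D (a', x) (β, (0 : E d)) := fun a' β =>
    (hDcont.comp (Continuous.prodMk_right a')).clm_apply continuous_const
  have e2 : ∫ r in s..t, ℓ (α r) = ℓ (c t - c s) := by
    rw [hc s hs t ht, ContinuousLinearMap.intervalIntegral_comp_comm _ hα.intervalIntegrable]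
  have e3 : ℓ (c t - c s) - L0 * Δ ^ 2
      ≤ ∫ x, q (c t, x) ∂(μ s).meas - ∫ x, q (c s, x) ∂(μ s).meas := by
    rw [hℓa, ← integral_sub (integrable_of_continuous _ (hqs _))
      (integrable_of_continuous _ (hqs _))]
    have h1 : ∫ x, (D (c t, x) (c t - c s, 0) - L0 * Δ ^ 2) ∂(μ s).meas
        ≤ ∫ x, (q (c t, x) - q (c s, x)) ∂(μ s).meas := by
      refine integral_mono ((integrable_of_continuous _ (hDapp _ _)).sub (integrable_const _))
        (integrable_of_continuous _ ((hqs _).sub (hqs _))) fun x => ?_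
      have h3 : ‖q (c s, x) - q (c t, x) - D (c t, x) ((c s, x) - (c t, x))‖
          ≤ (L0 * ‖c s - c t‖) * ‖((c s, x) - (c t, x) : A × E d)‖ := by
        refine (convex_segment (𝕜 := ℝ) (c t, x) (c s, x)).norm_image_sub_le_of_norm_fderiv_le'
          (f := q) (fun z _ => (hq.differentiable (by simp)) z) (fun z hz => ?_)
          (left_mem_segment ℝ _ _) (right_mem_segment ℝ _ _)
        refine (hL _ _).trans (mul_le_mul_of_nonneg_left ?_ hL0)
        have := norm_sub_le_of_mem_segment hz
        simpa [Prod.norm_def] using this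
      have h4 : ((c s, x) - (c t, x) : A × E d) = -(c t - c s, 0) := by simp
      have h5 : ‖((c t - c s, 0) : A × E d)‖ = ‖c t - c s‖ := by simp [Prod.norm_def]
      rw [h4, norm_neg, h5, map_neg, norm_sub_rev (c s), sub_neg_eq_add] at h3
      have h6 := hNc s hs t ht hst
      have h7 : L0 * ‖c t - c s‖ * ‖c t - c s‖ ≤ L0 * Δ ^ 2 := by
        rw [mul_assoc, sq]; gcongr
      have h8 := (abs_le.1 (h3.trans h7)).2
      simp only
      linarith
    rw [integral_sub (integrable_of_continuous _ (hDapp _ _)) (integrable_const _)] at h1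
    simpa using h1
  -- pointwise in time, the two contributions balance up to first order
  have e4 : ∀ᵐ r ∂volume, r ∈ Ioc s t → -ℓ (α r) - (L + C3) * Δ * (κ r + ‖α r‖) ≤ T1 r := by
    filter_upwards [(ae_restrict_iff' measurableSet_Icc).1 hw,
      (ae_restrict_iff' measurableSet_Icc).1 hwm,
      (ae_restrict_iff' measurableSet_Icc).1 hpos] with r h1 h2 h3 hr
    have hrI : r ∈ Icc a b := ⟨hs.1.trans hr.1.le, hr.2.trans ht.2⟩
    replace h1 := h1 hrI
    replace h2 := h2 hrI
    replace h3 := h3 hrI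
    have hcr : ‖c r - c t‖ ≤ Δ := by
      rw [norm_sub_rev]
      refine (hNc r hrI t ht hr.2).trans ?_
      have := hNmono s r hr.1.le
      linarith
    have hmeas : ∀ a' β, AEStronglyMeasurable (fun x => D (a', x) (β, w r x)) (μ r).meas :=
      fun a' β => isBoundedBilinearMap_apply.continuous.comp_aestronglyMeasurable
        (((hDcont.comp (Continuous.prodMk_right a')).aestronglyMeasurable).prodMk
          (aestronglyMeasurable_const.prodMk h2))
    have hint : ∀ a', Integrable (fun x => D (a', x) (0, w r x)) (μ r).meas := by
      intro a'
      refine Integrable.of_bound (hmeas a' 0) (C1 * κ r) (Eventually.of_forall fun x => ?_)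
      have h4 : ‖((0 : A), w r x)‖ = ‖w r x‖ := by simp [Prod.norm_def]
      calc _ ≤ ‖D (a', x)‖ * ‖w r x‖ := by
            rw [← h4]; exact ContinuousLinearMap.le_opNorm _ _
        _ ≤ ‖D (a', x)‖ * (κ r * (1 + ‖x‖)) := by gcongr; exact h1 x
        _ = (‖D (a', x)‖ * (1 + ‖x‖)) * κ r := by ring
        _ ≤ C1 * κ r := mul_le_mul_of_nonneg_right (hC1' (a', x)) (hκ0 r)
    have hint2 : ∀ a' β, Integrable (fun x => D (a', x) (β, (0 : E d))) (μ r).meas := fun a' β =>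
      integrable_of_continuous _ (hDapp a' β)
    have s1 : 0 ≤ (∫ x, D (c r, x) (0, w r x) ∂(μ r).meas)
        + ∫ x, D (c r, x) (α r, 0) ∂(μ r).meas := by
      rw [← integral_add (hint _) (hint2 _ _)]
      refine integral_nonneg_of_ae ?_
      filter_upwards [h3] with x hx
      simp only [Pi.zero_apply]
      rw [← map_add]
      simpa using hx
    have s2 : ∫ x, D (c r, x) (0, w r x) ∂(μ r).meas ≤ T1 r + L * Δ * κ r := by
      have : ∫ x, D (c r, x) (0, w r x) ∂(μ r).meas
          ≤ ∫ x, (D (c t, x) (0, w r x) + L * Δ * κ r) ∂(μ r).meas := by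
        refine integral_mono (hint _) ((hint _).add (integrable_const _)) fun x => ?_
        have h4 : ‖((0 : A), w r x)‖ = ‖w r x‖ := by simp [Prod.norm_def]
        have h5 : (D (c r, x) - D (c t, x)) (0, w r x) ≤ L * Δ * κ r := by
          refine (Real.le_norm_self _).trans ?_
          calc ‖(D (c r, x) - D (c t, x)) (0, w r x)‖
              ≤ ‖D (c r, x) - D (c t, x)‖ * ‖w r x‖ := by
                rw [← h4]
                exact ContinuousLinearMap.le_opNorm (D (c r, x) - D (c t, x)) ((0 : A), w r x)
            _ ≤ ‖D (c r, x) - D (c t, x)‖ * (κ r * (1 + ‖x‖)) := by gcongr; exact h1 x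
            _ = (‖D (c r, x) - D (c t, x)‖ * (1 + ‖x‖)) * κ r := by ring
            _ ≤ (L * ‖c r - c t‖) * κ r := mul_le_mul_of_nonneg_right (hLw _ _ _) (hκ0 r)
            _ ≤ L * Δ * κ r := by have := hκ0 r; gcongr
        rw [sub_apply] at h5
        simp only
        linarith
      rw [integral_add (hint _) (integrable_const _)] at this
      simpa using this
    have s3 : ∫ x, D (c r, x) (α r, 0) ∂(μ r).meas
        ≤ (∫ x, D (c t, x) (α r, 0) ∂(μ r).meas) + L * Δ * ‖α r‖ := by
      have : ∫ x, D (c r, x) (α r, 0) ∂(μ r).meas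
          ≤ ∫ x, (D (c t, x) (α r, 0) + L * Δ * ‖α r‖) ∂(μ r).meas := by
        refine integral_mono (hint2 _ _) ((hint2 _ _).add (integrable_const _)) fun x => ?_
        have h4 : ‖(α r, (0 : E d))‖ = ‖α r‖ := by simp [Prod.norm_def]
        have h5 : (D (c r, x) - D (c t, x)) (α r, 0) ≤ L * Δ * ‖α r‖ := by
          refine (Real.le_norm_self _).trans ?_
          calc ‖(D (c r, x) - D (c t, x)) (α r, 0)‖
              ≤ ‖D (c r, x) - D (c t, x)‖ * ‖α r‖ := by
                rw [← h4]
                exact ContinuousLinearMap.le_opNorm (D (c r, x) - D (c t, x)) (α r, (0 : E d))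
            _ ≤ (‖D (c r, x) - D (c t, x)‖ * (1 + ‖x‖)) * ‖α r‖ := by
                gcongr
                exact le_mul_of_one_le_right (norm_nonneg _) (by linarith [norm_nonneg x])
            _ ≤ (L * ‖c r - c t‖) * ‖α r‖ :=
                mul_le_mul_of_nonneg_right (hLw _ _ _) (norm_nonneg _)
            _ ≤ L * Δ * ‖α r‖ := by gcongr
        rw [sub_apply] at h5
        simp only
        linarith
      rw [integral_add (hint2 _ _) (integrable_const _)] at this
      simpa using this
    have s4 : ∫ x, D (c t, x) (α r, 0) ∂(μ r).meas ≤ ℓ (α r) + C3 * ‖α r‖ * Δ := by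
      have hd2 : ∀ x, HasFDerivAt (fun x => D (c t, x) (α r, (0 : E d)))
          (((fderiv ℝ D (c t, x)).comp (ContinuousLinearMap.inr ℝ A (E d))).flip (α r, 0)) x :=
        fun x => by
        have h4 := (((hDs.differentiable (by simp)) (c t, x)).hasFDerivAt.comp x (hembd _ x))
        have h5 := h4.clm_apply (hasFDerivAt_const ((α r, 0) : A × E d) x)
        simpa using h5
      have h6 := h.abs_sub_le hκ hw (ψ := fun x => D (c t, x) (α r, 0)) (B := C3 * ‖α r‖)
        ((hDs.comp (hemb _)).clm_apply contDiff_const)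
        (hcomp _ (fun x hx => by rw [hD0 _ _ hx]; simp)) (fun x => by
          rw [(hd2 x).fderiv]
          have h7 : ‖((fderiv ℝ D (c t, x)).comp (ContinuousLinearMap.inr ℝ A (E d))).flip
              (α r, 0)‖ ≤ ‖fderiv ℝ D (c t, x)‖ * ‖α r‖ := by
            refine ContinuousLinearMap.opNorm_le_bound _ (by positivity) fun y => ?_
            simp only [ContinuousLinearMap.flip_apply, ContinuousLinearMap.comp_apply,
              ContinuousLinearMap.inr_apply]
            refine (ContinuousLinearMap.le_opNorm _ _).trans ?_
            have h8 : ‖(α r, (0 : E d))‖ = ‖α r‖ := by simp [Prod.norm_def]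
            have h9 : ‖((0 : A), y)‖ = ‖y‖ := by simp [Prod.norm_def]
            rw [h8]
            have := ContinuousLinearMap.le_opNorm (fderiv ℝ D (c t, x)) ((0 : A), y)
            rw [h9] at this
            calc _ ≤ (‖fderiv ℝ D (c t, x)‖ * ‖y‖) * ‖α r‖ := by gcongr
              _ = _ := by ring
          calc _ ≤ (‖fderiv ℝ D (c t, x)‖ * ‖α r‖) * (1 + ‖x‖) := by gcongr
            _ = (‖fderiv ℝ D (c t, x)‖ * (1 + ‖x‖)) * ‖α r‖ := by ring
            _ ≤ C3 * ‖α r‖ := by gcongr; exact hC3' (c t, x)) hs hrI hr.1.le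
      rw [← hℓa] at h6
      have h7 := (abs_le.1 h6).2
      have h8 : ∫ z in s..r, κ z ≤ Δ := (hNκ s r hr.1.le).trans (by
        have := hNmono r t hr.2; linarith)
      have h9 : C3 * ‖α r‖ * (∫ z in s..r, κ z) ≤ C3 * ‖α r‖ * Δ := by gcongr
      linarith
    have h10 : 0 ≤ C3 * Δ * κ r := by have := hκ0 r; positivity
    nlinarith
  have e5 : -ℓ (c t - c s) - (L + C3) * Δ * Δ ≤ ∫ r in s..t, T1 r := by
    have i2 : IntervalIntegrable (fun r => ℓ (α r)) volume s t :=
      (ℓ.integrable_comp hα).intervalIntegrable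
    have i2n : IntervalIntegrable (fun r => -ℓ (α r)) volume s t := i2.neg
    have i3 : IntervalIntegrable T1 volume s t :=
      (intervalIntegrable_iff_integrableOn_Ioc_of_le hst).2
        (i1.mono_set (Ioc_subset_Icc_self.trans (Icc_subset_Icc hs.1 ht.2)))
    have h1 : ∫ r in s..t, (-ℓ (α r) - (L + C3) * Δ * (κ r + ‖α r‖)) ≤ ∫ r in s..t, T1 r := by
      refine intervalIntegral.integral_mono_ae_restrict hst
        (i2n.sub (hNi.intervalIntegrable.const_mul _)) i3 ?_
      rw [← Measure.restrict_congr_set Ioc_ae_eq_Icc, EventuallyLE,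
        ae_restrict_iff' measurableSet_Ioc]
      exact e4
    rw [intervalIntegral.integral_sub i2n (hNi.intervalIntegrable.const_mul _),
      intervalIntegral.integral_neg, e2, intervalIntegral.integral_const_mul, ← hNsub] at h1
    exact h1
  have : (L + C3 + L0) * Δ ^ 2 = (L + C3) * Δ * Δ + L0 * Δ ^ 2 := by ring
  rw [this]
  linarith

/-! ### Mass carried by moving balls -/

section balls

variable {ι : Type*} [Fintype ι]

/-- The squared distance from `x` to the moving centre `z.1.2 i`, shifted by `c` and discounted by
the expansion factor `exp (2 z.1.1)`. -/
def discountedSq (c : ℝ) (i : ι) (z : (ℝ × (ι → E d)) × E d) : ℝ :=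
  Real.exp (-2 * z.1.1) * (c + ‖z.2 - z.1.2 i‖ ^ 2)

/-- A smooth function of `x` and of the parameters, which is `0` where `discountedSq` is at most
`δ` for some centre, and `1` where it is at least `2δ` for all centres. -/
def avoidBalls (c δ : ℝ) (z : (ℝ × (ι → E d)) × E d) : ℝ :=
  ∏ i, Real.smoothTransition ((discountedSq c i z - δ) / δ)

lemma contDiff_discountedSq (c : ℝ) (i : ι) : ContDiff ℝ ∞ (discountedSq (d := d) c i) := by
  have h1 : ContDiff ℝ ∞ (fun z : (ℝ × (ι → E d)) × E d => z.2 - z.1.2 i) :=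
    contDiff_snd.sub ((contDiff_apply ℝ (E d) i).comp (contDiff_snd.comp contDiff_fst))
  have h2 : ContDiff ℝ ∞ (fun z : (ℝ × (ι → E d)) × E d => -2 * z.1.1) :=
    contDiff_const.mul (contDiff_fst.comp contDiff_fst)
  exact h2.exp.mul (contDiff_const.add (h1.norm_sq ℝ))

lemma contDiff_avoidBalls (c δ : ℝ) : ContDiff ℝ ∞ (avoidBalls (ι := ι) (d := d) c δ) :=
  contDiff_prod fun i _ => Real.smoothTransition.contDiff.comp
    (((contDiff_discountedSq c i).sub contDiff_const).div_const _)

lemma avoidBalls_nonneg (c δ : ℝ) (z : (ℝ × (ι → E d)) × E d) : 0 ≤ avoidBalls c δ z :=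
  Finset.prod_nonneg fun _ _ => Real.smoothTransition.nonneg _

lemma avoidBalls_le_one (c δ : ℝ) (z : (ℝ × (ι → E d)) × E d) : avoidBalls c δ z ≤ 1 :=
  Finset.prod_le_one (fun _ _ => Real.smoothTransition.nonneg _)
    fun _ _ => Real.smoothTransition.le_one _

lemma avoidBalls_eq_one {c δ : ℝ} (hδ : 0 < δ) {z : (ℝ × (ι → E d)) × E d}
    (h : ∀ i, 2 * δ ≤ discountedSq c i z) : avoidBalls c δ z = 1 :=
  Finset.prod_eq_one fun i _ => Real.smoothTransition.one_of_one_le (by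
    rw [one_le_div hδ]; linarith [h i])

lemma avoidBalls_eq_zero {c δ : ℝ} (hδ : 0 < δ) {z : (ℝ × (ι → E d)) × E d} {i : ι}
    (h : discountedSq c i z ≤ δ) : avoidBalls c δ z = 0 :=
  Finset.prod_eq_zero (Finset.mem_univ i) (Real.smoothTransition.zero_of_nonpos
    (div_nonpos_of_nonpos_of_nonneg (by linarith) hδ.le))

lemma fderiv_discountedSq (c : ℝ) (i : ι) (z : (ℝ × (ι → E d)) × E d)
    (ζ : (ℝ × (ι → E d)) × E d) : fderiv ℝ (discountedSq c i) z ζ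
      = 2 * Real.exp (-2 * z.1.1) *
        (inner ℝ (z.2 - z.1.2 i) (ζ.2 - ζ.1.2 i) - ζ.1.1 * (c + ‖z.2 - z.1.2 i‖ ^ 2)) := by
  have hd : HasFDerivAt (discountedSq c i) (fderiv ℝ (discountedSq c i) z) z :=
    ((contDiff_discountedSq c i).differentiable (by simp) z).hasFDerivAt
  have hl : HasDerivAt (fun s : ℝ => z + s • ζ) ζ 0 := by
    simpa using ((hasDerivAt_id (0 : ℝ)).smul_const ζ).const_add z
  have h1 : HasDerivAt (fun s : ℝ => discountedSq c i (z + s • ζ))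
      (fderiv ℝ (discountedSq c i) z ζ) 0 := by
    have hd' : HasFDerivAt (discountedSq c i) (fderiv ℝ (discountedSq c i) z)
        (z + (0 : ℝ) • ζ) := by simpa using hd
    exact hd'.comp_hasDerivAt 0 hl
  have e1 : HasDerivAt (fun s : ℝ => Real.exp (-2 * (z.1.1 + s * ζ.1.1)))
      (Real.exp (-2 * z.1.1) * (-2 * ζ.1.1)) 0 := by
    have : HasDerivAt (fun s : ℝ => -2 * (z.1.1 + s * ζ.1.1)) (-2 * ζ.1.1) 0 := by
      simpa using (((hasDerivAt_id (0 : ℝ)).mul_const ζ.1.1).const_add z.1.1).const_mul (-2)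
    simpa using this.exp
  have e2 : HasDerivAt (fun s : ℝ => (z.2 - z.1.2 i) + s • (ζ.2 - ζ.1.2 i)) (ζ.2 - ζ.1.2 i) 0 := by
    simpa using ((hasDerivAt_id (0 : ℝ)).smul_const (ζ.2 - ζ.1.2 i)).const_add (z.2 - z.1.2 i)
  have e3 := e1.mul ((e2.norm_sq).const_add c)
  have h2 : (fun s : ℝ => discountedSq c i (z + s • ζ)) =
      (fun s : ℝ => Real.exp (-2 * (z.1.1 + s * ζ.1.1))) *
        fun s : ℝ => c + ‖(z.2 - z.1.2 i) + s • (ζ.2 - ζ.1.2 i)‖ ^ 2 := by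
    funext s
    simp only [discountedSq, Prod.fst_add, Prod.snd_add, Prod.smul_fst, Prod.smul_snd, Pi.add_apply,
      Pi.smul_apply, smul_eq_mul, Pi.mul_apply]
    congr 4
    rw [smul_sub]; abel
  rw [h2] at h1
  rw [h1.unique e3]
  simp only [zero_mul, zero_smul, add_zero]
  ring

/-- `avoidBalls` is nonincreasing in the directions in which every `discountedSq` is. -/
lemma fderiv_avoidBalls_nonpos (c : ℝ) {δ : ℝ} (hδ : 0 < δ) (z ζ : (ℝ × (ι → E d)) × E d)
    (h : ∀ i, inner ℝ (z.2 - z.1.2 i) (ζ.2 - ζ.1.2 i) ≤ ζ.1.1 * (c + ‖z.2 - z.1.2 i‖ ^ 2)) :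
    fderiv ℝ (avoidBalls c δ) z ζ ≤ 0 := by
  classical
  have h1 : ∀ i ∈ Finset.univ, HasFDerivAt
      (fun z => Real.smoothTransition ((discountedSq c i z - δ) / δ))
      (deriv Real.smoothTransition ((discountedSq c i z - δ) / δ) •
        (δ⁻¹ • fderiv ℝ (discountedSq c i) z)) z := by
    intro i _
    have h2 : HasFDerivAt (discountedSq c i) (fderiv ℝ (discountedSq c i) z) z :=
      ((contDiff_discountedSq c i).differentiable (by simp) z).hasFDerivAt
    have h3 : HasFDerivAt (fun z => (discountedSq c i z - δ) / δ)
        (δ⁻¹ • fderiv ℝ (discountedSq c i) z) z := by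
      simp only [div_eq_inv_mul]
      exact (h2.sub_const δ).const_mul δ⁻¹
    have h4 : HasDerivAt Real.smoothTransition
        (deriv Real.smoothTransition ((discountedSq c i z - δ) / δ))
        ((discountedSq c i z - δ) / δ) :=
      ((Real.smoothTransition.contDiff (n := 1)).differentiable (by simp) _).hasDerivAt
    exact h4.comp_hasFDerivAt z h3
  have h5 := HasFDerivAt.finsetProd h1
  have h6 : HasFDerivAt (avoidBalls c δ) _ z := h5
  rw [h6.fderiv]
  simp only [_root_.sum_apply, _root_.smul_apply, smul_eq_mul]
  refine Finset.sum_nonpos fun i _ => ?_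
  refine mul_nonpos_of_nonneg_of_nonpos
    (Finset.prod_nonneg fun _ _ => Real.smoothTransition.nonneg _) ?_
  refine mul_nonpos_of_nonneg_of_nonpos Real.smoothTransition.monotone.deriv_nonneg ?_
  refine mul_nonpos_of_nonneg_of_nonpos (by positivity) ?_
  rw [fderiv_discountedSq]
  exact mul_nonpos_of_nonneg_of_nonpos (by positivity) (by linarith [h i])

/-- The mass outside the balls with moving centres `p i`, whose radii expand at a rate that
dominates the relative speed of the field, is nonincreasing, up to a factor on the radii. -/
theorem TestSolves.measure_avoid_le {a b : ℝ} (hab : a ≤ b) {w : ℝ → E d → E d}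
    {μ : ℝ → Pc d} (h : TestSolves a b w μ) {κ : ℝ → ℝ} (hκ : Integrable κ) (hκ0 : ∀ t, 0 ≤ κ t)
    (hw : ∀ᵐ r ∂(volume.restrict (Icc a b)), ∀ x, ‖w r x‖ ≤ κ r * (1 + ‖x‖))
    (hwm : ∀ᵐ r ∂(volume.restrict (Icc a b)), AEStronglyMeasurable (w r) (μ r).meas)
    {p β : ι → ℝ → E d} (hβ : ∀ i, Integrable (β i))
    (hp : ∀ i, ∀ s ∈ Icc a b, ∀ t ∈ Icc a b, p i t - p i s = ∫ r in s..t, β i r)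
    {lam : ℝ → ℝ} (hlam : Integrable lam) {c : ℝ}
    (hmon : ∀ᵐ r ∂(volume.restrict (Icc a b)), ∀ᵐ x ∂(μ r).meas, ∀ i,
      inner ℝ (x - p i r) (w r x - β i r) ≤ lam r * (c + ‖x - p i r‖ ^ 2))
    {δ : ℝ} (hδ : 0 < δ) :
    (μ b).meas.real {x | ∀ i, 2 * δ * Real.exp (2 * ∫ r in a..b, lam r) ≤ c + ‖x - p i b‖ ^ 2}
      ≤ (μ a).meas.real {x | ∀ i, δ < c + ‖x - p i a‖ ^ 2} := by
  set cc : ℝ → ℝ × (ι → E d) := fun t => (∫ r in a..t, lam r, fun i => p i t) with hcc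
  set α : ℝ → ℝ × (ι → E d) := fun t => (lam t, fun i => β i t) with hα
  have hαi : Integrable α := hlam.prodMk (Integrable.of_eval hβ)
  have hcα : ∀ s ∈ Icc a b, ∀ t ∈ Icc a b, cc t - cc s = ∫ r in s..t, α r := by
    intro s hs t ht
    refine Prod.ext ?_ ?_
    · have := (ContinuousLinearMap.fst ℝ ℝ (ι → E d)).intervalIntegral_comp_comm
        (hαi.intervalIntegrable (a := s) (b := t))
      simp only [ContinuousLinearMap.coe_fst'] at this
      rw [← this]
      exact intervalIntegral.integral_interval_sub_left hlam.intervalIntegrable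
        hlam.intervalIntegrable
    · funext i
      have := ((ContinuousLinearMap.proj (R := ℝ) (φ := fun _ : ι => E d) i).comp
        (ContinuousLinearMap.snd ℝ ℝ (ι → E d))).intervalIntegral_comp_comm
        (hαi.intervalIntegrable (a := s) (b := t))
      simp only [ContinuousLinearMap.comp_apply, ContinuousLinearMap.coe_snd',
        ContinuousLinearMap.proj_apply] at this
      rw [← this]
      exact hp i s hs t ht
  have hccont : ContinuousOn cc (Icc a b) := by
    have h1 : ContinuousOn (fun t => cc a + ∫ r in a..t, α r) (Icc a b) :=
      (continuous_const.add (intervalIntegral.continuous_primitive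
        (fun _ _ => hαi.intervalIntegrable) a)).continuousOn
    refine h1.congr fun t ht => ?_
    show cc t = cc a + ∫ r in a..t, α r
    rw [← hcα a (left_mem_Icc.2 hab) t ht, add_sub_cancel]
  obtain ⟨B, hB⟩ := isCompact_Icc.exists_bound_of_continuousOn hccont
  have hB0 : 0 ≤ B := (norm_nonneg _).trans (hB a (left_mem_Icc.2 hab))
  -- A cut-off in the parameter gives `q` compact support without changing it along the curve.
  let χ : ContDiffBump (0 : ℝ × (ι → E d)) := ⟨B + 1, B + 2, by linarith, by linarith⟩
  have hχ1 : ∀ a', ‖a'‖ ≤ B + 1 → χ a' = 1 := fun a' ha' =>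
    χ.one_of_mem_closedBall (by simpa [χ] using ha')
  set q : (ℝ × (ι → E d)) × E d → ℝ := fun z => χ z.1 * (1 - avoidBalls c δ z) with hq
  have hqs : ContDiff ℝ ∞ q :=
    (χ.contDiff.comp contDiff_fst).mul (contDiff_const.sub (contDiff_avoidBalls c δ))
  set ρ := 2 * δ * Real.exp (2 * (B + 2)) + |c| + 1 + (B + 2) with hρ
  have hqc : HasCompactSupport q := by
    refine HasCompactSupport.of_support_subset_isCompact
      ((isCompact_closedBall (0 : ℝ × (ι → E d)) (B + 2)).prod
        (isCompact_closedBall (0 : E d) ρ)) ?_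
    rintro ⟨a', x⟩ hz
    have hz1 : χ a' ≠ 0 := left_ne_zero_of_mul hz
    have hz2 : 1 - avoidBalls c δ (a', x) ≠ 0 := right_ne_zero_of_mul hz
    have ha' : ‖a'‖ < B + 2 := by
      have : a' ∈ Function.support χ := hz1
      rw [χ.support_eq] at this
      simpa [χ] using this
    refine ⟨by simpa using ha'.le, ?_⟩
    rw [mem_closedBall_zero_iff]
    by_contra hcon
    rw [not_le] at hcon
    refine hz2 (sub_eq_zero.2 (avoidBalls_eq_one hδ fun i => ?_).symm)
    have h1 : ‖a'.2 i‖ ≤ B + 2 := (norm_le_pi_norm a'.2 i).trans ((norm_snd_le a').trans ha'.le)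
    have h2 : ‖x‖ - ‖a'.2 i‖ ≤ ‖x - a'.2 i‖ := norm_sub_norm_le _ _
    have h3 : a'.1 ≤ B + 2 := (le_abs_self _).trans ((norm_fst_le a').trans ha'.le)
    have h4 : 2 * δ * Real.exp (2 * (B + 2)) + |c| + 1 ≤ ‖x - a'.2 i‖ := by linarith
    have h5 := Real.exp_pos (2 * (B + 2))
    have h6 : 2 * δ * Real.exp (2 * (B + 2)) ≤ c + ‖x - a'.2 i‖ ^ 2 := by
      have h7 : 1 ≤ ‖x - a'.2 i‖ := by
        have : 0 ≤ 2 * δ * Real.exp (2 * (B + 2)) := by positivity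
        linarith [abs_nonneg c]
      have h8 : ‖x - a'.2 i‖ ≤ ‖x - a'.2 i‖ ^ 2 := by nlinarith
      linarith [neg_abs_le c]
    simp only [discountedSq]
    have h9 : Real.exp (2 * a'.1) ≤ Real.exp (2 * (B + 2)) := Real.exp_le_exp.2 (by linarith)
    have h10 : Real.exp (-2 * a'.1) * Real.exp (2 * a'.1) = 1 := by
      rw [← Real.exp_add]; simp
    calc 2 * δ = Real.exp (-2 * a'.1) * (2 * δ * Real.exp (2 * a'.1)) := by
          linear_combination (-2 * δ) * h10
      _ ≤ Real.exp (-2 * a'.1) * (2 * δ * Real.exp (2 * (B + 2))) := by gcongr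
      _ ≤ _ := by gcongr
  have hpos : ∀ᵐ r ∂(volume.restrict (Icc a b)), ∀ᵐ x ∂(μ r).meas,
      0 ≤ fderiv ℝ q (cc r, x) (α r, w r x) := by
    filter_upwards [hmon, ae_restrict_mem measurableSet_Icc] with r hr hrI
    filter_upwards [hr] with x hx
    have hev : q =ᶠ[𝓝 (cc r, x)] fun z => 1 - avoidBalls c δ z := by
      have h1 : ‖(cc r, x).1‖ < B + 1 := by
        have := hB r hrI
        simp only; linarith
      have h2 : Continuous fun z : (ℝ × (ι → E d)) × E d => ‖z.1‖ := continuous_fst.norm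
      filter_upwards [h2.continuousAt.eventually_lt_const h1] with z hz
      simp only [hq]
      rw [hχ1 _ hz.le, one_mul]
    rw [hev.fderiv_eq, fderiv_const_sub]
    have := fderiv_avoidBalls_nonpos c hδ (cc r, x) (α r, w r x) hx
    simpa using this
  have key := h.integral_le_of_deriv_nonneg hab hκ hκ0 hw hwm hqs hqc hαi hcα hpos
  have hqcc : ∀ t ∈ Icc a b, ∀ x, q (cc t, x) = 1 - avoidBalls c δ (cc t, x) := fun t ht x => by
    simp only [hq]
    rw [hχ1 _ (by linarith [hB t ht]), one_mul]
  simp only [hqcc a (left_mem_Icc.2 hab), hqcc b (right_mem_Icc.2 hab)] at key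
  have hcontA : ∀ a' : ℝ × (ι → E d), Continuous fun x => avoidBalls c δ (a', x) := fun a' =>
    (contDiff_avoidBalls c δ).continuous.comp (Continuous.prodMk_right a')
  rw [integral_sub (integrable_const _) (integrable_of_continuous _ (hcontA _)),
    integral_sub (integrable_const _) (integrable_of_continuous _ (hcontA _))] at key
  simp only [integral_const, probReal_univ, smul_eq_mul, mul_one] at key
  have m1 : MeasurableSet {x : E d | ∀ i, 2 * δ * Real.exp (2 * ∫ r in a..b, lam r)
      ≤ c + ‖x - p i b‖ ^ 2} := by
    rw [ofPred_forall]
    exact MeasurableSet.iInter fun i => measurableSet_le measurable_const (by fun_prop)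
  have m2 : MeasurableSet {x : E d | ∀ i, δ < c + ‖x - p i a‖ ^ 2} := by
    rw [ofPred_forall]
    exact MeasurableSet.iInter fun i => measurableSet_lt measurable_const (by fun_prop)
  have s1 : (μ b).meas.real {x | ∀ i, 2 * δ * Real.exp (2 * ∫ r in a..b, lam r)
      ≤ c + ‖x - p i b‖ ^ 2} ≤ ∫ x, avoidBalls c δ (cc b, x) ∂(μ b).meas := by
    rw [← integral_indicator_one m1]
    refine integral_mono ((integrable_const 1).indicator m1)
      (integrable_of_continuous _ (hcontA _)) fun x => ?_
    by_cases hx : x ∈ {x | ∀ i, 2 * δ * Real.exp (2 * ∫ r in a..b, lam r) ≤ c + ‖x - p i b‖ ^ 2}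
    · rw [indicator_of_mem hx, avoidBalls_eq_one hδ (fun i => ?_)]
      · rfl
      · simp only [discountedSq, hcc]
        have h10 : Real.exp (-2 * ∫ r in a..b, lam r) * Real.exp (2 * ∫ r in a..b, lam r) = 1 := by
          rw [← Real.exp_add]; simp
        calc 2 * δ = Real.exp (-2 * ∫ r in a..b, lam r)
              * (2 * δ * Real.exp (2 * ∫ r in a..b, lam r)) := by
              linear_combination (-2 * δ) * h10
          _ ≤ _ := mul_le_mul_of_nonneg_left (hx i) (Real.exp_pos _).le
    · rw [indicator_of_notMem hx]
      exact avoidBalls_nonneg _ _ _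
  have s2 : ∫ x, avoidBalls c δ (cc a, x) ∂(μ a).meas
      ≤ (μ a).meas.real {x | ∀ i, δ < c + ‖x - p i a‖ ^ 2} := by
    rw [← integral_indicator_one m2]
    refine integral_mono (integrable_of_continuous _ (hcontA _))
      ((integrable_const 1).indicator m2) fun x => ?_
    by_cases hx : x ∈ {x | ∀ i, δ < c + ‖x - p i a‖ ^ 2}
    · rw [indicator_of_mem hx]
      exact avoidBalls_le_one _ _ _
    · rw [indicator_of_notMem hx]
      have hx' : ¬ ∀ i, δ < c + ‖x - p i a‖ ^ 2 := hx
      push Not at hx'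
      obtain ⟨i, hi⟩ := hx'
      refine (avoidBalls_eq_zero hδ (i := i) ?_).le
      simp only [discountedSq, hcc, intervalIntegral.integral_same, mul_zero, Real.exp_zero,
        one_mul]
      exact hi
  linarith

end balls

lemma TestSolves.mono_right {a b : ℝ} {w : ℝ → E d → E d} {μ : ℝ → Pc d}
    (h : TestSolves a b w μ) {t : ℝ} (ht : t ∈ Icc a b) : TestSolves a t w μ :=
  ⟨fun ψ h1 h2 => (h.integrable ψ h1 h2).mono_set (Icc_subset_Icc_right ht.2),
    fun ψ h1 h2 r hr s hs => h.eq ψ h1 h2 r ⟨hr.1, hr.2.trans ht.2⟩ s ⟨hs.1, hs.2.trans ht.2⟩⟩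

/-- Under sublinear growth of the field, the supports stay in a common ball. -/
theorem TestSolves.exists_mem_PcOn_ball {a b : ℝ} {w : ℝ → E d → E d}
    {μ : ℝ → Pc d} (h : TestSolves a b w μ) {κ : ℝ → ℝ} (hκ : Integrable κ) (hκ0 : ∀ t, 0 ≤ κ t)
    (hw : ∀ᵐ r ∂(volume.restrict (Icc a b)), ∀ x, ‖w r x‖ ≤ κ r * (1 + ‖x‖))
    (hwm : ∀ᵐ r ∂(volume.restrict (Icc a b)), AEStronglyMeasurable (w r) (μ r).meas) :
    ∃ R, ∀ t ∈ Icc a b, μ t ∈ PcOn (ball0 d R) := by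
  obtain ⟨R0, hR0, hμ0⟩ := MeanFieldControl.exists_mem_PcOn_ball (μ a)
  set J := ∫ r in a..b, 2 * κ r with hJ
  refine ⟨2 * (1 + R0 ^ 2) * Real.exp (2 * J), fun t ht => ?_⟩
  have hle : volume.restrict (Icc a t) ≤ volume.restrict (Icc a b) :=
    Measure.restrict_mono (Icc_subset_Icc_right ht.2) le_rfl
  have h1 := (h.mono_right ht).measure_avoid_le ht.1 hκ hκ0 (ae_mono hle hw) (ae_mono hle hwm)
    (ι := Unit) (p := fun _ _ => 0) (β := fun _ _ => 0) (fun _ => integrable_zero _ _ _)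
    (by simp) (lam := fun r => 2 * κ r) (hκ.const_mul 2) (c := 1) (by
      filter_upwards [ae_mono hle hw] with r hr
      refine Eventually.of_forall fun x _ => ?_
      rw [sub_zero, sub_zero]
      have h2 := hr x
      have h3 := real_inner_le_norm x (w r x)
      have h4 := hκ0 r
      have h5 : ‖x‖ * ‖w r x‖ ≤ ‖x‖ * (κ r * (1 + ‖x‖)) := by gcongr
      nlinarith [sq_nonneg (‖x‖ - 1), norm_nonneg x, mul_nonneg h4 (sq_nonneg (‖x‖ - 1))])
    (δ := 1 + R0 ^ 2) (by positivity)
  have h2 : (μ a).meas.real {x | ∀ _ : Unit, 1 + R0 ^ 2 < 1 + ‖x - (0 : E d)‖ ^ 2} = 0 := by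
    rw [measureReal_def, measure_eq_zero_iff_ae_notMem.2, ENNReal.toReal_zero]
    filter_upwards [mem_PcOn_ball.1 hμ0] with x hx hcon
    have h3 := hcon ()
    rw [sub_zero] at h3
    nlinarith [norm_nonneg x]
  rw [h2] at h1
  have h3 := le_antisymm h1 measureReal_nonneg
  rw [measureReal_eq_zero_iff, measure_eq_zero_iff_ae_notMem] at h3
  rw [mem_PcOn_ball]
  filter_upwards [h3] with x hx
  have hx' : ¬ ∀ _ : Unit, 2 * (1 + R0 ^ 2) * Real.exp (2 * ∫ r in a..t, 2 * κ r)
      ≤ 1 + ‖x - (0 : E d)‖ ^ 2 := hx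
  simp only [forall_const, sub_zero, not_le] at hx'
  have hJt : ∫ r in a..t, 2 * κ r ≤ J :=
    intervalIntegral.integral_mono_interval le_rfl ht.1 ht.2
      (Eventually.of_forall fun r => mul_nonneg zero_le_two (hκ0 r))
      (hκ.const_mul 2).intervalIntegrable
  have h6 : Real.exp (2 * ∫ r in a..t, 2 * κ r) ≤ Real.exp (2 * J) :=
    Real.exp_le_exp.2 (by linarith)
  have h7 : 2 * (1 + R0 ^ 2) * Real.exp (2 * ∫ r in a..t, 2 * κ r)
      ≤ 2 * (1 + R0 ^ 2) * Real.exp (2 * J) := by gcongr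
  nlinarith [sq_nonneg (‖x‖ - 1)]

/-! ### Carathéodory flows -/

lemma integral_mul_exp_primitive {n : ℝ → ℝ} {a b k : ℝ} (hab : a ≤ b) (hn : Integrable n)
    (hn0 : ∀ t, 0 ≤ n t) (hk : 0 < k) :
    ∫ s in a..b, n s * Real.exp (k * ∫ r in a..s, n r)
      = (Real.exp (k * ∫ r in a..b, n r) - 1) / k := by
  have hni : IntervalIntegrable n volume a b := hn.intervalIntegrable
  set N : ℝ → ℝ := fun t => ∫ s in a..t, n s with hN
  have hNac : AbsolutelyContinuousOnInterval N a b :=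
    hni.absolutelyContinuousOnInterval_intervalIntegral left_mem_uIcc
  have hNb : ∀ t ∈ uIcc a b, k * N t ≤ k * N b := fun t ht => by
    rw [uIcc_of_le hab] at ht
    exact mul_le_mul_of_nonneg_left (intervalIntegral.integral_mono_interval le_rfl ht.1 ht.2
      (Eventually.of_forall hn0) hni) hk.le
  have hac : AbsolutelyContinuousOnInterval (fun t => Real.exp (k * N t)) a b := by
    refine absolutelyContinuousOnInterval_of_dist_le (C := Real.exp (k * N b) * k) hNac
      (fun s hs t ht => ?_)
    have key : ∀ x y : ℝ, y ≤ k * N b → x ≤ y →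
        Real.exp y - Real.exp x ≤ Real.exp (k * N b) * (y - x) := by
      intro x y hy hxy
      have h1 : Real.exp x = Real.exp y * Real.exp (x - y) := by
        rw [← Real.exp_add]; ring_nf
      have h2 := Real.add_one_le_exp (x - y)
      have h4 := Real.exp_pos y
      have h5 : Real.exp y ≤ Real.exp (k * N b) := Real.exp_le_exp.2 hy
      have h6 : Real.exp y * (y - x) ≤ Real.exp (k * N b) * (y - x) :=
        mul_le_mul_of_nonneg_right h5 (by linarith)
      nlinarith
    rw [Real.dist_eq, Real.dist_eq]
    rcases le_total (N s) (N t) with hst | hst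
    · have h0 := mul_le_mul_of_nonneg_left hst hk.le
      have := key _ _ (hNb t ht) h0
      have h5 := Real.exp_le_exp.2 h0
      rw [abs_of_nonpos (by linarith), abs_of_nonpos (by linarith)]; linarith
    · have h0 := mul_le_mul_of_nonneg_left hst hk.le
      have := key _ _ (hNb s hs) h0
      have h5 := Real.exp_le_exp.2 h0
      rw [abs_of_nonneg (by linarith), abs_of_nonneg (by linarith)]; linarith
  have h1 := AbsolutelyContinuousOnInterval.integral_eq_sub
    (f' := fun t => Real.exp (k * N t) * (k * n t)) hab hac (by
    filter_upwards [hni.ae_hasDerivAt_integral] with t h1 ht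
    have ht' : t ∈ uIcc a b := by rwa [uIcc_of_le hab]
    exact ((h1 ht' a left_mem_uIcc).const_mul k).exp)
  have h0 : N a = 0 := by simp [hN]
  rw [h0, mul_zero, Real.exp_zero] at h1
  rw [← h1, ← intervalIntegral.integral_div]
  refine intervalIntegral.integral_congr fun s _ => ?_
  show n s * Real.exp (k * N s) = Real.exp (k * N s) * (k * n s) / k
  field_simp

/-- Carathéodory's existence theorem for a family of coupled integral equations, indexed by
labels `z : Z`, whose field at time `s` depends on the whole configuration at time `s`. The field
vanishes before the initial time `τ`. -/
theorem exists_caratheodory_flow {Z : Type*} [TopologicalSpace Z] [FirstCountableTopology Z]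
    {V : Type*} [NormedAddCommGroup V] [NormedSpace ℝ V] [CompleteSpace V]
    {τ : ℝ} {F : ℝ → (Z → V) → V → V} {n B : ℝ → ℝ}
    (hn : Integrable n) (hn0 : ∀ t, 0 ≤ n t) (hB : Integrable B)
    (hpre : ∀ s < τ, ∀ Y x, F s Y x = 0)
    (hmeas : ∀ X : ℝ → Z → V, Continuous (Function.uncurry X) → ∀ z,
      AEStronglyMeasurable (fun s => F s (X s) (X s z)) volume)
    (hbd : ∀ᵐ s, ∀ Y x, Continuous Y → ‖F s Y x‖ ≤ B s)
    (hlip : ∀ᵐ s, ∀ Y Y' : Z → V, Continuous Y → Continuous Y' → ∀ (x x' : V) (D : ℝ),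
      (∀ z, ‖Y z - Y' z‖ ≤ D) → ‖F s Y x - F s Y' x'‖ ≤ n s * (‖x - x'‖ + D))
    {ζ : Z → V} (hζ : Continuous ζ) {c : ℝ} (hζc : ∀ z, ‖ζ z‖ ≤ c) :
    ∃ X : ℝ → Z → V, Continuous (Function.uncurry X) ∧
      ∀ t z, X t z = ζ z + ∫ s in τ..t, F s (X s) (X s z) := by
  classical
  have hB0 : 0 ≤ᵐ[volume] B := by
    filter_upwards [hbd] with s hs
    exact (norm_nonneg (F s (fun _ => 0) 0)).trans (hs _ _ continuous_const)
  set N : ℝ → ℝ := fun t => ∫ r in τ..t, n r with hN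
  have hNc : Continuous N := intervalIntegral.continuous_primitive (fun _ _ => hn.intervalIntegrable) τ
  set J := ∫ r, n r with hJ
  have hNJ : ∀ t, |N t| ≤ J := fun t => by
    rw [hN]
    refine (intervalIntegral.norm_integral_le_integral_norm_uIoc (f := n)).trans ?_
    simp only [Real.norm_eq_abs, abs_of_nonneg (hn0 _)]
    exact setIntegral_le_integral hn (Eventually.of_forall hn0)
  have hint : ∀ X : ℝ → Z → V, Continuous (Function.uncurry X) → ∀ z,
      Integrable (fun s => F s (X s) (X s z)) := fun X hX z =>
    hB.mono' (hmeas X hX z) (by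
      filter_upwards [hbd] with s hs using hs _ _ (by fun_prop))
  have hIB : ∀ X : ℝ → Z → V, Continuous (Function.uncurry X) → ∀ t z,
      ‖∫ s in τ..t, F s (X s) (X s z)‖ ≤ ∫ s, B s := fun X hX t z => by
    refine intervalIntegral.norm_integral_le_integral_norm_uIoc.trans ?_
    refine (setIntegral_le_integral (hint X hX z).norm
      (Eventually.of_forall fun _ => norm_nonneg _)).trans ?_
    refine integral_mono_ae (hint X hX z).norm hB ?_
    filter_upwards [hbd] with s hs using hs _ _ (by fun_prop)
  have hIc : ∀ X : ℝ → Z → V, Continuous (Function.uncurry X) →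
      Continuous fun p : ℝ × Z => ∫ s in τ..p.1, F s (X s) (X s p.2) := fun X hX => by
    rw [continuous_iff_continuousAt]
    rintro ⟨t, z⟩
    have := intervalIntegral.continuousAt_parametric_primitive_of_dominated (μ := volume)
      (F := fun z s => F s (X s) (X s z)) (x₀ := z) B (min τ t - 1) (max τ t + 1) (a₀ := τ)
      (b₀ := t) (fun x => (hmeas X hX x).restrict)
      (Eventually.of_forall fun x => ae_restrict_of_ae (by
        filter_upwards [hbd] with s hs using hs _ _ (by fun_prop)))
      hB.intervalIntegrable (ae_restrict_of_ae (by
        filter_upwards [hlip] with s hs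
        have hXs : Continuous (X s) := by fun_prop
        rw [ContinuousAt, tendsto_iff_norm_sub_tendsto_zero]
        have h1 : Tendsto (fun x => n s * (‖X s x - X s z‖ + 0)) (𝓝 z) (𝓝 0) := by
          have h2 : Continuous fun x => n s * (‖X s x - X s z‖ + 0) := by fun_prop
          simpa using h2.tendsto z
        exact squeeze_zero (fun _ => norm_nonneg _)
          (fun x => hs _ _ hXs hXs _ _ 0 (by simp)) h1))
      ⟨by linarith [min_le_left τ t], by linarith [le_max_left τ t]⟩
      ⟨by linarith [min_le_right τ t], by linarith [le_max_right τ t]⟩ (by simp)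
    exact ContinuousAt.comp (x := ((t, z) : ℝ × Z)) (f := Prod.swap)
      (g := fun p : Z × ℝ => ∫ s in τ..p.2, F s (X s) (X s p.1)) this
      continuous_swap.continuousAt
  -- The unknown is `exp (-4 N) X`, for which the integral operator is a contraction.
  let lift : BoundedContinuousFunction (ℝ × Z) V → ℝ → Z → V :=
    fun W s z => Real.exp (4 * N s) • W (s, z)
  have hlift : ∀ W, Continuous (Function.uncurry (lift W)) := fun W => by
    have : Function.uncurry (lift W) = fun p => Real.exp (4 * N p.1) • W p := rfl
    rw [this]; fun_prop
  have hc0 : ∀ z, 0 ≤ c := fun z => (norm_nonneg _).trans (hζc z)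
  let Φ : BoundedContinuousFunction (ℝ × Z) V → BoundedContinuousFunction (ℝ × Z) V := fun W =>
    BoundedContinuousFunction.ofNormedAddCommGroup
      (fun p => Real.exp (-(4 * N p.1)) •
        (ζ p.2 + ∫ s in τ..p.1, F s (lift W s) (lift W s p.2)))
      (by have := hIc _ (hlift W); fun_prop)
      (Real.exp (4 * J) * (c + ∫ s, B s)) (fun p => by
        rw [norm_smul, Real.norm_eq_abs, Real.abs_exp]
        have h1 : -(4 * N p.1) ≤ 4 * J := by linarith [neg_abs_le (N p.1), hNJ p.1]
        refine mul_le_mul (Real.exp_le_exp.2 h1) ((norm_add_le _ _).trans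
          (add_le_add (hζc _) (hIB _ (hlift W) _ _))) (norm_nonneg _) (Real.exp_pos _).le)
  have hΦ : ContractingWith (1 / 2) Φ := by
    refine ⟨by rw [one_div]; exact NNReal.inv_lt_one_iff (by norm_num) |>.2 (by norm_num),
      LipschitzWith.of_dist_le_mul fun W W' => ?_⟩
    rw [BoundedContinuousFunction.dist_le (by positivity)]
    rintro ⟨t, z⟩
    have hval : ∀ W, Φ W (t, z) = Real.exp (-(4 * N t)) •
        (ζ z + ∫ s in τ..t, F s (lift W s) (lift W s z)) := fun _ => rfl
    rw [hval, hval, dist_eq_norm, ← smul_sub, add_sub_add_left_eq_sub, norm_smul,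
      Real.norm_eq_abs, Real.abs_exp,
      ← intervalIntegral.integral_sub (hint _ (hlift W) z).intervalIntegrable
        (hint _ (hlift W') z).intervalIntegrable]
    set D := dist W W' with hD
    have hD0 : 0 ≤ D := dist_nonneg
    rcases lt_or_ge t τ with ht | ht
    · have : ∫ s in τ..t, F s (lift W s) (lift W s z) - F s (lift W' s) (lift W' s z) = 0 := by
        rw [intervalIntegral.integral_symm, intervalIntegral.integral_of_le ht.le,
          integral_Ioc_eq_integral_Ioo, setIntegral_eq_zero_of_forall_eq_zero, neg_zero]
        intro s hs
        rw [hpre s hs.2, hpre s hs.2, sub_zero]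
      rw [this, norm_zero, mul_zero]
      positivity
    · have hdom : ∀ᵐ s, ‖F s (lift W s) (lift W s z) - F s (lift W' s) (lift W' s z)‖
          ≤ 2 * D * (n s * Real.exp (4 * N s)) := by
        filter_upwards [hlip] with s hs
        have hle : ∀ z, ‖lift W s z - lift W' s z‖ ≤ Real.exp (4 * N s) * D := fun z => by
          simp only [lift]
          rw [← smul_sub, norm_smul, Real.norm_eq_abs, Real.abs_exp, ← dist_eq_norm]
          exact mul_le_mul_of_nonneg_left (BoundedContinuousFunction.dist_coe_le_dist _)
            (Real.exp_pos _).le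
        have hWc := hlift W
        have hWc' := hlift W'
        refine (hs _ _ (by fun_prop) (by fun_prop) _ _ _ hle).trans ?_
        have := mul_le_mul_of_nonneg_left (add_le_add_left (hle z) (Real.exp (4 * N s) * D)) (hn0 s)
        linarith
      have hexp : IntervalIntegrable (fun s => n s * Real.exp (4 * N s)) volume τ t :=
        hn.intervalIntegrable.mul_continuousOn (by fun_prop)
      have h1 := intervalIntegral.norm_integral_le_of_norm_le ht
        (hdom.mono fun s hs _ => hs) (hexp.const_mul (2 * D))
      rw [intervalIntegral.integral_const_mul, integral_mul_exp_primitive ht hn hn0 (by norm_num)]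
        at h1
      have h2 : Real.exp (-(4 * N t)) * Real.exp (4 * N t) = 1 := by rw [← Real.exp_add]; simp
      have h3 := Real.exp_pos (-(4 * N t))
      calc _ ≤ Real.exp (-(4 * N t)) * (2 * D * ((Real.exp (4 * N t) - 1) / 4)) := by gcongr
        _ = D / 2 * (1 - Real.exp (-(4 * N t))) := by linear_combination (D / 2) * h2
        _ ≤ D / 2 * 1 := by gcongr; linarith
        _ = _ := by push_cast; ring
  obtain ⟨W, hW⟩ : ∃ W, Φ W = W := ⟨_, hΦ.fixedPoint_isFixedPt⟩
  refine ⟨lift W, hlift W, fun t z => ?_⟩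
  have h1 : W (t, z) = Real.exp (-(4 * N t)) •
      (ζ z + ∫ s in τ..t, F s (lift W s) (lift W s z)) := by
    conv_lhs => rw [← hW]
    rfl
  show Real.exp (4 * N t) • W (t, z) = _
  rw [h1, smul_smul, ← Real.exp_add]
  simp

/-! ### Lagrangian flows of the controlled field -/

/-- The radial retraction onto the closed ball of radius `R`. -/
def radialRetract (R : ℝ) (x : E d) : E d := (R / max R ‖x‖) • x

lemma norm_radialRetract_le {R : ℝ} (hR : 0 < R) (x : E d) : ‖radialRetract R x‖ ≤ R := by
  have h : 0 < max R ‖x‖ := lt_max_of_lt_left hR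
  rw [radialRetract, norm_smul, Real.norm_eq_abs, abs_of_pos (by positivity), div_mul_eq_mul_div,
    div_le_iff₀ h]
  exact mul_le_mul_of_nonneg_left (le_max_right _ _) hR.le

lemma norm_radialRetract_le_norm {R : ℝ} (hR : 0 < R) (x : E d) : ‖radialRetract R x‖ ≤ ‖x‖ := by
  have h : 0 < max R ‖x‖ := lt_max_of_lt_left hR
  rw [radialRetract, norm_smul, Real.norm_eq_abs, abs_of_pos (by positivity)]
  exact mul_le_of_le_one_left (norm_nonneg _) ((div_le_one h).2 (le_max_left _ _))

lemma radialRetract_of_norm_le {R : ℝ} (hR : 0 < R) {x : E d} (hx : ‖x‖ ≤ R) :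
    radialRetract R x = x := by
  rw [radialRetract, max_eq_left hx, div_self hR.ne', one_smul]

lemma norm_radialRetract_sub_le {R : ℝ} (hR : 0 < R) (x y : E d) :
    ‖radialRetract R x - radialRetract R y‖ ≤ 2 * ‖x - y‖ := by
  set a := max R ‖x‖ with ha
  set b := max R ‖y‖ with hb
  have ha0 : 0 < a := lt_max_of_lt_left hR
  have hb0 : 0 < b := lt_max_of_lt_left hR
  have e : radialRetract R x - radialRetract R y
      = (R / a) • (x - y) + (R / a - R / b) • y := by
    rw [radialRetract, radialRetract, smul_sub, sub_smul]; abel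
  have h1 : ‖(R / a) • (x - y)‖ ≤ ‖x - y‖ := by
    rw [norm_smul, Real.norm_eq_abs, abs_of_pos (by positivity)]
    exact mul_le_of_le_one_left (norm_nonneg _) ((div_le_one ha0).2 (le_max_left _ _))
  have h2 : ‖(R / a - R / b) • y‖ ≤ ‖x - y‖ := by
    have h3 : |b - a| ≤ ‖x - y‖ := by
      have h4 : |b - a| ≤ |‖y‖ - ‖x‖| := by
        rw [hb, ha]
        rw [max_comm R, max_comm R]
        exact abs_max_sub_max_le_abs _ _ _
      exact h4.trans (by rw [norm_sub_rev]; exact abs_norm_sub_norm_le y x)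
    have e2 : R / a - R / b = (R / a) * ((b - a) / b) := by field_simp
    rw [norm_smul, Real.norm_eq_abs, e2, abs_mul, abs_of_pos (by positivity : 0 < R / a), abs_div,
      abs_of_pos hb0]
    calc R / a * (|b - a| / b) * ‖y‖ ≤ 1 * (|b - a| / b) * b := by
          gcongr
          · exact (div_le_one ha0).2 (le_max_left _ _)
          · exact le_max_right _ _
      _ = |b - a| := by field_simp
      _ ≤ _ := h3
  rw [e]
  exact (norm_add_le _ _).trans (by linarith)

lemma continuous_radialRetract {R : ℝ} (hR : 0 < R) :
    Continuous (radialRetract (d := d) R) := by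
  have h : LipschitzWith 2 (radialRetract (d := d) R) :=
    LipschitzWith.of_dist_le_mul fun x y => by
      rw [dist_eq_norm, dist_eq_norm]
      exact norm_radialRetract_sub_le hR x y
  exact h.continuous

lemma continuousOn_integral {Ω V : Type*} [TopologicalSpace Ω] [SecondCountableTopology Ω]
    [MeasurableSpace Ω] [OpensMeasurableSpace Ω] [NormedAddCommGroup V] [NormedSpace ℝ V]
    {γ : Measure Ω} [IsFiniteMeasure γ] {S : Set ℝ} {Y : ℝ → Ω → V} {c : ℝ}
    (hY : Continuous (Function.uncurry Y)) (hb : ∀ s ∈ S, ∀ z, ‖Y s z‖ ≤ c) :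
    ContinuousOn (fun t => ∫ z, Y t z ∂γ) S := by
  intro t _
  refine tendsto_integral_filter_of_dominated_convergence (fun _ => c) ?_ ?_ (integrable_const _)
    (Eventually.of_forall fun z => ?_)
  · refine Eventually.of_forall fun s => ?_
    have : Continuous (Y s) := by fun_prop
    exact this.aestronglyMeasurable
  · filter_upwards [self_mem_nhdsWithin] with s hs
    exact Eventually.of_forall (hb s hs)
  · have : Continuous fun s => Y s z := by fun_prop
    exact (this.tendsto t).mono_left nhdsWithin_le_nhds

/-- Gronwall's inequality for a speed of sublinear growth driven by a mean `e`. -/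
lemma le_of_growth {f e m : ℝ → ℝ} {a b r : ℝ} (hab : a ≤ b) (hm : Integrable m)
    (hm0 : ∀ t, 0 ≤ m t) (hr : 0 ≤ r) (hf : ContinuousOn f (Icc a b))
    (he : ContinuousOn e (Icc a b)) (he0 : ∀ t ∈ Icc a b, 0 ≤ e t)
    (h : ∀ t ∈ Icc a b, f t ≤ r + ∫ s in a..t, m s * (1 + f s + e s)) :
    f b ≤ (r + ∫ s in a..b, m s * (1 + e s)) * Real.exp (∫ s, m s) := by
  have i1 : ∀ t ∈ Icc a b, IntervalIntegrable (fun s => m s * (1 + e s)) volume a t := fun t ht =>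
    hm.intervalIntegrable.mul_continuousOn (by
      rw [uIcc_of_le ht.1]
      exact continuousOn_const.add (he.mono (Icc_subset_Icc_right ht.2)))
  have i2 : ∀ t ∈ Icc a b, IntervalIntegrable (fun s => m s * f s) volume a t := fun t ht =>
    hm.intervalIntegrable.mul_continuousOn (by
      rw [uIcc_of_le ht.1]; exact hf.mono (Icc_subset_Icc_right ht.2))
  have h1 : ∀ t ∈ Icc a b, ∫ s in a..t, m s * (1 + e s) ≤ ∫ s in a..b, m s * (1 + e s) := by
    intro t ht
    refine intervalIntegral.integral_mono_interval le_rfl ht.1 ht.2 ?_ (i1 b (right_mem_Icc.2 hab))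
    rw [EventuallyLE, ae_restrict_iff' measurableSet_Ioc]
    refine Eventually.of_forall fun s hs => ?_
    have := he0 s (Ioc_subset_Icc_self hs)
    exact mul_nonneg (hm0 s) (by linarith)
  refine (gronwall_integral (A := r + ∫ s in a..b, m s * (1 + e s)) hab hm hm0 hf
    fun t ht => ?_).trans ?_
  · refine (h t ht).trans ?_
    have e1 : ∫ s in a..t, m s * (1 + f s + e s)
        = (∫ s in a..t, m s * (1 + e s)) + ∫ s in a..t, m s * f s := by
      rw [← intervalIntegral.integral_add (i1 t ht) (i2 t ht)]
      exact intervalIntegral.integral_congr fun s _ => by ring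
    rw [e1]
    linarith [h1 t ht]
  · refine mul_le_mul_of_nonneg_left (Real.exp_le_exp.2 ?_) ?_
    · rw [intervalIntegral.integral_of_le hab]
      exact setIntegral_le_integral hm (Eventually.of_forall hm0)
    · refine add_nonneg hr (intervalIntegral.integral_nonneg hab fun s hs => ?_)
      have := he0 s hs
      exact mul_nonneg (hm0 s) (by linarith)

/-- A bound on the first moment of trajectories that start in the ball of radius `r`, where `M` is
the total growth rate of the field. -/
def flowMoment (r M : ℝ) : ℝ := (r + M) * Real.exp M * Real.exp (Real.exp M * M)

/-- A radius that bounds all trajectories that start in the ball of radius `r`, where `M` is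
the total growth rate of the field. -/
def flowRadius (r M : ℝ) : ℝ := (r + M * (1 + flowMoment r M)) * Real.exp M

/-- If the mean `e` is itself controlled by the bound that it yields along trajectories, then it is
bounded by `flowMoment`, and trajectories are bounded by `flowRadius`. -/
lemma growth_bounds {e m : ℝ → ℝ} {a b r : ℝ} (hm : Integrable m)
    (hm0 : ∀ t, 0 ≤ m t) (hr : 0 ≤ r)
    (he : ContinuousOn e (Icc a b))
    (hE : ∀ t ∈ Icc a b, e t ≤ (r + ∫ s in a..t, m s * (1 + e s)) * Real.exp (∫ s, m s)) :
    (∀ t ∈ Icc a b, e t ≤ flowMoment r (∫ s, m s)) ∧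
    ∀ t ∈ Icc a b, (r + ∫ s in a..t, m s * (1 + e s)) * Real.exp (∫ s, m s)
      ≤ flowRadius r (∫ s, m s) := by
  set M := ∫ s, m s with hM
  have hM0 : 0 ≤ M := integral_nonneg hm0
  have hmt : ∀ t ∈ Icc a b, ∫ s in a..t, m s ≤ M := fun t ht => by
    rw [intervalIntegral.integral_of_le ht.1]
    exact setIntegral_le_integral hm (Eventually.of_forall hm0)
  have i2 : ∀ t ∈ Icc a b, IntervalIntegrable (fun s => m s * e s) volume a t := fun t ht =>
    hm.intervalIntegrable.mul_continuousOn (by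
      rw [uIcc_of_le ht.1]; exact he.mono (Icc_subset_Icc_right ht.2))
  have e1 : ∀ t ∈ Icc a b, ∫ s in a..t, m s * (1 + e s)
      = (∫ s in a..t, m s) + ∫ s in a..t, m s * e s := fun t ht => by
    rw [← intervalIntegral.integral_add hm.intervalIntegrable (i2 t ht)]
    exact intervalIntegral.integral_congr fun s _ => by ring
  have hpos := Real.exp_pos M
  have h1 : ∀ t ∈ Icc a b, e t ≤ flowMoment r M := by
    intro t ht
    have hsub := Icc_subset_Icc_right (b := a) ht.2
    have := gronwall_integral (f := e) (l := fun s => Real.exp M * m s)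
      (A := (r + M) * Real.exp M) ht.1 (hm.const_mul _)
      (fun s => mul_nonneg hpos.le (hm0 s)) (he.mono hsub) (fun s hs => by
        have h2 := hE s (hsub hs)
        rw [e1 s (hsub hs)] at h2
        have h3 : ∫ q in a..s, Real.exp M * m q * e q = Real.exp M * ∫ q in a..s, m q * e q := by
          rw [← intervalIntegral.integral_const_mul]
          exact intervalIntegral.integral_congr fun q _ => by ring
        rw [h3]
        have := mul_le_mul_of_nonneg_right (hmt s (hsub hs)) hpos.le
        linarith)
    refine this.trans ?_
    rw [intervalIntegral.integral_const_mul, flowMoment]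
    have h4 := hmt t ht
    gcongr
  refine ⟨h1, fun t ht => ?_⟩
  have hsub := Icc_subset_Icc_right (b := a) ht.2
  have h2 : ∫ s in a..t, m s * (1 + e s) ≤ ∫ s in a..t, m s * (1 + flowMoment r M) := by
    refine intervalIntegral.integral_mono_on ht.1 ?_ (hm.mul_const _).intervalIntegrable
      fun s hs => ?_
    · exact hm.intervalIntegrable.mul_continuousOn (by
        rw [uIcc_of_le ht.1]; exact continuousOn_const.add (he.mono hsub))
    · have := h1 s (hsub hs)
      exact mul_le_mul_of_nonneg_left (by linarith) (hm0 s)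
  rw [intervalIntegral.integral_mul_const] at h2
  have hfm : 0 ≤ flowMoment r M := by unfold flowMoment; positivity
  have h3 := mul_le_mul_of_nonneg_right (hmt t ht) (by linarith : 0 ≤ 1 + flowMoment r M)
  rw [flowRadius]
  exact mul_le_mul_of_nonneg_right (by linarith) hpos.le

section flow

variable {U : Type*} [MetricSpace U]

/-- `X` is a flow along which the curve of measures `μ`, driven by the control `u`, is transported
from time `τ` to time `T`. Labels in the ball of radius `r` are initial positions; the other labels
are irrelevant. All positions lie in the ball of radius `R`. -/
structure IsFlow (v : ℝ → Pc d → U → E d → E d) (τ T r R : ℝ) (u : ℝ → U) (μ : ℝ → Pc d)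
    (X : ℝ → E d → E d) : Prop where
  cont : Continuous (Function.uncurry X)
  init : ∀ z, ‖z‖ ≤ r → X τ z = z
  bdd : ∀ t ∈ Icc τ T, ∀ z, ‖X t z‖ ≤ R
  eq : ∀ t ∈ Icc τ T, ∀ z, X t z = X τ z + ∫ s in τ..t, v s (μ s) (u s) (X s z)
  law_eq : ∀ t ∈ Icc τ T, μ t = law (μ τ).meas (X t)

variable {T τ : ℝ} {v : ℝ → Pc d → U → E d → E d} {m : ℝ → ℝ} {l : ℕ → ℝ → ℝ}

/-- A flow in a bounded continuous configuration is a `W_1`-continuous curve of measures. -/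
lemma bddCurve_law {P : Measure (E d)} [IsProbabilityMeasure P] {S : Set ℝ} {n : ℕ}
    {Y : ℝ → E d → E d} (hY : Continuous (Function.uncurry Y))
    (hb : ∀ s ∈ S, ∀ z, ‖Y s z‖ ≤ n) : BddCurve S n (fun s => law P (Y s)) := by
  have hYs : ∀ s, Continuous (Y s) := fun s => by fun_prop
  have hbdd : ∀ s ∈ S, BddRV P (Y s) n := fun s hs =>
    ⟨(hYs s).aemeasurable, Eventually.of_forall (hb s hs)⟩
  refine ⟨fun s hs => (hbdd s hs).law_mem, fun t ht => ?_⟩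
  have h1 : Tendsto (fun s => ∫ z, ‖Y s z - Y t z‖ ∂P) (𝓝[S] t) (𝓝 0) := by
    have : Tendsto (fun s => ∫ z, ‖Y s z - Y t z‖ ∂P) (𝓝[S] t) (𝓝 (∫ z, (0 : ℝ) ∂P)) := by
      refine tendsto_integral_filter_of_dominated_convergence (fun _ => (n : ℝ) + n) ?_ ?_
        (integrable_const _) (Eventually.of_forall fun z => ?_)
      · exact Eventually.of_forall fun s => ((hYs s).sub (hYs t)).norm.aestronglyMeasurable
      · filter_upwards [self_mem_nhdsWithin] with s hs
        refine Eventually.of_forall fun z => ?_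
        rw [norm_norm]
        exact (norm_sub_le _ _).trans (add_le_add (hb s hs z) (hb t ht z))
      · have hc : Continuous fun s => ‖Y s z - Y t z‖ := by fun_prop
        have := hc.tendsto t
        rw [sub_self, norm_zero] at this
        exact this.mono_left nhdsWithin_le_nhds
    simpa using this
  refine squeeze_zero' (Eventually.of_forall fun _ => Wp_nonneg _ _ _) ?_ h1
  filter_upwards [self_mem_nhdsWithin] with s hs using Wp_one_law_le (hbdd s hs) (hbdd t ht)

lemma Carath.ae_good (hC : Carath T v m l) (hτ : 0 ≤ τ) :
    ∀ᵐ s, s ∈ Icc τ T → GoodTime (v s) (m s) (fun k => l k s) :=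
  (ae_restrict_iff' measurableSet_Icc).1
    (ae_mono (Measure.restrict_mono (Icc_subset_Icc_left hτ) le_rfl) hC.good)

variable [MeasurableSpace U] [BorelSpace U] [SecondCountableTopology U]

/-- Existence of flows of the truncated field, for a measure argument `ν s Y` that depends on the
time `s` and on the configuration `Y`. -/
lemma Carath.exists_truncated_flow (hC : Carath T v m l) (hτ : 0 ≤ τ) {u : ℝ → U}
    (hu : AEMeasurable u (leb T)) {r : ℝ} (hr : 0 < r) {n : ℕ} (hn : 0 < n)
    {ν : ℝ → (E d → E d) → Pc d}
    (hν : ∀ s ∈ Icc τ T, ∀ Y, Continuous Y → ν s Y ∈ PcOn (ball0 d n))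
    (hνlip : ∀ s Y Y', Continuous Y → Continuous Y' → ∀ D : ℝ, (∀ z, ‖Y z - Y' z‖ ≤ D) →
      Wp 1 (ν s Y) (ν s Y') ≤ 2 * D)
    (hνcurve : ∀ X : ℝ → E d → E d, Continuous (Function.uncurry X) →
      BddCurve (Icc τ T) n (fun s => ν s (X s))) :
    ∃ X : ℝ → E d → E d, Continuous (Function.uncurry X) ∧ (∀ z, X τ z = radialRetract r z) ∧
      ∀ t ∈ Icc τ T, ∀ z, X t z = X τ z +
        ∫ s in τ..t, v s (ν s (X s)) (u s) (radialRetract n (X s z)) := by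
  have hn0 : (0 : ℝ) < n := by exact_mod_cast hn
  have hST : Icc τ T ⊆ Icc 0 T := Icc_subset_Icc_left hτ
  have hgood := hC.ae_good hτ
  obtain ⟨X, hXc, hX⟩ := exists_caratheodory_flow (Z := E d) (V := E d) (τ := τ)
    (F := fun s Y x => (Icc τ T).indicator (fun s => v s (ν s Y) (u s) (radialRetract n x)) s)
    (n := fun s => 2 * l n s) (B := fun s => m s * (1 + 2 * n)) ((hC.l_int n).const_mul 2)
    (fun s => mul_nonneg zero_le_two (hC.l_nonneg n s)) (hC.m_int.mul_const _)
    (fun s hs Y x => indicator_of_notMem (fun h => absurd h.1 (not_le.2 hs)) _)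
    (fun X hX z => by
      have h1 := hC.aestronglyMeasurable_comp measurableSet_Icc hST hu (hνcurve X hX)
        (x := fun s => radialRetract n (X s z))
        ((continuous_radialRetract hn0).comp (by fun_prop)).continuousOn
        (fun s _ => norm_radialRetract_le hn0 _)
      rw [← aestronglyMeasurable_indicator_iff measurableSet_Icc] at h1
      refine h1.congr (Eventually.of_forall fun s => ?_)
      by_cases hs : s ∈ Icc τ T
      · simp only [indicator_of_mem hs]
      · simp only [indicator_of_notMem hs])
    (by
      filter_upwards [hgood] with s hs Y x hY
      by_cases hsI : s ∈ Icc τ T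
      · rw [indicator_of_mem hsI]
        exact (hs hsI).norm_le (hC.m_nonneg s) (hν s hsI Y hY) (norm_radialRetract_le hn0 _) _
      · rw [indicator_of_notMem hsI, norm_zero]
        exact mul_nonneg (hC.m_nonneg s) (by positivity))
    (by
      filter_upwards [hgood] with s hs Y Y' hY hY' x x' D hD
      have hD0 : 0 ≤ D := (norm_nonneg _).trans (hD 0)
      by_cases hsI : s ∈ Icc τ T
      · rw [indicator_of_mem hsI, indicator_of_mem hsI]
        refine ((hs hsI).lip n (u s) _ (hν s hsI Y hY) _ (hν s hsI Y' hY') _ _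
          (norm_radialRetract_le hn0 _) (norm_radialRetract_le hn0 _)).trans ?_
        have h1 := norm_radialRetract_sub_le hn0 x x'
        have h2 := hνlip s Y Y' hY hY' D hD
        have h3 := mul_le_mul_of_nonneg_left (add_le_add h1 h2) (hC.l_nonneg n s)
        linarith
      · rw [indicator_of_notMem hsI, indicator_of_notMem hsI, sub_self, norm_zero]
        exact mul_nonneg (mul_nonneg zero_le_two (hC.l_nonneg n s)) (by positivity))
    (continuous_radialRetract hr) (norm_radialRetract_le hr)
  have h0 : ∀ z, X τ z = radialRetract r z := fun z => by rw [hX τ z]; simp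
  refine ⟨X, hXc, h0, fun t ht z => ?_⟩
  rw [hX t z, h0]
  congr 1
  refine intervalIntegral.integral_congr fun s hs => ?_
  rw [uIcc_of_le ht.1] at hs
  exact indicator_of_mem (show s ∈ Icc τ T from ⟨hs.1, hs.2.trans ht.2⟩) _

/-- Every control and every initial measure admit a flow: the truncated field has one, and by the a
priori bound `flowRadius` the truncation is inactive along it. -/
theorem Carath.exists_isFlow (hC : Carath T v m l) (hτ : τ ∈ Icc 0 T) {u : ℝ → U}
    (hu : AEMeasurable u (leb T)) {r : ℝ} (hr : 0 < r) {μ₀ : Pc d} (hμ₀ : μ₀ ∈ PcOn (ball0 d r)) :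
    ∃ μ X, μ τ = μ₀ ∧ IsFlow v τ T r (flowRadius r (∫ s, m s)) u μ X := by
  set R := flowRadius r (∫ s, m s) with hR
  obtain ⟨n, hnR⟩ := exists_nat_gt (max R 0)
  have hn0 : (0 : ℝ) < n := (le_max_right _ _).trans_lt hnR
  have hn : 0 < n := by exact_mod_cast hn0
  have hrc := continuous_radialRetract (d := d) hn0
  set P := μ₀.meas with hP
  have hbY : ∀ Y : E d → E d, Continuous Y → BddRV P (fun z => radialRetract n (Y z)) n :=
    fun Y hY => ⟨(hrc.comp hY).aemeasurable,
      Eventually.of_forall fun _ => norm_radialRetract_le hn0 _⟩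
  obtain ⟨X, hXc, hX0, hX⟩ := hC.exists_truncated_flow hτ.1 hu hr hn
    (ν := fun _ Y => law P (fun z => radialRetract n (Y z)))
    (fun s _ Y hY => (hbY Y hY).law_mem)
    (fun s Y Y' hY hY' D hD => Wp_one_law_le_of_le (hbY Y hY) (hbY Y' hY')
      (Eventually.of_forall fun z => (norm_radialRetract_sub_le hn0 _ _).trans
        (mul_le_mul_of_nonneg_left (hD z) zero_le_two)))
    (fun X hX => bddCurve_law (Y := fun s z => radialRetract n (X s z))
      (hrc.comp hX) (fun s _ z => norm_radialRetract_le hn0 _))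
  have hgood := hC.ae_good hτ.1
  -- The truncated flow is bounded, since the truncated field is.
  have hXs : ∀ s, Continuous (X s) := fun s => by fun_prop
  have hXb : ∀ t ∈ Icc τ T, ∀ z, ‖X t z‖ ≤ r + ∫ s, m s * (1 + 2 * n) := fun t ht z => by
    rw [hX t ht z]
    refine (norm_add_le _ _).trans (add_le_add (by rw [hX0]; exact norm_radialRetract_le hr z) ?_)
    refine (intervalIntegral.norm_integral_le_of_norm_le (g := fun s => m s * (1 + 2 * n)) ht.1
      ?_ (hC.m_int.mul_const _).intervalIntegrable).trans ?_
    · filter_upwards [hgood] with s hs hst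
      exact (hs ⟨hst.1.le, hst.2.trans ht.2⟩).norm_le (hC.m_nonneg s) (hbY _ (hXs s)).law_mem
        (norm_radialRetract_le hn0 _) _
    · rw [intervalIntegral.integral_of_le ht.1]
      exact setIntegral_le_integral (hC.m_int.mul_const _)
        (Eventually.of_forall fun s => mul_nonneg (hC.m_nonneg s) (by positivity))
  set e : ℝ → ℝ := fun s => ∫ z, ‖X s z‖ ∂P with he
  have hec : ContinuousOn e (Icc τ T) :=
    continuousOn_integral (Y := fun s z => ‖X s z‖) (by fun_prop)
      (fun s hs z => by rw [norm_norm]; exact hXb s hs z)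
  have he0 : ∀ t ∈ Icc τ T, 0 ≤ e t := fun t _ => integral_nonneg fun _ => norm_nonneg _
  have hXi : ∀ s, Integrable (fun z => ‖X s z‖) P := fun s =>
    integrable_of_continuous μ₀ (hXs s).norm
  have hgrow : ∀ t ∈ Icc τ T, ∀ z,
      ‖X t z‖ ≤ (r + ∫ s in τ..t, m s * (1 + e s)) * Real.exp (∫ s, m s) := by
    intro t ht z
    have hsub := Icc_subset_Icc_right (b := τ) ht.2
    have hXz : Continuous fun s => ‖X s z‖ := by fun_prop
    refine le_of_growth (f := fun s => ‖X s z‖) (e := e) ht.1 hC.m_int hC.m_nonneg hr.le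
      hXz.continuousOn (hec.mono hsub) (fun s hs => he0 s (hsub hs)) fun t' ht' => ?_
    show ‖X t' z‖ ≤ _
    rw [hX t' (hsub ht') z]
    refine (norm_add_le _ _).trans (add_le_add (by rw [hX0]; exact norm_radialRetract_le hr z) ?_)
    refine intervalIntegral.norm_integral_le_of_norm_le ht'.1 ?_ ?_
    · filter_upwards [hgood] with s hs hst
      have hsI : s ∈ Icc τ T := hsub ⟨hst.1.le, hst.2.trans ht'.2⟩
      refine ((hs hsI).growth (u s) _ _).trans ?_
      rw [(hbY _ (hXs s)).integral_law continuous_norm.aestronglyMeasurable]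
      refine mul_le_mul_of_nonneg_left ?_ (hC.m_nonneg s)
      refine add_le_add (add_le_add le_rfl (norm_radialRetract_le_norm hn0 _)) ?_
      exact integral_mono (hbY _ (hXs s)).integrable.norm (hXi s)
        fun z => norm_radialRetract_le_norm hn0 _
    · exact hC.m_int.intervalIntegrable.mul_continuousOn (by
        rw [uIcc_of_le ht'.1]
        exact (continuousOn_const.add hXz.continuousOn).add
          (hec.mono ((Icc_subset_Icc_right ht'.2).trans hsub)))
  have hgb := growth_bounds hC.m_int hC.m_nonneg hr.le hec (fun t ht => by
    calc e t ≤ ∫ _, (r + ∫ s in τ..t, m s * (1 + e s)) * Real.exp (∫ s, m s) ∂P :=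
          integral_mono (hXi t) (integrable_const _) (hgrow t ht)
      _ = _ := by simp)
  have hXR : ∀ t ∈ Icc τ T, ∀ z, ‖X t z‖ ≤ R := fun t ht z =>
    (hgrow t ht z).trans (hgb.2 t ht)
  have hXn : ∀ t ∈ Icc τ T, ∀ z, radialRetract n (X t z) = X t z := fun t ht z =>
    radialRetract_of_norm_le hn0 ((hXR t ht z).trans ((le_max_left _ _).trans hnR.le))
  have hτI : τ ∈ Icc τ T := left_mem_Icc.2 hτ.2
  have hinit : ∀ z, ‖z‖ ≤ r → X τ z = z := fun z hz => by
    rw [hX0, radialRetract_of_norm_le hr hz]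
  have hμτ : law P (X τ) = μ₀ := by
    have hb := bddRV_id hμ₀
    rw [← law_congr (Y := X τ) (X := fun x => x) ?_ hb, law_id]
    filter_upwards [mem_PcOn_ball.1 hμ₀] with z hz using (hinit z hz).symm
  refine ⟨fun t => law P (X t), X, hμτ, ⟨hXc, hinit, hXR, fun t ht z => ?_, fun t ht => ?_⟩⟩
  · conv_lhs => rw [hX t ht z]
    congr 1
    refine intervalIntegral.integral_congr fun s hs => ?_
    rw [uIcc_of_le ht.1] at hs
    have hsI : s ∈ Icc τ T := ⟨hs.1, hs.2.trans ht.2⟩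
    simp only [hXn s hsI]
  · show law P (X t) = law (law P (X τ)).meas (X t)
    rw [hμτ]

end flow

/-! ### Flows and solutions of the continuity equation -/

section flow

variable {U : Type*} [MetricSpace U] {T τ r R : ℝ} {v : ℝ → Pc d → U → E d → E d} {m : ℝ → ℝ}
  {l : ℕ → ℝ → ℝ} {u : ℝ → U} {μ : ℝ → Pc d} {X : ℝ → E d → E d}

lemma IsFlow.continuous_apply (h : IsFlow v τ T r R u μ X) (t : ℝ) : Continuous (X t) := by
  have := h.cont
  fun_prop

lemma IsFlow.continuous_time (h : IsFlow v τ T r R u μ X) (z : E d) :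
    Continuous fun t => X t z := by
  have := h.cont
  fun_prop

lemma IsFlow.bddRV (h : IsFlow v τ T r R u μ X) {t : ℝ} (ht : t ∈ Icc τ T)
    {P : Measure (E d)} : BddRV P (X t) R :=
  ⟨(h.continuous_apply t).aemeasurable, Eventually.of_forall (h.bdd t ht)⟩

lemma IsFlow.bddCurve (h : IsFlow v τ T r R u μ X) {n : ℕ} (hn : R ≤ n) :
    BddCurve (Icc τ T) n μ := by
  have h1 := bddCurve_law (P := (μ τ).meas) h.cont (S := Icc τ T) (n := n)
    (fun s hs z => (h.bdd s hs z).trans hn)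
  refine ⟨fun s hs => ?_, fun t ht => ?_⟩
  · rw [h.law_eq s hs]; exact h1.mem s hs
  · refine (h1.cont t ht).congr' ?_
    filter_upwards [self_mem_nhdsWithin] with s hs
    rw [h.law_eq s hs, h.law_eq t ht]

variable [MeasurableSpace U] [BorelSpace U] [SecondCountableTopology U]

lemma IsFlow.aestronglyMeasurable (h : IsFlow v τ T r R u μ X) (hC : Carath T v m l)
    (hτ : τ ∈ Icc 0 T) (hu : AEMeasurable u (leb T)) (z : E d) :
    AEStronglyMeasurable (fun t => v t (μ t) (u t) (X t z)) (volume.restrict (Icc τ T)) := by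
  obtain ⟨n, hn⟩ := exists_nat_ge R
  exact hC.aestronglyMeasurable_comp measurableSet_Icc (Icc_subset_Icc_left hτ.1) hu
    (h.bddCurve hn) (h.continuous_time z).continuousOn (fun s hs => (h.bdd s hs z).trans hn)

lemma IsFlow.ae_norm_le (h : IsFlow v τ T r R u μ X) (hC : Carath T v m l)
    (hτ : τ ∈ Icc 0 T) : ∀ᵐ t, t ∈ Icc τ T → ∀ z,
      ‖v t (μ t) (u t) (X t z)‖ ≤ m t * (1 + 2 * R) := by
  filter_upwards [hC.ae_good hτ.1] with t ht htI z
  refine (ht htI).norm_le (hC.m_nonneg t) ?_ (h.bdd t htI z) _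
  rw [h.law_eq t htI]
  exact (h.bddRV htI).law_mem

lemma IsFlow.integrableOn (h : IsFlow v τ T r R u μ X) (hC : Carath T v m l)
    (hτ : τ ∈ Icc 0 T) (hu : AEMeasurable u (leb T)) (z : E d) :
    IntegrableOn (fun t => v t (μ t) (u t) (X t z)) (Icc τ T) := by
  refine Integrable.mono' (hC.m_int.mul_const (1 + 2 * R)).integrableOn
    (h.aestronglyMeasurable hC hτ hu z) ?_
  rw [ae_restrict_iff' measurableSet_Icc]
  filter_upwards [h.ae_norm_le hC hτ] with t ht htI using ht htI z

/-- Curves transported by a flow solve the continuity equation: test functions integrate to zero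
along every characteristic, by the chain rule. -/
theorem IsFlow.solvesContinuityEq (h : IsFlow v τ T r R u μ X) (hC : Carath T v m l)
    (hτ : τ ∈ Icc 0 T) (hu : AEMeasurable u (leb T)) (hR : 0 ≤ R) :
    SolvesContinuityEq τ T (fun t ν x => v t ν (u t) x) μ := by
  obtain ⟨n, hn⟩ := exists_nat_ge R
  refine ⟨(h.bddCurve hn).cont, fun ξ hξ hξc hξs => ?_⟩
  set S := Icc τ T with hS
  set P := (μ τ).meas with hP
  set w : ℝ → E d → E d := fun t z => v t (μ t) (u t) (X t z) with hw
  have hfc : Continuous (fderiv ℝ ξ) := hξ.continuous_fderiv (by simp)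
  obtain ⟨L, hLb⟩ := (hξc.fderiv (𝕜 := ℝ)).exists_bound_of_continuous hfc
  have hL0 : 0 ≤ L := (norm_nonneg _).trans (hLb 0)
  set g : ℝ → E d → ℝ := fun t z => fderiv ℝ ξ (t, X t z) (1, w t z) with hg
  set κ : ℝ → ℝ := fun t => L * (1 + m t * (1 + 2 * R)) with hκ
  have hgood := hC.ae_good hτ.1
  have hgb : ∀ᵐ t, t ∈ S → ∀ z, ‖g t z‖ ≤ κ t := by
    filter_upwards [h.ae_norm_le hC hτ] with t ht htI z
    refine (ContinuousLinearMap.le_opNorm _ _).trans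
      (mul_le_mul (hLb _) ?_ (norm_nonneg _) hL0)
    have h1 : ‖((1 : ℝ), w t z)‖ ≤ ‖(1 : ℝ)‖ + ‖w t z‖ := by
      rw [Prod.norm_def]
      exact max_le (le_add_of_nonneg_right (norm_nonneg _))
        (le_add_of_nonneg_left (norm_nonneg _))
    rw [norm_one] at h1
    linarith [ht htI z]
  have hwm : AEStronglyMeasurable (fun a : ℝ × E d => w a.1 a.2)
      ((volume.restrict S).prod P) := by
    refine aestronglyMeasurable_comp_of_continuousWithinAt (Y := E d)
      (f := fun p (a : ℝ × E d) => w a.1 p) (y := fun a => a.2) (s := univ)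
      measurable_snd.aemeasurable (Eventually.of_forall fun _ => mem_univ _)
      (fun p _ => (h.aestronglyMeasurable hC hτ hu p).comp_fst) ?_
    have h1 := Measure.quasiMeasurePreserving_fst (μ := volume.restrict S) (ν := P) |>.ae
      ((ae_restrict_iff' measurableSet_Icc).2 hgood)
    have h2 := Measure.quasiMeasurePreserving_fst (μ := volume.restrict S) (ν := P) |>.ae
      (ae_restrict_mem measurableSet_Icc)
    filter_upwards [h1, h2] with a ha haI
    rw [continuousWithinAt_univ, ContinuousAt, tendsto_iff_norm_sub_tendsto_zero]
    have h3 : Tendsto (fun x => l n a.1 * ‖X a.1 x - X a.1 a.2‖) (𝓝 a.2) (𝓝 0) := by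
      have h4 := h.continuous_apply a.1
      have h5 : Continuous fun x => l n a.1 * ‖X a.1 x - X a.1 a.2‖ := by fun_prop
      simpa using h5.tendsto a.2
    exact squeeze_zero (fun _ => norm_nonneg _) (fun x => ha.lip_space
      ((h.bddCurve hn).mem _ haI) ((h.bdd _ haI _).trans hn) ((h.bdd _ haI _).trans hn) _) h3
  have hXc : Continuous fun a : ℝ × E d => (a.1, X a.1 a.2) := by
    have := h.cont
    fun_prop
  have hgi : Integrable (Function.uncurry g) ((volume.restrict S).prod P) := by
    have hκi : IntegrableOn κ S :=
      (((integrableOn_const (by simp [hS])).add (hC.m_int.mul_const _).integrableOn).const_mul L)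
    refine Integrable.mono' (hκi.comp_fst P) ?_ ?_
    · exact isBoundedBilinearMap_apply.continuous.comp_aestronglyMeasurable
        ((hfc.comp hXc).aestronglyMeasurable.prodMk
          (aestronglyMeasurable_const.prodMk hwm))
    · refine Measure.quasiMeasurePreserving_fst (μ := volume.restrict S) (ν := P) |>.ae
        ((ae_restrict_iff' measurableSet_Icc).2 hgb) |>.mono fun a ha => ha a.2
  have hzero : ∀ z, ∫ t in S, g t z = 0 := by
    intro z
    have hwz := h.integrableOn hC hτ hu z
    have hwI : IntervalIntegrable (fun t => w t z) volume τ T :=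
      (intervalIntegrable_iff_integrableOn_Icc_of_le hτ.2).2 hwz
    set k : ℝ → ℝ := fun t => 1 + m t * (1 + 2 * R) with hk
    have hk0 : ∀ t, 0 ≤ k t := fun t => by
      have := mul_nonneg (hC.m_nonneg t) (by linarith : 0 ≤ 1 + 2 * R)
      simp only [hk]; linarith
    have hki : ∀ a b, IntervalIntegrable k volume a b := fun a b =>
      intervalIntegrable_const.add (hC.m_int.mul_const _).intervalIntegrable
    set N : ℝ → ℝ := fun t => ∫ s in τ..t, k s with hN
    have hNac : AbsolutelyContinuousOnInterval N τ T :=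
      (hki τ T).absolutelyContinuousOnInterval_intervalIntegral left_mem_uIcc
    obtain ⟨L', hL'0, hL'⟩ := ContDiff.exists_lipschitz_of_hasCompactSupport hξ hξc
    have hstep : ∀ s ∈ S, ∀ t ∈ S, s ≤ t → ‖(t, X t z) - (s, X s z)‖ ≤ N t - N s := by
      intro s hs t ht hst
      have hsub : ∀ a ∈ S, ∀ b ∈ S, IntervalIntegrable (fun t => w t z) volume a b :=
        fun a ha b hb => (hwI.mono_set (by
          rw [uIcc_of_le hτ.2]; exact uIcc_subset_Icc ha hb))
      have e1 : X t z - X s z = ∫ q in s..t, w q z := by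
        rw [h.eq t ht z, h.eq s hs z, add_sub_add_left_eq_sub]
        exact intervalIntegral.integral_interval_sub_left
          (hsub _ (left_mem_Icc.2 hτ.2) _ ht) (hsub _ (left_mem_Icc.2 hτ.2) _ hs)
      have e2 : N t - N s = (t - s) + ∫ q in s..t, m q * (1 + 2 * R) := by
        rw [hN]
        simp only
        rw [intervalIntegral.integral_interval_sub_left (hki _ _) (hki _ _)]
        simp only [hk]
        rw [intervalIntegral.integral_add intervalIntegrable_const
          (hC.m_int.mul_const _).intervalIntegrable]
        simp
      have e3 : ‖X t z - X s z‖ ≤ ∫ q in s..t, m q * (1 + 2 * R) := by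
        rw [e1]
        refine intervalIntegral.norm_integral_le_of_norm_le hst ?_
          (hC.m_int.mul_const _).intervalIntegrable
        filter_upwards [h.ae_norm_le hC hτ] with q hq hqI
        exact hq ⟨hs.1.trans hqI.1.le, hqI.2.trans ht.2⟩ z
      have e4 : 0 ≤ ∫ q in s..t, m q * (1 + 2 * R) := (norm_nonneg _).trans e3
      rw [e2, Prod.mk_sub_mk, Prod.norm_def]
      refine max_le ?_ (by linarith)
      rw [Real.norm_eq_abs, abs_of_nonneg (by linarith)]
      linarith
    have hac : AbsolutelyContinuousOnInterval (fun t => ξ (t, X t z)) τ T := by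
      refine absolutelyContinuousOnInterval_of_dist_le (C := L') hNac fun s hs t ht => ?_
      rw [uIcc_of_le hτ.2] at hs ht
      rw [dist_eq_norm, Real.dist_eq]
      refine (hL' _ _).trans (mul_le_mul_of_nonneg_left ?_ hL'0)
      rcases le_total s t with hst | hst
      · rw [norm_sub_rev, abs_sub_comm]
        exact (hstep s hs t ht hst).trans (le_abs_self _)
      · exact (hstep t ht s hs hst).trans (le_abs_self _)
    have hder := AbsolutelyContinuousOnInterval.integral_eq_sub (f' := fun t => g t z) hτ.2 hac (by
      have n1 : ∀ᵐ t : ℝ, t ≠ τ := by simp [ae_iff, measure_singleton]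
      have n2 : ∀ᵐ t : ℝ, t ≠ T := by simp [ae_iff, measure_singleton]
      filter_upwards [hwI.ae_hasDerivAt_integral, n1, n2] with t ht ht1 ht2 htI
      have h1 := ht (by rwa [uIcc_of_le hτ.2]) τ left_mem_uIcc
      have hnhds : Icc τ T ∈ 𝓝 t :=
        Icc_mem_nhds (lt_of_le_of_ne htI.1 (Ne.symm ht1)) (lt_of_le_of_ne htI.2 ht2)
      have h2 : HasDerivAt (fun t => X t z) (w t z) t := by
        refine (h1.const_add (X τ z)).congr_of_eventuallyEq ?_
        filter_upwards [hnhds] with q hq using h.eq q hq z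
      have h3 : HasDerivAt (fun t => (t, X t z)) (1, w t z) t := (hasDerivAt_id t).prodMk h2
      exact ((hξ.differentiable (by simp) _).hasFDerivAt.comp_hasDerivAt t h3))
    have hb0 : ∀ t, t ∉ Ioo τ T → ∀ x, ξ (t, x) = 0 := fun t ht x =>
      image_eq_zero_of_notMem_tsupport fun hx => ht (hξs hx).1
    rw [hS, integral_Icc_eq_integral_Ioc, ← intervalIntegral.integral_of_le hτ.2, hder,
      hb0 T (by simp), hb0 τ (by simp), sub_zero]
  have hswap := integral_integral_swap hgi
  simp only [hzero, integral_zero] at hswap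
  rw [← hswap]
  refine integral_congr_ae ?_
  filter_upwards [(ae_restrict_iff' measurableSet_Icc).2 hgood,
    ae_restrict_mem measurableSet_Icc] with t ht htI
  have e1 : ∀ x, deriv (fun s => ξ (s, x)) t
      + inner ℝ (∇ (fun y => ξ (t, y)) x) (v t (μ t) (u t) x)
      = fderiv ℝ ξ (t, x) (1, v t (μ t) (u t) x) := by
    intro x
    have hd := (hξ.differentiable (by simp) (t, x)).hasFDerivAt
    have h1 : HasDerivAt (fun s => ξ (s, x)) (fderiv ℝ ξ (t, x) (1, 0)) t :=
      hd.comp_hasDerivAt (f := fun s => (s, x)) t ((hasDerivAt_id t).prodMk (hasDerivAt_const t x))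
    have h2 : HasFDerivAt (fun y => ξ (t, y))
        ((fderiv ℝ ξ (t, x)).comp (ContinuousLinearMap.inr ℝ ℝ (E d))) x :=
      hd.comp x (hasFDerivAt_prodMk_right t x)
    rw [inner_gradient_left, h1.deriv, h2.fderiv, ContinuousLinearMap.comp_apply,
      ContinuousLinearMap.inr_apply, ← map_add]
    simp
  simp only [e1]
  have hmem : μ t ∈ PcOn (ball0 d n) := (h.bddCurve hn).mem t htI
  have hmem' := hmem
  rw [h.law_eq t htI] at hmem'
  have hc2 : Continuous fun x : E d => fderiv ℝ ξ (t, x) := hfc.comp (Continuous.prodMk_right t)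
  have hme : AEStronglyMeasurable (fun x => fderiv ℝ ξ (t, x) (1, v t (μ t) (u t) x))
      (law P (X t)).meas :=
    isBoundedBilinearMap_apply.continuous.comp_aestronglyMeasurable
      (hc2.aestronglyMeasurable.prodMk
        (aestronglyMeasurable_const.prodMk (ht.aestronglyMeasurable hmem (u t) hmem')))
  have := (h.bddRV (P := P) htI).integral_law hme
  rw [← h.law_eq t htI] at this
  exact this

end flow

/-! ### Solutions of the continuity equation are transported by flows -/

section representation

variable {U : Type*} [MetricSpace U] {T τ r R : ℝ} {v : ℝ → Pc d → U → E d → E d} {m : ℝ → ℝ}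
  {l : ℕ → ℝ → ℝ} {u : ℝ → U} {μ : ℝ → Pc d} {X : ℝ → E d → E d}
variable [MeasurableSpace U] [BorelSpace U] [SecondCountableTopology U]

/-- The mass that a solution gives to the image of a compact set under characteristics is
nondecreasing: the balls that start around the points of a fine net of `A`, and whose radii grow
exponentially, retain their mass, and they shrink to the image of `A` when the net is refined. -/
lemma TestSolves.measure_le_measure_image {w : ℝ → E d → E d} {a b : ℝ} (hab : a ≤ b)
    (h : TestSolves a b w μ) {κ : ℝ → ℝ} (hκ : Integrable κ) (hκ0 : ∀ t, 0 ≤ κ t)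
    (hw : ∀ᵐ r ∂(volume.restrict (Icc a b)), ∀ x, ‖w r x‖ ≤ κ r * (1 + ‖x‖))
    (hwm : ∀ᵐ r ∂(volume.restrict (Icc a b)), AEStronglyMeasurable (w r) (μ r).meas)
    (hX : ∀ t ∈ Icc a b, Continuous (X t))
    (hXi : ∀ z, IntegrableOn (fun s => w s (X s z)) (Icc a b))
    (hXeq : ∀ t ∈ Icc a b, ∀ z, X t z = X a z + ∫ s in a..t, w s (X s z))
    {lam : ℝ → ℝ} (hlam : Integrable lam)
    (hmon : ∀ᵐ r ∂(volume.restrict (Icc a b)), ∀ᵐ x ∂(μ r).meas, ∀ z,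
      ‖w r x - w r (X r z)‖ ≤ lam r * ‖x - X r z‖)
    {A : Set (E d)} (hA : IsCompact A) (hXA : ∀ z ∈ A, X a z = z) :
    (μ a).meas A ≤ (μ b).meas (X b '' A) := by
  set Λ := ∫ r in a..b, lam r with hΛ
  have hbI : b ∈ Icc a b := right_mem_Icc.2 hab
  have hKc : IsCompact (X b '' A) := hA.image (hX b hbI)
  have key : ∀ ε > 0, (μ a).meas A ≤ (μ b).meas (Metric.cthickening ε (X b '' A)) := by
    intro ε hε
    -- the radius of the net for which the final balls have radius `ε`
    set δ := ε ^ 2 / (2 * Real.exp (2 * Λ)) with hδ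
    have hδ0 : 0 < δ := by positivity
    have hδε : 2 * δ * Real.exp (2 * Λ) = ε ^ 2 := by
      have := Real.exp_pos (2 * Λ)
      rw [hδ]; field_simp
    obtain ⟨t, htA, htf, hcov⟩ := hA.finite_cover_balls (Real.sqrt_pos.2 hδ0)
    haveI : Fintype t := htf.fintype
    set β : t → ℝ → E d := fun i => (Icc a b).indicator fun s => w s (X s i) with hβ
    have hβi : ∀ i, Integrable (β i) := fun i =>
      (integrable_indicator_iff measurableSet_Icc).2 (hXi i)
    have hint : ∀ i : t, ∀ s ∈ Icc a b, X s i = X a i + ∫ q in a..s, β i q := by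
      intro i s hs
      rw [hXeq s hs i]
      congr 1
      refine intervalIntegral.integral_congr fun q hq => ?_
      rw [uIcc_of_le hs.1] at hq
      have hqI : q ∈ Icc a b := ⟨hq.1, hq.2.trans hs.2⟩
      simp only [hβ, indicator_of_mem hqI]
    have h1 := h.measure_avoid_le hab hκ hκ0 hw hwm (p := fun (i : t) s => X s i) hβi
      (fun i s hs q hq => by
        rw [hint i s hs, hint i q hq, add_sub_add_left_eq_sub]
        exact intervalIntegral.integral_interval_sub_left (hβi i).intervalIntegrable
          (hβi i).intervalIntegrable)
      hlam (c := 0) (by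
        filter_upwards [hmon, ae_restrict_mem measurableSet_Icc] with q hq hqI
        filter_upwards [hq] with x hx i
        rw [hβ]
        simp only [indicator_of_mem hqI]
        refine (real_inner_le_norm _ _).trans ?_
        have := mul_le_mul_of_nonneg_left (hx i) (norm_nonneg (x - X q i))
        nlinarith) hδ0
    rw [← hΛ, hδε] at h1
    set B := {x | ∀ i : t, ε ^ 2 ≤ 0 + ‖x - X b i‖ ^ 2} with hB
    have hBm : MeasurableSet B := by
      rw [hB, ofPred_forall]
      exact MeasurableSet.iInter fun i => measurableSet_le measurable_const (by fun_prop)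
    have h2 : (μ b).meas B ≤ (μ a).meas Aᶜ := by
      have h3 : (μ b).meas B ≤ (μ a).meas {x | ∀ i : t, δ < 0 + ‖x - X a i‖ ^ 2} := by
        simpa [measureReal_def] using
          (ENNReal.toReal_le_toReal (measure_ne_top _ _) (measure_ne_top _ _)).1 h1
      refine h3.trans (measure_mono fun x hx hxA => ?_)
      obtain ⟨i, hi, hxi⟩ := mem_iUnion₂.1 (hcov hxA)
      have h4 := hx ⟨i, hi⟩
      simp only [hXA i (htA hi), zero_add] at h4
      rw [Metric.mem_ball, dist_eq_norm] at hxi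
      have h5 : ‖x - i‖ ^ 2 < δ := by
        have := Real.sq_sqrt hδ0.le
        nlinarith [norm_nonneg (x - i), Real.sqrt_nonneg δ]
      linarith
    have h6 : Bᶜ ⊆ Metric.cthickening ε (X b '' A) := by
      intro x hx
      have hx' : ¬ ∀ i : t, ε ^ 2 ≤ 0 + ‖x - X b i‖ ^ 2 := hx
      push Not at hx'
      obtain ⟨i, hi⟩ := hx'
      refine Metric.mem_cthickening_of_dist_le x (X b i) ε _ ⟨i, htA i.2, rfl⟩ ?_
      rw [dist_eq_norm]
      rw [zero_add] at hi
      exact (pow_lt_pow_iff_left₀ (norm_nonneg _) hε.le two_ne_zero).1 hi |>.le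
    have h7 := prob_compl_eq_one_sub (μ := (μ a).meas) hA.measurableSet
    have h8 := prob_compl_eq_one_sub (μ := (μ b).meas) hBm
    calc (μ a).meas A = 1 - (μ a).meas Aᶜ := by
          rw [h7, ENNReal.sub_sub_cancel ENNReal.one_ne_top prob_le_one]
      _ ≤ 1 - (μ b).meas B := tsub_le_tsub_left h2 _
      _ = (μ b).meas Bᶜ := h8.symm
      _ ≤ _ := measure_mono h6
  have hlim : Tendsto (fun ε => (μ b).meas (Metric.cthickening ε (X b '' A))) (𝓝[>] 0)
      (𝓝 ((μ b).meas (X b '' A))) :=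
    (tendsto_measure_cthickening_of_isClosed ⟨1, one_pos, measure_ne_top _ _⟩
      hKc.isClosed).mono_left nhdsWithin_le_nhds
  exact ge_of_tendsto hlim (by filter_upwards [self_mem_nhdsWithin] with ε hε using key ε hε)

/-- A probability measure that gives more mass to the images of compact sets is the image
measure. -/
lemma eq_law_of_measure_le_measure_image {μ ν : Pc d} {f : E d → E d} (hf : Continuous f)
    (hμ : μ ∈ PcOn (ball0 d r)) (hb : BddRV μ.meas f R)
    (h : ∀ A, IsCompact A → A ⊆ ball0 d r → μ.meas A ≤ ν.meas (f '' A)) : ν = law μ.meas f := by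
  refine Pc.ext_meas (Measure.eq_of_le_of_measure_univ_eq ?_ (by simp)).symm
  refine Measure.le_iff.2 fun B hB => ?_
  rw [hB.measure_eq_iSup_isCompact]
  refine iSup₂_le fun C hCB => iSup_le fun hC => ?_
  rw [hb.law_meas, Measure.map_apply hf.measurable hC.measurableSet]
  have hA : IsCompact (f ⁻¹' C ∩ ball0 d r) :=
    (isCompact_closedBall (0 : E d) r).inter_left (hC.isClosed.preimage hf)
  calc μ.meas (f ⁻¹' C) ≤ μ.meas (f ⁻¹' C ∩ ball0 d r) := by
        refine measure_mono_ae ?_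
        filter_upwards [mem_PcOn_ball.1 hμ] with x hx hxC
        exact ⟨hxC, by simpa using hx⟩
    _ ≤ ν.meas (f '' (f ⁻¹' C ∩ ball0 d r)) := h _ hA inter_subset_right
    _ ≤ ν.meas B := measure_mono (by
        rintro _ ⟨x, hx, rfl⟩
        exact hCB hx.1)

/-- Every solution `μ` of the continuity equation is transported by a flow, namely the
characteristics of the field in which the measure is frozen to `μ t`. -/
theorem SolvesContinuityEq.exists_isFlow
    (hμ : SolvesContinuityEq τ T (fun t ν x => v t ν (u t) x) μ) (hC : Carath T v m l)
    (hτ : τ ∈ Icc 0 T) (hu : AEMeasurable u (leb T)) (hr : 0 < r) (hμr : μ τ ∈ PcOn (ball0 d r)) :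
    ∃ X, IsFlow v τ T r (flowRadius r (∫ s, m s)) u μ X := by
  have hts := hC.testSolves hτ.1 hu hμ
  obtain ⟨Mo, hMo0, hMo⟩ := hμ.exists_moment_bound
  have hgood := hC.ae_good hτ.1
  have hgood' := (ae_restrict_iff' measurableSet_Icc).2 hgood
  set κ : ℝ → ℝ := fun s => m s * (1 + Mo) with hκ
  have hκi : Integrable κ := hC.m_int.mul_const _
  have hκ0 : ∀ t, 0 ≤ κ t := fun t => mul_nonneg (hC.m_nonneg t) (by linarith)
  have hw : ∀ᵐ s ∂(volume.restrict (Icc τ T)), ∀ x, ‖v s (μ s) (u s) x‖ ≤ κ s * (1 + ‖x‖) := by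
    filter_upwards [hgood', ae_restrict_mem measurableSet_Icc] with s hs hsI x
    refine (hs.growth _ _ _).trans ?_
    have h1 := hMo s hsI
    have h2 := hC.m_nonneg s
    calc _ ≤ m s * (1 + ‖x‖ + Mo) := by gcongr
      _ ≤ m s * ((1 + Mo) * (1 + ‖x‖)) := by
          refine mul_le_mul_of_nonneg_left ?_ h2
          nlinarith [mul_nonneg hMo0 (norm_nonneg x)]
      _ = _ := by rw [hκ]; ring
  have hwm : ∀ᵐ s ∂(volume.restrict (Icc τ T)),
      AEStronglyMeasurable (v s (μ s) (u s)) (μ s).meas := by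
    filter_upwards [hgood'] with s hs
    obtain ⟨R', -, hR'⟩ := exists_mem_PcOn_ball (μ s)
    obtain ⟨n, hn⟩ := exists_nat_ge R'
    exact hs.aestronglyMeasurable (PcOn_ball_mono hn hR') _ (PcOn_ball_mono hn hR')
  obtain ⟨R₀, hR₀⟩ := hts.exists_mem_PcOn_ball hκi hκ0 hw hwm
  set ρ := (r + ∫ s in τ..T, m s * (1 + Mo)) * Real.exp (∫ s, m s) with hρ
  obtain ⟨n, hnR⟩ := exists_nat_gt (max (max R₀ ρ) 0)
  have hn0 : (0 : ℝ) < n := (le_max_right _ _).trans_lt hnR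
  have hn : 0 < n := by exact_mod_cast hn0
  have hR₀n : R₀ ≤ n := ((le_max_left _ _).trans (le_max_left _ _)).trans hnR.le
  have hρn : ρ ≤ n := ((le_max_right _ _).trans (le_max_left _ _)).trans hnR.le
  have hμn : ∀ s ∈ Icc τ T, μ s ∈ PcOn (ball0 d n) := fun s hs => PcOn_ball_mono hR₀n (hR₀ s hs)
  obtain ⟨X, hXc, hX0, hX⟩ := hC.exists_truncated_flow hτ.1 hu hr hn (ν := fun s _ => μ s)
    (fun s hs _ _ => hμn s hs)
    (fun s Y Y' _ _ D hD => by
      rw [Wp_one_self]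
      exact mul_nonneg zero_le_two ((norm_nonneg _).trans (hD 0)))
    (fun _ _ => ⟨hμn, hμ.1⟩)
  have hXs : ∀ s, Continuous (X s) := fun s => by fun_prop
  have hXz : ∀ z, Continuous fun s => X s z := fun z => by fun_prop
  have hXτ : ∀ z, ‖X τ z‖ ≤ r := fun z => by rw [hX0]; exact norm_radialRetract_le hr z
  -- Growth along characteristics, for any continuous function that dominates the first moment.
  have hgrow : ∀ e : ℝ → ℝ, ContinuousOn e (Icc τ T) → (∀ s ∈ Icc τ T, ∫ y, ‖y‖ ∂(μ s).meas ≤ e s) →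
      ∀ t ∈ Icc τ T, ∀ z,
        ‖X t z‖ ≤ (r + ∫ s in τ..t, m s * (1 + e s)) * Real.exp (∫ s, m s) := by
    intro e he hme t ht z
    have hsub := Icc_subset_Icc_right (b := τ) ht.2
    refine le_of_growth (f := fun s => ‖X s z‖) (e := e) ht.1 hC.m_int hC.m_nonneg hr.le
      (hXz z).norm.continuousOn (he.mono hsub)
      (fun s hs => (integral_nonneg fun _ => norm_nonneg _).trans (hme s (hsub hs)))
      fun t' ht' => ?_
    show ‖X t' z‖ ≤ _
    rw [hX t' (hsub ht') z]
    refine (norm_add_le _ _).trans (add_le_add (hXτ z) ?_)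
    refine intervalIntegral.norm_integral_le_of_norm_le ht'.1 ?_ ?_
    · filter_upwards [hgood] with s hs hst
      have hsI : s ∈ Icc τ T := hsub ⟨hst.1.le, hst.2.trans ht'.2⟩
      refine ((hs hsI).growth (u s) _ _).trans
        (mul_le_mul_of_nonneg_left ?_ (hC.m_nonneg s))
      exact add_le_add (add_le_add le_rfl (norm_radialRetract_le_norm hn0 _)) (hme s hsI)
    · exact hC.m_int.intervalIntegrable.mul_continuousOn (by
        rw [uIcc_of_le ht'.1]
        exact (continuousOn_const.add (hXz z).norm.continuousOn).add
          (he.mono ((Icc_subset_Icc_right ht'.2).trans hsub)))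
  have hXn : ∀ t ∈ Icc τ T, ∀ z, ‖X t z‖ ≤ n := fun t ht z => by
    refine ((hgrow (fun _ => Mo) continuousOn_const hMo t ht z).trans ?_).trans hρn
    refine mul_le_mul_of_nonneg_right (add_le_add le_rfl ?_) (Real.exp_pos _).le
    exact intervalIntegral.integral_mono_interval le_rfl ht.1 ht.2
      (Eventually.of_forall hκ0) hκi.intervalIntegrable
  have hXeq : ∀ t ∈ Icc τ T, ∀ z, X t z = X τ z + ∫ s in τ..t, v s (μ s) (u s) (X s z) := by
    intro t ht z
    conv_lhs => rw [hX t ht z]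
    congr 1
    refine intervalIntegral.integral_congr fun s hs => ?_
    rw [uIcc_of_le ht.1] at hs
    have hsI : s ∈ Icc τ T := ⟨hs.1, hs.2.trans ht.2⟩
    simp only [radialRetract_of_norm_le hn0 (hXn s hsI z)]
  have hXi : ∀ z, IntegrableOn (fun s => v s (μ s) (u s) (X s z)) (Icc τ T) := fun z => by
    refine Integrable.mono' (hC.m_int.mul_const (1 + 2 * (n : ℝ))).integrableOn
      (hC.aestronglyMeasurable_comp measurableSet_Icc (Icc_subset_Icc_left hτ.1) hu (n := n)
        ⟨hμn, hμ.1⟩ (hXz z).continuousOn (fun s hs => hXn s hs z)) ?_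
    filter_upwards [hgood', ae_restrict_mem measurableSet_Icc] with s hs hsI
    exact hs.norm_le (hC.m_nonneg s) (hμn s hsI) (hXn s hsI z) _
  have hinit : ∀ z, ‖z‖ ≤ r → X τ z = z := fun z hz => by
    rw [hX0, radialRetract_of_norm_le hr hz]
  have hbdd : ∀ t ∈ Icc τ T, BddRV (μ τ).meas (X t) n := fun t ht =>
    ⟨(hXs t).aemeasurable, Eventually.of_forall (hXn t ht)⟩
  have hlaw : ∀ t ∈ Icc τ T, μ t = law (μ τ).meas (X t) := by
    intro t ht
    have hsub : Icc τ t ⊆ Icc τ T := Icc_subset_Icc_right ht.2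
    have hle : volume.restrict (Icc τ t) ≤ volume.restrict (Icc τ T) :=
      Measure.restrict_mono hsub le_rfl
    refine eq_law_of_measure_le_measure_image (hXs t) hμr (hbdd t ht) fun A hA hAr => ?_
    refine (hts.mono_right ht).measure_le_measure_image ht.1 hκi hκ0 (ae_mono hle hw)
      (ae_mono hle hwm) (fun s _ => hXs s) (fun z => (hXi z).mono_set hsub)
      (fun s hs z => hXeq s (hsub hs) z) (hC.l_int n) ?_ hA
      (fun z hz => hinit z (by simpa using hAr hz))
    filter_upwards [ae_mono hle hgood', ae_restrict_mem measurableSet_Icc] with s hs hsI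
    filter_upwards [mem_PcOn_ball.1 (hμn s (hsub hsI))] with x hx z
    exact hs.lip_space (hμn s (hsub hsI)) hx (hXn s (hsub hsI) z) _
  set e : ℝ → ℝ := fun s => ∫ z, ‖X s z‖ ∂(μ τ).meas with he
  have hee : ∀ s ∈ Icc τ T, ∫ y, ‖y‖ ∂(μ s).meas = e s := fun s hs => by
    conv_lhs => rw [hlaw s hs]
    exact (hbdd s hs).integral_law continuous_norm.aestronglyMeasurable
  have hec : ContinuousOn e (Icc τ T) :=
    continuousOn_integral (Y := fun s z => ‖X s z‖) (by fun_prop)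
      (fun s hs z => by rw [norm_norm]; exact hXn s hs z)
  have hge := hgrow e hec (fun s hs => (hee s hs).le)
  have hgb := growth_bounds hC.m_int hC.m_nonneg hr.le hec
    (fun t ht => by
    calc e t ≤ ∫ _, (r + ∫ s in τ..t, m s * (1 + e s)) * Real.exp (∫ s, m s) ∂(μ τ).meas :=
          integral_mono (integrable_of_continuous _ (hXs t).norm) (integrable_const _) (hge t ht)
      _ = _ := by simp)
  exact ⟨X, hXc, hinit, fun t ht z => (hge t ht z).trans (hgb.2 t ht), hXeq, hlaw⟩

end representation

/-! ### From local to global semiconcavity on segments -/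

/-- A differentiable function that satisfies the semiconcavity inequality on short intervals to the
right of every point satisfies it globally: otherwise, the difference with the chord, perturbed to
be strictly concave locally, would have an interior minimum, where its derivative vanishes. -/
lemma semiconcave_of_local {g g' : ℝ → ℝ} {κ : ℝ}
    (hd : ∀ s ∈ Icc (0 : ℝ) 1, HasDerivAt g (g' s) s)
    (hloc : ∀ s₀ ∈ Ioo (0 : ℝ) 1, ∀ᶠ s₁ in 𝓝[>] s₀, ∀ l ∈ Icc (0 : ℝ) 1,
      (1 - l) * g s₀ + l * g s₁ - g ((1 - l) * s₀ + l * s₁) ≤ κ * (l * (1 - l)) * (s₁ - s₀) ^ 2) :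
    ∀ l ∈ Icc (0 : ℝ) 1, (1 - l) * g 0 + l * g 1 - g l ≤ κ * (l * (1 - l)) := by
  suffices H : ∀ ε > 0, ∀ l ∈ Icc (0 : ℝ) 1,
      (1 - l) * g 0 + l * g 1 - g l ≤ (κ + ε) * (l * (1 - l)) by
    intro l hl
    have h1 : Tendsto (fun ε => (κ + ε) * (l * (1 - l))) (𝓝[>] 0) (𝓝 ((κ + 0) * (l * (1 - l)))) := by
      have : Continuous fun ε => (κ + ε) * (l * (1 - l)) := by fun_prop
      exact (this.tendsto 0).mono_left nhdsWithin_le_nhds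
    rw [add_zero] at h1
    exact ge_of_tendsto h1 (by filter_upwards [self_mem_nhdsWithin] with ε hε using H ε hε l hl)
  intro ε hε
  by_contra hcon
  push Not at hcon
  obtain ⟨l₀, hl₀, hlt⟩ := hcon
  set c := κ + ε with hc
  set H : ℝ → ℝ := fun s => g s - ((1 - s) * g 0 + s * g 1) + c * (s * (1 - s)) with hH
  have hHd : ∀ s ∈ Icc (0 : ℝ) 1, HasDerivAt H
      (g' s - ((-1) * g 0 + 1 * g 1) + c * (1 * (1 - s) + s * (-1))) s := by
    intro s hs
    have h1 : HasDerivAt (fun s : ℝ => 1 - s) (-1) s := by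
      simpa using (hasDerivAt_id s).const_sub 1
    exact ((hd s hs).sub ((h1.mul_const _).add ((hasDerivAt_id s).mul_const _))).add
      (((hasDerivAt_id s).mul h1).const_mul c)
  obtain ⟨s₀, hs₀, hmin⟩ := isCompact_Icc.exists_isMinOn ⟨l₀, hl₀⟩
    (fun s hs => (hHd s hs).continuousAt.continuousWithinAt)
  have hneg : H s₀ < 0 := by
    refine (hmin hl₀).trans_lt ?_
    simp only [hH]; linarith
  have hs₀' : s₀ ∈ Ioo (0 : ℝ) 1 := by
    refine ⟨lt_of_le_of_ne hs₀.1 fun h => ?_, lt_of_le_of_ne hs₀.2 fun h => ?_⟩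
    · rw [← h] at hneg; simp [hH] at hneg
    · rw [h] at hneg; simp [hH] at hneg
  have hd0 := hHd s₀ hs₀
  have hlm : IsLocalMin H s₀ := hmin.isLocalMin (Icc_mem_nhds hs₀'.1 hs₀'.2)
  rw [hlm.hasDerivAt_eq_zero hd0] at hd0
  have hev : ∀ᶠ s₁ in 𝓝[>] s₀, s₁ ∈ Ioo s₀ 1 := Ioo_mem_nhdsGT hs₀'.2
  obtain ⟨s₁, hs₁, hs₁I⟩ := ((hloc s₀ hs₀').and hev).exists
  have hpos : 0 < s₁ - s₀ := by linarith [hs₁I.1]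
  -- the difference quotients of `H` at `s₀` are bounded below by `ε (1 - l) (s₁ - s₀) ^ 2`
  have hq : ∀ l ∈ Ioo (0 : ℝ) 1, ε * (1 - l) * (s₁ - s₀) ^ 2
      ≤ l⁻¹ * (H (s₀ + l * (s₁ - s₀)) - H s₀) := by
    intro l hl
    have h1 := hs₁ l ⟨hl.1.le, hl.2.le⟩
    have h2 : H s₀ ≤ H s₁ := hmin (a := s₁) ⟨hs₀.1.trans hs₁I.1.le, hs₁I.2.le⟩
    have e1 : (1 - l) * s₀ + l * s₁ = s₀ + l * (s₁ - s₀) := by ring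
    rw [e1] at h1
    have h3 : l * (ε * (1 - l) * (s₁ - s₀) ^ 2) ≤ H (s₀ + l * (s₁ - s₀)) - H s₀ := by
      have h4 : 0 ≤ l * (H s₁ - H s₀) := mul_nonneg hl.1.le (by linarith)
      simp only [hH, hc] at h4 ⊢
      linarith
    rw [inv_mul_eq_div, le_div_iff₀ hl.1]
    linarith
  have hlin : HasDerivAt (fun l : ℝ => s₀ + l * (s₁ - s₀)) (s₁ - s₀) 0 := by
    simpa using ((hasDerivAt_id (0 : ℝ)).mul_const (s₁ - s₀)).const_add s₀
  have hcomp : HasDerivAt (fun l : ℝ => H (s₀ + l * (s₁ - s₀))) 0 0 := by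
    have h1 : HasDerivAt H 0 (s₀ + 0 * (s₁ - s₀)) := by rwa [zero_mul, add_zero]
    have h2 := h1.comp (0 : ℝ) hlin
    rw [zero_mul] at h2
    exact h2
  have hlim := hcomp.tendsto_slope_zero_right
  have hlim2 : Tendsto (fun l : ℝ => ε * (1 - l) * (s₁ - s₀) ^ 2) (𝓝[>] 0)
      (𝓝 (ε * (1 - 0) * (s₁ - s₀) ^ 2)) := by
    have : Continuous fun l : ℝ => ε * (1 - l) * (s₁ - s₀) ^ 2 := by fun_prop
    exact (this.tendsto 0).mono_left nhdsWithin_le_nhds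
  have := le_of_tendsto_of_tendsto hlim2 hlim (by
    filter_upwards [Ioo_mem_nhdsGT (zero_lt_one (α := ℝ))] with l hl
    have := hq l hl
    simpa using this)
  have : 0 < ε * (1 - 0) * (s₁ - s₀) ^ 2 := by positivity
  linarith

section finite

variable {ι : Type*} [Fintype ι] [MeasurableSpace ι] [MeasurableSingletonClass ι]
  {P : Measure ι} [IsProbabilityMeasure P] {A B : ι → E d} {R : ℝ}

lemma bddRV_of_finite (h : ∀ i, ‖A i‖ ≤ R) : BddRV P A R :=
  ⟨(measurable_of_finite A).aemeasurable, Eventually.of_forall h⟩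

lemma bddRV_norm (A : ι → E d) : BddRV P A ‖A‖ := bddRV_of_finite (norm_le_pi_norm A)

/-- In the configuration `B`, every particle is strictly closer to its own position in the
configuration `A` than to the other positions of `A`. -/
def Separated (A B : ι → E d) : Prop := ∀ i j, A i ≠ A j → ‖B i - A i‖ < ‖B i - A j‖

lemma ae_law_of_finite {p : E d → Prop} (h : ∀ᵐ i ∂P, p (A i)) :
    ∀ᵐ x ∂(law P A).meas, p x := by
  rw [(bddRV_norm A).law_meas]
  have hT : (A '' {i | p (A i)}).Finite := Set.toFinite _
  have : ∀ᵐ x ∂(P.map A), x ∈ A '' {i | p (A i)} := by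
    refine (ae_map_iff (p := fun x => x ∈ A '' {i | p (A i)})
      (measurable_of_finite A).aemeasurable hT.measurableSet).2 ?_
    filter_upwards [h] with i hi using ⟨i, hi, rfl⟩
  filter_upwards [this] with x hx
  obtain ⟨i, hi, rfl⟩ := hx
  exact hi

/-- Between separated configurations, the only optimal plan sends each particle to its own new
position, since this plan couples every point with the point closest to it. -/
theorem optPlans_eq_of_separated (h : Separated A B) (hA : BddRV P A R) (hB : BddRV P B R) :
    optPlans (law P A) (law P B) = {jointLaw P A B hA.1 hB.1} := by
  classical
  -- `n y` is the point of `A` nearest to the point `y` of `B`.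
  set n : E d → E d := fun y => if hy : ∃ i, B i = y then A hy.choose else 0 with hn
  have hnB : ∀ i, n (B i) = A i := by
    intro i
    have hex : ∃ j, B j = B i := ⟨i, rfl⟩
    simp only [hn, dif_pos hex]
    by_contra hne
    have hj := hex.choose_spec
    have h1 := h i hex.choose (fun h => hne h.symm)
    have h2 := h hex.choose i hne
    rw [hj] at h2
    exact lt_asymm h1 h2
  have hnm : Measurable n := by
    refine measurable_of_measurable_on_compl_finite (range B) (Set.finite_range B) ?_
    have : (range B)ᶜ.domRestrict n = fun _ => 0 := by
      funext y
      have hy : ¬ ∃ i, B i = (y : E d) := fun ⟨i, hi⟩ => y.2 ⟨i, hi⟩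
      show n y = 0
      simp only [hn, dif_neg hy]
    rw [this]; exact measurable_const
  have hAm := (measurable_of_finite A)
  have hBm := (measurable_of_finite B)
  set c := ∫ i, ‖A i - B i‖ ^ 2 ∂P with hc
  have hfst : ∀ᵐ x ∂(law P A).meas, x ∈ range A :=
    ae_law_of_finite (Eventually.of_forall fun i => mem_range_self i)
  have hsnd : ∀ᵐ y ∂(law P B).meas, y ∈ range B :=
    ae_law_of_finite (Eventually.of_forall fun i => mem_range_self i)
  have hcn : ∀ γ ∈ plans (law P A) (law P B),
      ∫ z, ‖n z.2 - z.2‖ ^ 2 ∂(γ : Measure (E d × E d)) = c := by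
    intro γ hγ
    have hm : Measurable fun y : E d => ‖n y - y‖ ^ 2 := (hnm.sub measurable_id).norm.pow_const 2
    have h1 := integral_map (μ := (γ : Measure (E d × E d))) measurable_snd.aemeasurable
      (f := fun y : E d => ‖n y - y‖ ^ 2) hm.aestronglyMeasurable
    rw [← h1, hγ.2, hB.law_meas, integral_map hBm.aemeasurable hm.aestronglyMeasurable]
    simp only [hnB, hc]
  have hle : ∀ γ ∈ plans (law P A) (law P B), ∀ᵐ z ∂(γ : Measure (E d × E d)),
      ‖n z.2 - z.2‖ ≤ ‖z.1 - z.2‖ ∧ (z.1 ≠ n z.2 → ‖n z.2 - z.2‖ < ‖z.1 - z.2‖) := by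
    intro γ hγ
    filter_upwards [plans_ae_fst hγ hfst, plans_ae_snd hγ hsnd] with z ⟨i, hi⟩ ⟨j, hj⟩
    have h1 : z.1 ≠ n z.2 → ‖n z.2 - z.2‖ < ‖z.1 - z.2‖ := fun hne => by
      rw [← hi, ← hj, hnB] at hne ⊢
      rw [norm_sub_rev, norm_sub_rev (A i)]
      exact h j i hne.symm
    refine ⟨?_, h1⟩
    by_cases heq : z.1 = n z.2
    · rw [heq]
    · exact (h1 heq).le
  have hint1 : ∀ γ ∈ plans (law P A) (law P B),
      Integrable (fun z : E d × E d => ‖z.1 - z.2‖ ^ 2) (γ : Measure (E d × E d)) := by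
    intro γ hγ
    refine Integrable.of_bound (C := (R + R) ^ 2) (by fun_prop) ?_
    filter_upwards [plans_ae_fst hγ (mem_PcOn_ball.1 hA.law_mem),
      plans_ae_snd hγ (mem_PcOn_ball.1 hB.law_mem)] with z h1 h2
    rw [Real.norm_of_nonneg (by positivity)]
    have := norm_sub_le z.1 z.2
    gcongr
    linarith
  have hint2 : ∀ γ ∈ plans (law P A) (law P B),
      Integrable (fun z : E d × E d => ‖n z.2 - z.2‖ ^ 2) (γ : Measure (E d × E d)) := by
    intro γ hγ
    refine (hint1 γ hγ).mono' ?_ ?_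
    · exact (((hnm.comp measurable_snd).sub measurable_snd).norm.pow_const 2).aestronglyMeasurable
    · filter_upwards [hle γ hγ] with z hz
      rw [Real.norm_of_nonneg (by positivity)]
      have := hz.1
      gcongr
  have hJ := jointLaw_mem_plans hA hB
  have hJc : planCost 2 (jointLaw P A B hA.1 hB.1) ^ 2 = c := by
    rw [planCost_two_sq, integral_jointLaw hA.1 hB.1 (by fun_prop)]
  have hmin : ∀ γ ∈ plans (law P A) (law P B),
      planCost 2 (jointLaw P A B hA.1 hB.1) ≤ planCost 2 γ := by
    intro γ hγ
    refine (pow_le_pow_iff_left₀ (planCost_nonneg _ _) (planCost_nonneg _ _) two_ne_zero).1 ?_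
    rw [hJc, planCost_two_sq, ← hcn γ hγ]
    refine integral_mono_ae (hint2 γ hγ) (hint1 γ hγ) ?_
    filter_upwards [hle γ hγ] with z hz
    have := hz.1
    gcongr
  have hW : Wp 2 (law P A) (law P B) = planCost 2 (jointLaw P A B hA.1 hB.1) :=
    le_antisymm (Wp_le_planCost hJ) (le_csInf ((plans_nonempty _ _).image _) (by
      rintro _ ⟨γ, hγ, rfl⟩
      exact hmin γ hγ))
  refine subset_antisymm ?_ (singleton_subset_iff.2 ⟨hJ, hW.symm⟩)
  rintro γ ⟨hγ, hγo⟩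
  have h0 : ∫ z, (‖z.1 - z.2‖ ^ 2 - ‖n z.2 - z.2‖ ^ 2) ∂(γ : Measure (E d × E d)) = 0 := by
    rw [integral_sub (hint1 γ hγ) (hint2 γ hγ), hcn γ hγ, ← planCost_two_sq, hγo, hW, hJc, sub_self]
  have hi3 : Integrable (fun z : E d × E d => ‖z.1 - z.2‖ ^ 2 - ‖n z.2 - z.2‖ ^ 2)
      (γ : Measure (E d × E d)) := (hint1 γ hγ).sub (hint2 γ hγ)
  rw [integral_eq_zero_iff_of_nonneg_ae ?_ hi3] at h0
  · have hae : (fun z : E d × E d => z) =ᵐ[(γ : Measure (E d × E d))] fun z => (n z.2, z.2) := by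
      filter_upwards [h0, hle γ hγ] with z hz hz2
      refine Prod.ext ?_ rfl
      by_contra hne
      have h1 := hz2.2 hne
      have h2 : ‖z.1 - z.2‖ ^ 2 - ‖n z.2 - z.2‖ ^ 2 = 0 := hz
      nlinarith [norm_nonneg (n z.2 - z.2)]
    have hm : Measurable fun y : E d => (n y, y) := hnm.prodMk measurable_id
    refine mem_singleton_iff.2 (Subtype.ext ?_)
    show (γ : Measure (E d × E d)) = P.map (fun i => (A i, B i))
    calc (γ : Measure (E d × E d)) = (γ : Measure (E d × E d)).map (fun z => z) :=
          Measure.map_id.symm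
      _ = (γ : Measure (E d × E d)).map ((fun y : E d => (n y, y)) ∘ Prod.snd) :=
          Measure.map_congr hae
      _ = ((γ : Measure (E d × E d)).map Prod.snd).map (fun y : E d => (n y, y)) :=
          (Measure.map_map hm measurable_snd).symm
      _ = (P.map B).map (fun y : E d => (n y, y)) := by rw [hγ.2, hB.law_meas]
      _ = P.map (fun i => (A i, B i)) := by
          rw [Measure.map_map hm hBm]
          congr 1
          funext i
          simp only [Function.comp_apply, hnB]
  · filter_upwards [hle γ hγ] with z hz
    have h1 := hz.1
    have : ‖n z.2 - z.2‖ ^ 2 ≤ ‖z.1 - z.2‖ ^ 2 := by gcongr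
    simp only [Pi.zero_apply]
    linarith

lemma Wp_two_of_separated (h : Separated A B) :
    Wp 2 (law P A) (law P B) ^ 2 = ∫ i, ‖A i - B i‖ ^ 2 ∂P := by
  have hA : BddRV P A (max ‖A‖ ‖B‖) := (bddRV_norm A).mono (le_max_left _ _)
  have hB : BddRV P B (max ‖A‖ ‖B‖) := (bddRV_norm B).mono (le_max_right _ _)
  have := optPlans_eq_of_separated h hA hB
  have hJ : jointLaw P A B hA.1 hB.1 ∈ optPlans (law P A) (law P B) := by rw [this]; rfl
  rw [Wp_two_sq_of_optPlans hJ, integral_jointLaw hA.1 hB.1 (by fun_prop)]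

/-- The configuration at time `s` on the segment from `A` to `B`. -/
def segConf (A B : ι → E d) (s : ℝ) : ι → E d := fun i => (1 - s) • A i + s • B i

lemma segConf_zero : segConf A B 0 = A := by funext i; simp [segConf]

lemma segConf_one : segConf A B 1 = B := by funext i; simp [segConf]

lemma segConf_sub (s s₀ : ℝ) (i : ι) :
    segConf A B s i - segConf A B s₀ i = (s - s₀) • (B i - A i) := by
  simp only [segConf]
  module

lemma segConf_segConf (a b l : ℝ) (i : ι) :
    (1 - l) • segConf A B a i + l • segConf A B b i
      = segConf A B ((1 - l) * a + l * b) i := by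
  simp only [segConf]
  module

lemma norm_segConf_le {s : ℝ} (hs : s ∈ Icc (0 : ℝ) 1) (hA : ∀ i, ‖A i‖ ≤ R)
    (hB : ∀ i, ‖B i‖ ≤ R) (i : ι) : ‖segConf A B s i‖ ≤ R :=
  norm_convexComb_le hs (hA i) (hB i)

lemma continuous_segConf : Continuous (segConf A B) := by
  unfold segConf
  fun_prop

/-- By continuity, for `s` near `s₀` each particle is closer to its own position at `s₀` than to those
of the particles located elsewhere at `s₀`. -/
lemma eventually_separated_segConf (A B : ι → E d) (s₀ : ℝ) :
    ∀ᶠ s in 𝓝 s₀, Separated (segConf A B s₀) (segConf A B s) := by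
  unfold Separated
  rw [eventually_all]
  intro i
  rw [eventually_all]
  intro j
  by_cases hij : segConf A B s₀ i = segConf A B s₀ j
  · exact Eventually.of_forall fun _ h => absurd hij h
  · have hc := continuous_segConf (A := A) (B := B)
    have h1 : Continuous fun s => ‖segConf A B s i - segConf A B s₀ i‖ := by fun_prop
    have h2 : Continuous fun s => ‖segConf A B s i - segConf A B s₀ j‖ := by fun_prop
    have h3 : ‖segConf A B s₀ i - segConf A B s₀ i‖ < ‖segConf A B s₀ i - segConf A B s₀ j‖ := by
      rw [sub_self, norm_zero]
      exact norm_pos_iff.2 (sub_ne_zero.2 hij)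
    filter_upwards [h1.continuousAt.eventually_lt h2.continuousAt h3] with s hs _ using hs

lemma integral_norm_segConf_sub_sq (s s₀ : ℝ) :
    ∫ i, ‖segConf A B s₀ i - segConf A B s i‖ ^ 2 ∂P
      = (s - s₀) ^ 2 * ∫ i, ‖A i - B i‖ ^ 2 ∂P := by
  rw [← integral_const_mul]
  refine integral_congr_ae (Eventually.of_forall fun i => ?_)
  simp only
  rw [norm_sub_rev, segConf_sub, norm_smul, mul_pow, Real.norm_eq_abs, sq_abs, norm_sub_rev]

/-- Lower derivative along a segment of configurations, from the subdifferential. -/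
lemma InSubdifferential.eventually_le {φ : Pc d → ℝ} {ξ : E d → E d} {s₀ : ℝ}
    (h : InSubdifferential φ (law P (segConf A B s₀)) ξ) {ε : ℝ} (hε : 0 < ε) :
    ∀ᶠ s in 𝓝 s₀, (s - s₀) * ∫ i, inner ℝ (ξ (segConf A B s₀ i)) (B i - A i) ∂P
        - ε * |s - s₀| ≤ φ (law P (segConf A B s)) - φ (law P (segConf A B s₀)) := by
  set k := Real.sqrt (∫ i, ‖A i - B i‖ ^ 2 ∂P) with hk
  have hk0 : 0 ≤ k := Real.sqrt_nonneg _
  obtain ⟨δ, hδ, H⟩ := h.2 1 one_pos (ε / (k + 1)) (by positivity)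
  have hcont := continuous_segConf (A := A) (B := B)
  have e1 : ∀ᶠ s in 𝓝 s₀, ∀ i, ‖segConf A B s i - segConf A B s₀ i‖ < 1 := by
    rw [eventually_all]
    intro i
    have h1 : Continuous fun s => ‖segConf A B s i - segConf A B s₀ i‖ := by fun_prop
    exact h1.continuousAt.eventually_lt_const (by simp)
  have e2 : ∀ᶠ s in 𝓝 s₀, |s - s₀| * k < δ := by
    have h1 : Continuous fun s => |s - s₀| * k := by fun_prop
    exact h1.continuousAt.eventually_lt_const (by simpa using hδ)
  filter_upwards [e1, e2, eventually_separated_segConf A B s₀] with s h1 h2 h3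
  set X := segConf A B s₀ with hX
  set Y := segConf A B s with hY
  have hW : Wp 2 (law P X) (law P Y) = |s - s₀| * k := by
    refine (pow_left_inj₀ (Wp_nonneg _ _ _) (by positivity) two_ne_zero).1 ?_
    rw [Wp_two_of_separated h3, integral_norm_segConf_sub_sq, mul_pow, sq_abs, hk,
      Real.sq_sqrt (integral_nonneg fun _ => by positivity)]
  have hmem : law P Y ∈ PcOn (fattening (law P X) 1) := by
    have hs : ∀ᵐ x ∂(law P X).meas, x ∈ (law P X).meas.support := Measure.support_mem_ae
    rw [(bddRV_norm X).law_meas] at hs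
    have hs' := ae_of_ae_map (measurable_of_finite X).aemeasurable hs
    have : ∀ᵐ y ∂(law P Y).meas, y ∈ fattening (law P X) 1 := by
      refine ae_law_of_finite ?_
      filter_upwards [hs'] with i hi
      rw [← (bddRV_norm X).law_meas] at hi
      refine mem_iUnion₂.2 ⟨X i, hi, ?_⟩
      rw [Metric.mem_closedBall, dist_eq_norm]
      exact (h1 i).le
    exact this
  have hfin := H _ hmem (by rw [hW]; exact h2)
  have hA : BddRV P X (max ‖X‖ ‖Y‖) := (bddRV_norm X).mono (le_max_left _ _)
  have hB : BddRV P Y (max ‖X‖ ‖Y‖) := (bddRV_norm Y).mono (le_max_right _ _)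
  rw [optPlans_eq_of_separated h3 hA hB, image_singleton, csInf_singleton, hW] at hfin
  have hξ : AEStronglyMeasurable ξ (P.map X) := by
    rw [← (bddRV_norm X).law_meas]; exact h.1.1
  have hpm : Measurable fun i => (X i, Y i) := measurable_of_finite _
  have hξ2 : AEStronglyMeasurable (fun z : E d × E d => inner ℝ (ξ z.1) (z.2 - z.1))
      (P.map fun i => (X i, Y i)) := by
    refine AEStronglyMeasurable.inner ?_ (by fun_prop)
    refine AEStronglyMeasurable.comp_aemeasurable (g := ξ) (f := Prod.fst) ?_
      measurable_fst.aemeasurable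
    rwa [Measure.map_map measurable_fst hpm]
  have e3 : ∫ z, inner ℝ (ξ z.1) (z.2 - z.1)
      ∂(jointLaw P X Y hA.1 hB.1 : Measure (E d × E d))
      = (s - s₀) * ∫ i, inner ℝ (ξ (X i)) (B i - A i) ∂P := by
    show ∫ z, inner ℝ (ξ z.1) (z.2 - z.1) ∂(P.map fun i => (X i, Y i)) = _
    rw [integral_map hpm.aemeasurable hξ2, ← integral_const_mul]
    refine integral_congr_ae (Eventually.of_forall fun i => ?_)
    simp only [hX, hY, segConf_sub, inner_smul_right]
  rw [e3] at hfin
  refine le_trans ?_ hfin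
  have h5 : ε / (k + 1) * (|s - s₀| * k) ≤ ε * |s - s₀| := by
    rw [div_mul_eq_mul_div, div_le_iff₀ (by positivity)]
    nlinarith [mul_nonneg hε.le (abs_nonneg (s - s₀))]
  linarith

/-- Chain rule for the Wasserstein gradient along a segment of configurations. -/
theorem IsWassersteinGradient.hasDerivAt_segConf {φ : Pc d → ℝ} {ξ : E d → E d} {s₀ : ℝ}
    (h : IsWassersteinGradient φ (law P (segConf A B s₀)) ξ) :
    HasDerivAt (fun s => φ (law P (segConf A B s)))
      (∫ i, inner ℝ (ξ (segConf A B s₀ i)) (B i - A i) ∂P) s₀ := by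
  rw [hasDerivAt_iff_isLittleO, Asymptotics.isLittleO_iff]
  intro c hc
  filter_upwards [h.2.1.eventually_le hc, InSubdifferential.eventually_le h.2.2 hc] with s h1 h2
  simp only [inner_neg_left, integral_neg] at h2
  rw [smul_eq_mul, Real.norm_eq_abs, Real.norm_eq_abs, abs_le]
  constructor <;> linarith

end finite

/-! ### Approximation by finite probability spaces -/

section approximation

variable {Ω : Type*} [MetricSpace Ω] [SecondCountableTopology Ω] [MeasurableSpace Ω]
  [BorelSpace Ω] {γ : Measure Ω} [IsProbabilityMeasure γ] {A B : Ω → E d} {R : ℝ}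

/-- The identity is a pointwise limit of simple functions. -/
lemma exists_simpleFunc_tendsto_id [Nonempty Ω] :
    ∃ s : ℕ → SimpleFunc Ω Ω, ∀ z, Tendsto (fun n => s n z) atTop (𝓝 z) := by
  obtain ⟨y⟩ := ‹Nonempty Ω›
  refine ⟨fun n => SimpleFunc.approxOn (fun z : Ω => z) measurable_id univ y (mem_univ y) n,
    fun z => ?_⟩
  exact SimpleFunc.tendsto_approxOn measurable_id (mem_univ y) (by simp)

/-- The measure that a measure on `Ω` induces on the range of a simple function. -/
def rangeMeasure (γ : Measure Ω) (s : SimpleFunc Ω Ω) : Measure s.range :=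
  γ.map fun z => ⟨s z, s.mem_range_self z⟩

lemma measurable_rangeFactorization (s : SimpleFunc Ω Ω) :
    Measurable fun z => (⟨s z, s.mem_range_self z⟩ : s.range) :=
  s.measurable.subtype_mk

instance (s : SimpleFunc Ω Ω) : IsProbabilityMeasure (rangeMeasure γ s) :=
  Measure.isProbabilityMeasure_map (μ := γ) (measurable_rangeFactorization s).aemeasurable

lemma law_rangeMeasure (s : SimpleFunc Ω Ω) (A : Ω → E d) :
    law (rangeMeasure γ s) (fun i => A i) = law γ (fun z => A (s z)) :=
  ((law_map (P' := γ) (P := rangeMeasure γ s) (measurable_rangeFactorization s).aemeasurable rfl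
    (bddRV_norm _)).2).symm

lemma integral_rangeMeasure (s : SimpleFunc Ω Ω) (f : Ω → ℝ) :
    ∫ i, f i ∂(rangeMeasure γ s) = ∫ z, f (s z) ∂γ :=
  integral_map (measurable_rangeFactorization s).aemeasurable
    (measurable_of_finite (fun i : s.range => f i)).aestronglyMeasurable

lemma bddRV_of_continuous (hA : Continuous A) (hAR : ∀ z, ‖A z‖ ≤ R) : BddRV γ A R :=
  ⟨hA.aemeasurable, Eventually.of_forall hAR⟩

lemma bddRV_comp_simpleFunc (hA : Continuous A) (hAR : ∀ z, ‖A z‖ ≤ R) (s : SimpleFunc Ω Ω) :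
    BddRV γ (fun z => A (s z)) R :=
  ⟨(hA.measurable.comp s.measurable).aemeasurable, Eventually.of_forall fun _ => hAR _⟩

lemma tendsto_Wp_one_law {s : ℕ → SimpleFunc Ω Ω}
    (hs : ∀ z, Tendsto (fun n => s n z) atTop (𝓝 z)) (hA : Continuous A) (hAR : ∀ z, ‖A z‖ ≤ R) :
    Tendsto (fun n => Wp 1 (law γ (fun z => A (s n z))) (law γ A)) atTop (𝓝 0) := by
  refine squeeze_zero (fun _ => Wp_nonneg _ _ _) (fun n => Wp_one_law_le
    (bddRV_comp_simpleFunc hA hAR (s n)) (bddRV_of_continuous hA hAR)) ?_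
  have : Tendsto (fun n => ∫ z, ‖A (s n z) - A z‖ ∂γ) atTop (𝓝 (∫ _, (0 : ℝ) ∂γ)) := by
    refine tendsto_integral_of_dominated_convergence (fun _ => R + R) (fun n => ?_)
      (integrable_const _) (fun n => Eventually.of_forall fun z => ?_)
      (Eventually.of_forall fun z => ?_)
    · exact ((hA.measurable.comp (s n).measurable).sub hA.measurable).norm.aestronglyMeasurable
    · rw [norm_norm]
      exact (norm_sub_le _ _).trans (add_le_add (hAR _) (hAR _))
    · have h1 : Tendsto (fun n => A (s n z) - A z) atTop (𝓝 (A z - A z)) :=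
        ((hA.tendsto z).comp (hs z)).sub_const _
      rw [sub_self] at h1
      simpa using h1.norm
  simpa using this

lemma tendsto_integral_norm_sub_sq {s : ℕ → SimpleFunc Ω Ω}
    (hs : ∀ z, Tendsto (fun n => s n z) atTop (𝓝 z)) (hA : Continuous A) (hAR : ∀ z, ‖A z‖ ≤ R)
    (hB : Continuous B) (hBR : ∀ z, ‖B z‖ ≤ R) :
    Tendsto (fun n => ∫ z, ‖A (s n z) - B (s n z)‖ ^ 2 ∂γ) atTop
      (𝓝 (∫ z, ‖A z - B z‖ ^ 2 ∂γ)) := by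
  have hc : Continuous fun z => ‖A z - B z‖ ^ 2 := by fun_prop
  refine tendsto_integral_of_dominated_convergence (fun _ => (R + R) ^ 2) (fun n => ?_)
    (integrable_const _) (fun n => Eventually.of_forall fun z => ?_)
    (Eventually.of_forall fun z => (hc.tendsto z).comp (hs z))
  · exact (hc.measurable.comp (s n).measurable).aestronglyMeasurable
  · rw [Real.norm_of_nonneg (by positivity)]
    have := (norm_sub_le (A (s n z)) (B (s n z))).trans (add_le_add (hAR _) (hBR _))
    gcongr

end approximation

/-! ### Semiconcavity of the final cost along arbitrary interpolations -/

section cost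

variable {φ : Pc d → ℝ} {R C : ℝ}

/-- On a finite probability space, semiconcavity along optimal plans implies semiconcavity along
all interpolations, since short segments are optimal. -/
lemma CostHyp.semiconcave_of_finite {ι : Type*} [Fintype ι] [MeasurableSpace ι]
    [MeasurableSingletonClass ι] {P : Measure ι} [IsProbabilityMeasure P] (hφ : CostHyp φ)
    (hC : ∀ μ₁ ∈ PcOn (ball0 d R), ∀ μ₂ ∈ PcOn (ball0 d R),
      ∀ γ, ∀ hγ : γ ∈ optPlans μ₁ μ₂, ∀ l ∈ Icc (0 : ℝ) 1,
        (1 - l) * φ μ₁ + l * φ μ₂ - φ (interp hγ.1 l) ≤ C * (l * (1 - l)) * Wp 2 μ₁ μ₂ ^ 2)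
    {A B : ι → E d} (hA : ∀ i, ‖A i‖ ≤ R) (hB : ∀ i, ‖B i‖ ≤ R) {l : ℝ} (hl : l ∈ Icc (0 : ℝ) 1) :
    (1 - l) * φ (law P A) + l * φ (law P B) - φ (law P (segConf A B l))
      ≤ C * (l * (1 - l)) * ∫ i, ‖A i - B i‖ ^ 2 ∂P := by
  choose ξ hξ using hφ.diff
  have := semiconcave_of_local (g := fun s => φ (law P (segConf A B s)))
    (κ := C * ∫ i, ‖A i - B i‖ ^ 2 ∂P)
    (fun s _ => (hξ (law P (segConf A B s))).2.hasDerivAt_segConf) (fun s₀ hs₀ => ?_) l hl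
  · rw [segConf_zero, segConf_one] at this
    linarith
  · filter_upwards [nhdsWithin_le_nhds (eventually_separated_segConf A B s₀),
      Ioo_mem_nhdsGT hs₀.2] with s₁ hsep hs₁ l hl
    have hX := bddRV_of_finite (P := P) (norm_segConf_le (Ioo_subset_Icc_self hs₀) hA hB)
    have hY := bddRV_of_finite (P := P)
      (norm_segConf_le (s := s₁) ⟨hs₀.1.le.trans hs₁.1.le, hs₁.2.le⟩ hA hB)
    have hJ : jointLaw P _ _ hX.1 hY.1 ∈ optPlans (law P (segConf A B s₀))
        (law P (segConf A B s₁)) := by rw [optPlans_eq_of_separated hsep hX hY]; rfl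
    have h1 := hC _ hX.law_mem _ hY.law_mem _ hJ l hl
    rw [interp_jointLaw hX hY, Wp_two_of_separated hsep, integral_norm_segConf_sub_sq] at h1
    simp only [segConf_segConf] at h1
    linarith

variable {Ω : Type*} [MetricSpace Ω] [SecondCountableTopology Ω] [MeasurableSpace Ω]
  [BorelSpace Ω] {γ : Measure Ω} [IsProbabilityMeasure γ] {A B : Ω → E d}

/-- Semiconcavity of the cost along all interpolations. -/
theorem CostHyp.semiconcave [Nonempty Ω] (hφ : CostHyp φ) (hR : 0 < R)
    (hC : ∀ μ₁ ∈ PcOn (ball0 d R), ∀ μ₂ ∈ PcOn (ball0 d R),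
      ∀ γ, ∀ hγ : γ ∈ optPlans μ₁ μ₂, ∀ l ∈ Icc (0 : ℝ) 1,
        (1 - l) * φ μ₁ + l * φ μ₂ - φ (interp hγ.1 l) ≤ C * (l * (1 - l)) * Wp 2 μ₁ μ₂ ^ 2)
    (hA : Continuous A) (hAR : ∀ z, ‖A z‖ ≤ R) (hB : Continuous B) (hBR : ∀ z, ‖B z‖ ≤ R)
    {l : ℝ} (hl : l ∈ Icc (0 : ℝ) 1) :
    (1 - l) * φ (law γ A) + l * φ (law γ B) - φ (law γ fun z => (1 - l) • A z + l • B z)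
      ≤ C * (l * (1 - l)) * ∫ z, ‖A z - B z‖ ^ 2 ∂γ := by
  obtain ⟨s, hs⟩ := exists_simpleFunc_tendsto_id (Ω := Ω)
  obtain ⟨L, hL⟩ := hφ.lipschitz R hR
  have hlim : ∀ D : Ω → E d, Continuous D → (∀ z, ‖D z‖ ≤ R) →
      Tendsto (fun n => φ (law γ (fun z => D (s n z)))) atTop (𝓝 (φ (law γ D))) := by
    intro D hD hDR
    rw [tendsto_iff_norm_sub_tendsto_zero]
    refine squeeze_zero (fun _ => norm_nonneg _) (fun n => hL _
      (bddRV_comp_simpleFunc hD hDR (s n)).law_mem _ (bddRV_of_continuous hD hDR).law_mem) ?_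
    simpa using (tendsto_Wp_one_law hs hD hDR).const_mul L
  refine le_of_tendsto_of_tendsto' ((((hlim A hA hAR).const_mul (1 - l)).add
    ((hlim B hB hBR).const_mul l)).sub (hlim (fun z => (1 - l) • A z + l • B z) (by fun_prop)
      fun z => norm_convexComb_le hl (hAR z) (hBR z)))
    ((tendsto_integral_norm_sub_sq (γ := γ) hs hA hAR hB hBR).const_mul _) fun n => ?_
  have h1 := hφ.semiconcave_of_finite (P := rangeMeasure γ (s n)) hC (A := fun i => A i)
    (B := fun i => B i) (fun i => hAR i) (fun i => hBR i) hl
  have e1 := law_rangeMeasure (γ := γ) (s n) A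
  have e2 := law_rangeMeasure (γ := γ) (s n) B
  have e3 := law_rangeMeasure (γ := γ) (s n) (fun z => (1 - l) • A z + l • B z)
  have e4 := integral_rangeMeasure (γ := γ) (s n) (fun z => ‖A z - B z‖ ^ 2)
  rw [← e1, ← e2, ← e3, ← e4]
  exact h1

end cost

/-! ### Semiconcavity of the velocity field along arbitrary interpolations -/

section velocity

variable {U : Type*} {w : Pc d → U → E d → E d} {u : U}

/-- The differentiability properties of the velocity field `w = v(t,·,·,·)` that hold, for each
control `u`, at almost every time `t`. -/
structure DiffTime (w : Pc d → U → E d → E d) (u : U) : Prop where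
  space : ∀ μ, Differentiable ℝ (w μ u)
  cont : ∀ n : ℕ, W1ContinuousOn (fun μ x => fderiv ℝ (w μ u) x) (PcOn (ball0 d (n + 1)))
    (ball0 d (n + 1))
  measure : ∀ μ x i, ∃ ξ, IsWassersteinGradient (fun ν => w ν u x i) μ ξ

lemma VelocityHyp.ae_diffTime [TopologicalSpace U] {T : ℝ} {v : ℝ → Pc d → U → E d → E d}
    (h : VelocityHyp T v) (u : U) : ∀ᵐ t ∂(leb T), DiffTime (v t) u := by
  have h1 := ae_all_iff.2 fun n : ℕ => h.diff_space (n + 1) (by positivity) u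
  filter_upwards [h1, h.diff_measure 1 one_pos u] with t ht1 ht2
  obtain ⟨G, hG, -⟩ := ht2
  exact ⟨(ht1 0).1, fun n => (ht1 n).2, fun μ x i => ⟨_, hG μ x i⟩⟩

section finite

variable {ι : Type*} [Fintype ι] [MeasurableSpace ι] [MeasurableSingletonClass ι]
  {P : Measure ι} [IsProbabilityMeasure P] {A B : ι → E d} {R : ℝ}

lemma norm_segConf_le_of_abs_le {s c : ℝ} (h0 : |s| ≤ c) (h1 : |1 - s| ≤ c) (i : ι) :
    ‖segConf A B s i‖ ≤ c * (‖A‖ + ‖B‖) := by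
  have hA := norm_le_pi_norm A i
  have hB := norm_le_pi_norm B i
  refine (norm_add_le _ _).trans ?_
  rw [norm_smul, norm_smul, Real.norm_eq_abs, Real.norm_eq_abs]
  have e1 := mul_le_mul h1 hA (norm_nonneg _) ((abs_nonneg _).trans h1)
  have e2 := mul_le_mul h0 hB (norm_nonneg _) ((abs_nonneg _).trans h0)
  linarith

lemma tendsto_Wp_one_segConf (s₀ : ℝ) :
    Tendsto (fun s => Wp 1 (law P (segConf A B s₀)) (law P (segConf A B s))) (𝓝 s₀) (𝓝 0) := by
  have hc := continuous_segConf (A := A) (B := B)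
  have h1 : Tendsto (fun s => ‖segConf A B s₀ - segConf A B s‖) (𝓝 s₀) (𝓝 0) := by
    have : Continuous fun s => ‖segConf A B s₀ - segConf A B s‖ := by fun_prop
    simpa using this.tendsto s₀
  refine squeeze_zero (fun _ => Wp_nonneg _ _ _) (fun s => ?_) h1
  exact Wp_one_law_le_of_le ((bddRV_norm _).mono (le_max_left _ _))
    ((bddRV_norm _).mono (le_max_right _ _))
    (Eventually.of_forall fun i => norm_le_pi_norm (segConf A B s₀ - segConf A B s) i)

/-- The velocity field is differentiable when measure and position move along segments. -/
lemma DiffTime.exists_hasDerivAt (h : DiffTime w u) (A B : ι → E d) (p q : E d) (s₀ : ℝ) :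
    ∃ D, HasDerivAt (fun s => w (law P (segConf A B s)) u ((1 - s) • p + s • q)) D s₀ := by
  set x : ℝ → E d := fun s => (1 - s) • p + s • q with hx
  have hxc : Continuous x := by rw [hx]; fun_prop
  have hxs : ∀ s, x s - x s₀ = (s - s₀) • (q - p) := fun s => by simp only [hx]; module
  set L := fderiv ℝ (w (law P (segConf A B s₀)) u) (x s₀) with hL
  choose ξ hξ using fun i => h.measure (law P (segConf A B s₀)) (x s₀) i
  have h1 : HasDerivAt (fun s => w (law P (segConf A B s)) u (x s₀))
      (WithLp.toLp 2 fun i => ∫ j, inner ℝ (ξ i (segConf A B s₀ j)) (B j - A j) ∂P) s₀ := by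
    have h2 : HasDerivAt (fun s i => w (law P (segConf A B s)) u (x s₀) i)
        (fun i => ∫ j, inner ℝ (ξ i (segConf A B s₀ j)) (B j - A j) ∂P) s₀ :=
      hasDerivAt_pi.2 fun i => (hξ i).hasDerivAt_segConf
    exact ((PiLp.continuousLinearEquiv 2 ℝ (fun _ : Fin d => ℝ)).symm :
      (Fin d → ℝ) →L[ℝ] E d).hasFDerivAt.comp_hasDerivAt s₀ h2
  have h3 : HasDerivAt (fun s => w (law P (segConf A B s)) u (x s)
      - w (law P (segConf A B s)) u (x s₀)) (L (q - p)) s₀ := by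
    rw [hasDerivAt_iff_isLittleO, Asymptotics.isLittleO_iff]
    intro c hc
    obtain ⟨n, hn⟩ := exists_nat_ge
      (max ((|s₀| + 2) * (‖A‖ + ‖B‖)) ((|s₀| + 2) * (‖p‖ + ‖q‖)))
    have hbd : ∀ s, |s - s₀| < 1 → (∀ i, ‖segConf A B s i‖ ≤ n + 1) ∧ ‖x s‖ ≤ n + 1 := by
      intro s hs
      have e0 : |s| ≤ |s₀| + 2 := by
        have := abs_add_le (s - s₀) s₀
        rw [sub_add_cancel] at this
        linarith
      have e1 : |1 - s| ≤ |s₀| + 2 := by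
        have := abs_sub (1 - s₀) (s - s₀)
        have h5 := abs_sub 1 s₀
        rw [abs_one] at h5
        have h6 : (1 - s₀) - (s - s₀) = 1 - s := by ring
        rw [h6] at this
        linarith
      refine ⟨fun i => ?_, ?_⟩
      · linarith [norm_segConf_le_of_abs_le (A := A) (B := B) e0 e1 i, le_max_left
          ((|s₀| + 2) * (‖A‖ + ‖B‖)) ((|s₀| + 2) * (‖p‖ + ‖q‖))]
      · have e2 := norm_segConf_le_of_abs_le (A := fun _ : Unit => p) (B := fun _ => q) e0 e1 ()
        rw [pi_norm_const, pi_norm_const] at e2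
        have e3 : ‖x s‖ ≤ (|s₀| + 2) * (‖p‖ + ‖q‖) := e2
        linarith [le_max_right ((|s₀| + 2) * (‖A‖ + ‖B‖)) ((|s₀| + 2) * (‖p‖ + ‖q‖))]
    have hs₀ := hbd s₀ (by simp)
    obtain ⟨δ, hδ, H⟩ := h.cont n (law P (segConf A B s₀)) (bddRV_of_finite hs₀.1).law_mem (x s₀)
      (by simpa using hs₀.2) (c / (‖q - p‖ + 1)) (by positivity)
    have e1 : ∀ᶠ s in 𝓝 s₀, |s - s₀| < 1 := by
      have : Continuous fun s => |s - s₀| := by fun_prop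
      exact this.continuousAt.eventually_lt_const (by simp)
    have e2 : ∀ᶠ s in 𝓝 s₀, ‖x s - x s₀‖ < δ := by
      have : Continuous fun s => ‖x s - x s₀‖ := by fun_prop
      exact this.continuousAt.eventually_lt_const (by simpa using hδ)
    filter_upwards [e1, e2, (tendsto_Wp_one_segConf (P := P) (A := A) (B := B) s₀).eventually_lt_const hδ]
      with s h4 h5 h6
    have hs := hbd s h4
    have hconv : Convex ℝ (Metric.ball (x s₀) δ ∩ ball0 d (n + 1)) :=
      (convex_ball _ _).inter (convex_closedBall _ _)
    have key := hconv.norm_image_sub_le_of_norm_fderiv_le' (𝕜 := ℝ)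
      (f := w (law P (segConf A B s)) u) (φ := L) (C := c / (‖q - p‖ + 1)) (x := x s₀) (y := x s)
      (fun y _ => h.space _ y)
      (fun y hy => by
        rw [← dist_eq_norm, dist_comm]
        exact (H _ (bddRV_of_finite hs.1).law_mem y hy.2 h6
          (by rw [dist_comm]; exact hy.1)).le)
      ⟨by simpa using hδ, by simpa using hs₀.2⟩
      ⟨by rw [Metric.mem_ball, dist_eq_norm]; exact h5, by simpa using hs.2⟩
    simp only [sub_self, sub_zero]
    rw [← map_smul, ← hxs]
    refine key.trans ?_
    rw [hxs, norm_smul, div_mul_eq_mul_div, div_le_iff₀ (by positivity)]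
    nlinarith [mul_nonneg hc.le (norm_nonneg (s - s₀))]
  refine ⟨_, (h3.add h1).congr_of_eventuallyEq (Eventually.of_forall fun s => ?_)⟩
  simp [hx]

/-- On a finite probability space, semiconcavity of the velocity field along separated
configurations implies semiconcavity along all interpolations. -/
lemma DiffTime.semiconcave_of_separated (h : DiffTime w u) {C : ℝ} (hC0 : 0 ≤ C)
    (hC : ∀ A B : ι → E d, Separated A B → (∀ i, ‖A i‖ ≤ R) → (∀ i, ‖B i‖ ≤ R) →
      ∀ p q : E d, ‖p‖ ≤ R → ‖q‖ ≤ R → ∀ l ∈ Icc (0 : ℝ) 1,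
      ‖(1 - l) • w (law P A) u p + l • w (law P B) u q
          - w (law P (segConf A B l)) u ((1 - l) • p + l • q)‖
        ≤ C * (l * (1 - l)) * (‖p - q‖ ^ 2 + ∫ i, ‖A i - B i‖ ^ 2 ∂P))
    (hA : ∀ i, ‖A i‖ ≤ R) (hB : ∀ i, ‖B i‖ ≤ R) {p q : E d} (hp : ‖p‖ ≤ R) (hq : ‖q‖ ≤ R)
    {l : ℝ} (hl : l ∈ Icc (0 : ℝ) 1) :
    ‖(1 - l) • w (law P A) u p + l • w (law P B) u q
        - w (law P (segConf A B l)) u ((1 - l) • p + l • q)‖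
      ≤ C * (l * (1 - l)) * (‖p - q‖ ^ 2 + ∫ i, ‖A i - B i‖ ^ 2 ∂P) := by
  set e := (1 - l) • w (law P A) u p + l • w (law P B) u q
        - w (law P (segConf A B l)) u ((1 - l) • p + l • q) with he
  set K := ‖p - q‖ ^ 2 + ∫ i, ‖A i - B i‖ ^ 2 ∂P with hK
  set x : ℝ → E d := fun s => (1 - s) • p + s • q with hx
  -- the scalar function is the component of the field in the direction of the defect `e`
  set g : ℝ → ℝ := fun s => inner ℝ e (w (law P (segConf A B s)) u (x s)) with hg
  choose D hD using h.exists_hasDerivAt (P := P) A B p q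
  have hinner : ∀ (y₁ y₂ y₃ : E d) (l : ℝ), (1 - l) * inner ℝ e y₁ + l * inner ℝ e y₂ - inner ℝ e y₃
      = inner ℝ e ((1 - l) • y₁ + l • y₂ - y₃) := fun y₁ y₂ y₃ l => by
    rw [inner_sub_right, inner_add_right, inner_smul_right, inner_smul_right]
  have g0 : g 0 = inner ℝ e (w (law P A) u p) := by
    have hx0 : x 0 = p := by simp [hx]
    simp only [hg]
    rw [segConf_zero, hx0]
  have g1 : g 1 = inner ℝ e (w (law P B) u q) := by
    have hx1 : x 1 = q := by simp [hx]
    simp only [hg]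
    rw [segConf_one, hx1]
  have key := semiconcave_of_local (g := g) (g' := fun s => inner ℝ e (D s)) (κ := ‖e‖ * C * K)
    (fun s _ => (innerSL ℝ e).hasFDerivAt.comp_hasDerivAt s (hD s)) (fun s₀ hs₀ => ?_) l hl
  · have e1 : (1 - l) * g 0 + l * g 1 - g l = ‖e‖ ^ 2 := by
      rw [g0, g1, hinner, ← real_inner_self_eq_norm_sq]
    rw [e1] at key
    rcases (norm_nonneg e).eq_or_lt with h0 | h0
    · have h2 : 0 ≤ K := add_nonneg (by positivity) (integral_nonneg fun _ => by positivity)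
      exact h0.symm.le.trans (mul_nonneg (mul_nonneg hC0
        (mul_nonneg hl.1 (sub_nonneg.2 hl.2))) h2)
    · have h2 : ‖e‖ * ‖e‖ ≤ ‖e‖ * (C * (l * (1 - l)) * K) := by
        rw [sq] at key
        refine key.trans (le_of_eq ?_)
        ring
      exact le_of_mul_le_mul_left h2 h0
  · filter_upwards [nhdsWithin_le_nhds (eventually_separated_segConf A B s₀),
      Ioo_mem_nhdsGT hs₀.2] with s₁ hsep hs₁ l hl
    have hs₀' := Ioo_subset_Icc_self hs₀
    have hs₁' : s₁ ∈ Icc (0 : ℝ) 1 := ⟨hs₀.1.le.trans hs₁.1.le, hs₁.2.le⟩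
    have h1 := hC _ _ hsep (norm_segConf_le hs₀' hA hB) (norm_segConf_le hs₁' hA hB)
      (x s₀) (x s₁) (norm_convexComb_le hs₀' hp hq) (norm_convexComb_le hs₁' hp hq) l hl
    have e2 : segConf (segConf A B s₀) (segConf A B s₁) l
        = segConf A B ((1 - l) * s₀ + l * s₁) := funext fun i => segConf_segConf s₀ s₁ l i
    have e3 : (1 - l) • x s₀ + l • x s₁ = x ((1 - l) * s₀ + l * s₁) := by
      simp only [hx]; module
    have e4 : ‖x s₀ - x s₁‖ ^ 2 = (s₁ - s₀) ^ 2 * ‖p - q‖ ^ 2 := by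
      have : x s₀ - x s₁ = (s₁ - s₀) • (p - q) := by simp only [hx]; module
      rw [this, norm_smul, mul_pow, Real.norm_eq_abs, sq_abs]
    rw [e2, e3, e4, integral_norm_segConf_sub_sq, ← mul_add] at h1
    simp only [hg]
    rw [hinner]
    refine (real_inner_le_norm _ _).trans ((mul_le_mul_of_nonneg_left h1 (norm_nonneg _)).trans
      (le_of_eq ?_))
    ring

end finite

end velocity

/-- The semiconcavity inequality, between quantities that depend continuously on parameters, is
preserved in the limit. -/
lemma le_of_tendsto_defect {V : Type*} [NormedAddCommGroup V] [NormedSpace ℝ V] {K : Type*}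
    {F : Filter K} [F.NeBot] {f g h : K → V} {f₀ g₀ h₀ : V} {a b : K → ℝ} {a₀ b₀ c l : ℝ}
    (hf : Tendsto f F (𝓝 f₀)) (hg : Tendsto g F (𝓝 g₀)) (hh : Tendsto h F (𝓝 h₀))
    (ha : Tendsto a F (𝓝 a₀)) (hb : Tendsto b F (𝓝 b₀))
    (hle : ∀ᶠ k in F, ‖(1 - l) • f k + l • g k - h k‖ ≤ c * (a k ^ 2 + b k)) :
    ‖(1 - l) • f₀ + l • g₀ - h₀‖ ≤ c * (a₀ ^ 2 + b₀) :=
  le_of_tendsto_of_tendsto (((hf.const_smul _).add (hg.const_smul _)).sub hh).norm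
    (((ha.pow 2).add hb).const_mul c) hle

section velocity

variable {U : Type*} [MetricSpace U]

section finite

variable {ι : Type*} [Fintype ι] [MeasurableSpace ι] [MeasurableSingletonClass ι]
  {P : Measure ι} [IsProbabilityMeasure P] {R : ℝ}

lemma GoodTime.continuous_law {w : Pc d → U → E d → E d} {m : ℝ} {l : ℕ → ℝ}
    (h : GoodTime w m l) {K : Type*} [TopologicalSpace K] {a : K → ι → E d} (ha : Continuous a)
    (haR : ∀ k i, ‖a k i‖ ≤ R) {x : K → E d} (hx : Continuous x) (hxR : ∀ k, ‖x k‖ ≤ R) (u : U) :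
    Continuous fun k => w (law P (a k)) u (x k) := by
  obtain ⟨n, hn⟩ := exists_nat_ge R
  have hb : ∀ k, BddRV P (a k) R := fun k => bddRV_of_finite (haR k)
  rw [continuous_iff_continuousAt]
  intro k
  refine h.tendsto (n := n) (νs := fun k => law P (a k)) (us := fun _ => u)
    (Eventually.of_forall fun j => ((hb j).mono hn).law_mem)
    ((hb k).mono hn).law_mem (Eventually.of_forall fun j => (hxR j).trans hn) ((hxR k).trans hn)
    ?_ tendsto_const_nhds (hx.tendsto k)
  have h1 : Tendsto (fun j => ‖a j - a k‖) (𝓝 k) (𝓝 0) := by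
    have : Continuous fun j => ‖a j - a k‖ := by fun_prop
    simpa using this.tendsto k
  exact squeeze_zero (fun _ => Wp_nonneg _ _ _) (fun j => Wp_one_law_le_of_le (hb j) (hb k)
    (Eventually.of_forall fun i => norm_le_pi_norm (a j - a k) i)) h1

lemma continuous_integral_norm_sub_sq {K : Type*} [TopologicalSpace K] {a b : K → ι → E d}
    (ha : Continuous a) (hb : Continuous b) :
    Continuous fun k => ∫ i, ‖a k i - b k i‖ ^ 2 ∂P := by
  have : ∀ k, ∫ i, ‖a k i - b k i‖ ^ 2 ∂P = ∑ i, P.real {i} • ‖a k i - b k i‖ ^ 2 := fun k =>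
    integral_fintype Integrable.of_finite
  simp only [this]
  fun_prop

variable {T : ℝ} {v : ℝ → Pc d → U → E d → E d} {m : ℝ → ℝ} {l : ℕ → ℝ → ℝ} {C : ℝ → ℝ}

/-- At almost every time, the semiconcavity inequality holds for all separated configurations. The
exceptional null set can be chosen uniformly, by density and continuity. -/
lemma Carath.ae_semiconcave_of_separated (hC : Carath T v m l) {u : U}
    (hsc : ∀ μ₁ ∈ PcOn (ball0 d R), ∀ μ₂ ∈ PcOn (ball0 d R), ∀ γ, ∀ hγ : γ ∈ optPlans μ₁ μ₂,
      ∀ x ∈ ball0 d R, ∀ y ∈ ball0 d R, ∀ᵐ t ∂(leb T), ∀ l ∈ Icc (0 : ℝ) 1,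
        ‖(1 - l) • v t μ₁ u x + l • v t μ₂ u y
            - v t (interp hγ.1 l) u ((1 - l) • x + l • y)‖
          ≤ C t * (l * (1 - l)) * (‖x - y‖ ^ 2 + Wp 2 μ₁ μ₂ ^ 2)) :
    ∀ᵐ t ∂(leb T), ∀ A B : ι → E d, Separated A B → (∀ i, ‖A i‖ ≤ R) → (∀ i, ‖B i‖ ≤ R) →
      ∀ p q : E d, ‖p‖ ≤ R → ‖q‖ ≤ R → ∀ l ∈ Icc (0 : ℝ) 1,
      ‖(1 - l) • v t (law P A) u p + l • v t (law P B) u q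
          - v t (law P (segConf A B l)) u ((1 - l) • p + l • q)‖
        ≤ C t * (l * (1 - l)) * (‖p - q‖ ^ 2 + ∫ i, ‖A i - B i‖ ^ 2 ∂P) := by
  let K := {c : ((ι → E d) × (ι → E d)) × (E d × E d) // Separated c.1.1 c.1.2 ∧
    (∀ i, ‖c.1.1 i‖ ≤ R) ∧ (∀ i, ‖c.1.2 i‖ ≤ R) ∧ ‖c.2.1‖ ≤ R ∧ ‖c.2.2‖ ≤ R}
  obtain ⟨S, hSc, hSd⟩ := TopologicalSpace.exists_countable_dense K
  have h1 : ∀ᵐ t ∂(leb T), ∀ c ∈ S, ∀ l ∈ Icc (0 : ℝ) 1,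
      ‖(1 - l) • v t (law P c.1.1.1) u c.1.2.1 + l • v t (law P c.1.1.2) u c.1.2.2
          - v t (law P (segConf c.1.1.1 c.1.1.2 l)) u ((1 - l) • c.1.2.1 + l • c.1.2.2)‖
        ≤ C t * (l * (1 - l)) *
          (‖c.1.2.1 - c.1.2.2‖ ^ 2 + ∫ i, ‖c.1.1.1 i - c.1.1.2 i‖ ^ 2 ∂P) := by
    refine (ae_ball_iff hSc).2 ?_
    rintro ⟨⟨⟨A, B⟩, p, q⟩, hsep, hA, hB, hp, hq⟩ -
    have hX := bddRV_of_finite (P := P) hA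
    have hY := bddRV_of_finite (P := P) hB
    have hJ : jointLaw P _ _ hX.1 hY.1 ∈ optPlans (law P A) (law P B) := by
      rw [optPlans_eq_of_separated hsep hX hY]; rfl
    filter_upwards [hsc _ hX.law_mem _ hY.law_mem _ hJ p (by simpa using hp) q (by simpa using hq)]
      with t ht l hl
    have h2 := ht l hl
    rw [interp_jointLaw hX hY, Wp_two_of_separated hsep] at h2
    exact h2
  filter_upwards [h1, hC.good] with t ht htg A B hsep hA hB p q hp hq l hl
  have c1 : Continuous fun c : K => c.1.1.1 := by fun_prop
  have c2 : Continuous fun c : K => c.1.1.2 := by fun_prop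
  have c3 : Continuous fun c : K => c.1.2.1 := by fun_prop
  have c4 : Continuous fun c : K => c.1.2.2 := by fun_prop
  have k1 := htg.continuous_law (P := P) c1 (fun c => c.2.2.1) c3 (fun c => c.2.2.2.2.1) u
  have k2 := htg.continuous_law (P := P) c2 (fun c => c.2.2.2.1) c4 (fun c => c.2.2.2.2.2) u
  have k3 := htg.continuous_law (P := P) (a := fun c : K => segConf c.1.1.1 c.1.1.2 l)
    (by unfold segConf; fun_prop)
    (fun c i => norm_segConf_le hl c.2.2.1 c.2.2.2.1 i)
    (x := fun c : K => (1 - l) • c.1.2.1 + l • c.1.2.2) (by fun_prop)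
    (fun c => norm_convexComb_le hl c.2.2.2.2.1 c.2.2.2.2.2) u
  have k4 := continuous_integral_norm_sub_sq (P := P) c1 c2
  let c₀ : K := ⟨((A, B), (p, q)), hsep, hA, hB, hp, hq⟩
  haveI : (𝓝[S] c₀).NeBot := mem_closure_iff_nhdsWithin_neBot.1 (hSd c₀)
  have key := le_of_tendsto_defect (F := 𝓝[S] c₀) (c := C t * (l * (1 - l))) (l := l)
    ((k1.tendsto c₀).mono_left nhdsWithin_le_nhds) ((k2.tendsto c₀).mono_left nhdsWithin_le_nhds)
    ((k3.tendsto c₀).mono_left nhdsWithin_le_nhds)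
    (((c3.sub c4).norm.tendsto c₀).mono_left nhdsWithin_le_nhds)
    ((k4.tendsto c₀).mono_left nhdsWithin_le_nhds)
    (by filter_upwards [self_mem_nhdsWithin] with c hc using ht c hc l hl)
  exact key

end finite

variable {Ω : Type*} [MetricSpace Ω] [SecondCountableTopology Ω] [MeasurableSpace Ω]
  [BorelSpace Ω] {γ : Measure Ω} [IsProbabilityMeasure γ]
  {T : ℝ} {v : ℝ → Pc d → U → E d → E d} {m : ℝ → ℝ} {l : ℕ → ℝ → ℝ} {C : ℝ → ℝ} {R : ℝ}

/-- At almost every time, the velocity field is semiconcave along all interpolations. -/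
theorem Carath.ae_semiconcave [CompactSpace U] [Nonempty U] [Nonempty Ω] (hC : Carath T v m l)
    (hv : VelocityHyp T v) (hC0 : ∀ t ∈ Icc 0 T, 0 ≤ C t)
    (hsc : ∀ u, ∀ μ₁ ∈ PcOn (ball0 d R), ∀ μ₂ ∈ PcOn (ball0 d R), ∀ γ, ∀ hγ : γ ∈ optPlans μ₁ μ₂,
      ∀ x ∈ ball0 d R, ∀ y ∈ ball0 d R, ∀ᵐ t ∂(leb T), ∀ l ∈ Icc (0 : ℝ) 1,
        ‖(1 - l) • v t μ₁ u x + l • v t μ₂ u y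
            - v t (interp hγ.1 l) u ((1 - l) • x + l • y)‖
          ≤ C t * (l * (1 - l)) * (‖x - y‖ ^ 2 + Wp 2 μ₁ μ₂ ^ 2)) :
    ∀ᵐ t ∂(leb T), ∀ u, ∀ A B : Ω → E d, Continuous A → Continuous B → (∀ z, ‖A z‖ ≤ R) →
      (∀ z, ‖B z‖ ≤ R) → ∀ p q : E d, ‖p‖ ≤ R → ‖q‖ ≤ R → ∀ l ∈ Icc (0 : ℝ) 1,
      ‖(1 - l) • v t (law γ A) u p + l • v t (law γ B) u q
          - v t (law γ fun z => (1 - l) • A z + l • B z) u ((1 - l) • p + l • q)‖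
        ≤ C t * (l * (1 - l)) * (‖p - q‖ ^ 2 + ∫ z, ‖A z - B z‖ ^ 2 ∂γ) := by
  obtain ⟨s, hs⟩ := exists_simpleFunc_tendsto_id (Ω := Ω)
  obtain ⟨N, hN⟩ := exists_nat_ge R
  have h1 := fun k n => hC.ae_semiconcave_of_separated (P := rangeMeasure γ (s n))
    (hsc (TopologicalSpace.denseSeq U k))
  replace h1 := ae_all_iff.2 fun k => ae_all_iff.2 fun n => h1 k n
  have h2 := ae_all_iff.2 fun k => hv.ae_diffTime (TopologicalSpace.denseSeq U k)
  filter_upwards [h1, h2, hC.good, ae_restrict_mem measurableSet_Icc] with t ht1 ht2 htg htI u A B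
    hA hB hAR hBR p q hp hq l hl
  have hDc : Continuous fun z => (1 - l) • A z + l • B z := by fun_prop
  have hDR : ∀ z, ‖(1 - l) • A z + l • B z‖ ≤ R := fun z => norm_convexComb_le hl (hAR z) (hBR z)
  refine (TopologicalSpace.denseRange_denseSeq U).induction_on
    (p := fun u => ‖(1 - l) • v t (law γ A) u p + l • v t (law γ B) u q
          - v t (law γ fun z => (1 - l) • A z + l • B z) u ((1 - l) • p + l • q)‖
        ≤ C t * (l * (1 - l)) * (‖p - q‖ ^ 2 + ∫ z, ‖A z - B z‖ ^ 2 ∂γ)) u ?_ fun k => ?_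
  · have hcont : Continuous fun u => ‖(1 - l) • v t (law γ A) u p + l • v t (law γ B) u q
          - v t (law γ fun z => (1 - l) • A z + l • B z) u ((1 - l) • p + l • q)‖ := by
      have h3 := htg.cont
      fun_prop
    exact isClosed_le hcont continuous_const
  · set u' := TopologicalSpace.denseSeq U k with hu'
    have hlim : ∀ (D : Ω → E d) (x : E d), Continuous D → (∀ z, ‖D z‖ ≤ R) → ‖x‖ ≤ R →
        Tendsto (fun n => v t (law γ fun z => D (s n z)) u' x) atTop (𝓝 (v t (law γ D) u' x)) := by
      intro D x hD hDR hx
      exact htg.tendsto (n := N) (us := fun _ => u') (xs := fun _ => x) (Eventually.of_forall fun n =>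
          ((bddRV_comp_simpleFunc hD hDR (s n)).mono hN).law_mem)
        ((bddRV_of_continuous hD hDR).mono hN).law_mem (Eventually.of_forall fun _ => hx.trans hN)
        (hx.trans hN) (tendsto_Wp_one_law hs hD hDR) tendsto_const_nhds tendsto_const_nhds
    refine le_of_tendsto_defect (F := atTop) (hlim A p hA hAR hp) (hlim B q hB hBR hq)
      (hlim _ _ hDc hDR (norm_convexComb_le hl hp hq)) tendsto_const_nhds
      (tendsto_integral_norm_sub_sq (γ := γ) hs hA hAR hB hBR) (Eventually.of_forall fun n => ?_)
    have h3 := (ht2 k).semiconcave_of_separated (P := rangeMeasure γ (s n)) (hC0 t htI)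
      (ht1 k n) (A := fun i => A i) (B := fun i => B i) (fun i => hAR i) (fun i => hBR i) hp hq hl
    have e1 := law_rangeMeasure (γ := γ) (s n) A
    have e2 := law_rangeMeasure (γ := γ) (s n) B
    have e3 := law_rangeMeasure (γ := γ) (s n) (fun z => (1 - l) • A z + l • B z)
    have e4 := integral_rangeMeasure (γ := γ) (s n) (fun z => ‖A z - B z‖ ^ 2)
    rw [← e1, ← e2, ← e3, ← e4]
    exact h3

end velocity

/-! ### Stability of flows in the mean -/

/-- The constant of the mean-field Gronwall inequality. -/
def gronwallMean (J : ℝ) : ℝ := Real.exp J * Real.exp (Real.exp J * J)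

lemma gronwallMean_nonneg (J : ℝ) : 0 ≤ gronwallMean J := by unfold gronwallMean; positivity

/-- The Lipschitz constant of flows that results from the mean-field Gronwall inequality. -/
def flowLip (J : ℝ) : ℝ := (1 + J * gronwallMean J) * Real.exp J

section gronwall

variable {Ω : Type*} [MeasurableSpace Ω] {γ : Measure Ω} [IsProbabilityMeasure γ]

/-- Gronwall's inequality for a family of functions coupled through their mean. It is applied for
each label first, and then to the mean of the resulting bounds. -/
lemma meanField_gronwall {a b : ℝ} {f : ℝ → Ω → ℝ} {g : Ω → ℝ} {k : ℝ → ℝ}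
    (hk : Integrable k) (hk0 : ∀ t, 0 ≤ k t)
    (hf : ∀ z, ContinuousOn (fun t => f t z) (Icc a b)) (hf0 : ∀ t ∈ Icc a b, ∀ z, 0 ≤ f t z)
    (hfi : ∀ t ∈ Icc a b, Integrable (f t) γ)
    (hfc : ContinuousOn (fun t => ∫ z, f t z ∂γ) (Icc a b)) (hg : Integrable g γ)
    (hg0 : ∀ z, 0 ≤ g z)
    (h : ∀ z, ∀ t ∈ Icc a b, f t z ≤ g z + ∫ s in a..t, k s * (f s z + ∫ z', f s z' ∂γ)) :
    (∀ t ∈ Icc a b, ∫ z, f t z ∂γ ≤ gronwallMean (∫ s, k s) * ∫ z, g z ∂γ) ∧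
    ∀ t ∈ Icc a b, ∀ z, f t z ≤ flowLip (∫ s, k s) * (g z + ∫ z, g z ∂γ) := by
  set J := ∫ s, k s with hJ
  have hJ0 : 0 ≤ J := integral_nonneg hk0
  set F : ℝ → ℝ := fun t => ∫ z, f t z ∂γ with hF
  set G := ∫ z, g z ∂γ with hG
  have hG0 : 0 ≤ G := integral_nonneg hg0
  have hF0 : ∀ t ∈ Icc a b, 0 ≤ F t := fun t ht => integral_nonneg (hf0 t ht)
  have hkt : ∀ t ∈ Icc a b, ∫ s in a..t, k s ≤ J := fun t ht => by
    rw [intervalIntegral.integral_of_le ht.1]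
    exact setIntegral_le_integral hk (Eventually.of_forall hk0)
  have hpos := Real.exp_pos J
  have hkF : ∀ t ∈ Icc a b, IntervalIntegrable (fun s => k s * F s) volume a t := fun t ht =>
    hk.intervalIntegrable.mul_continuousOn (by
      rw [uIcc_of_le ht.1]; exact hfc.mono (Icc_subset_Icc_right ht.2))
  have h1 : ∀ t ∈ Icc a b, ∀ z, f t z ≤ (g z + ∫ s in a..t, k s * F s) * Real.exp J := by
    intro t ht z
    have hsub := Icc_subset_Icc_right (b := a) ht.2
    have hA0 : 0 ≤ g z + ∫ s in a..t, k s * F s := add_nonneg (hg0 z)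
      (intervalIntegral.integral_nonneg ht.1 fun s hs => mul_nonneg (hk0 s) (hF0 s (hsub hs)))
    refine (gronwall_integral (f := fun t => f t z) (A := g z + ∫ s in a..t, k s * F s) ht.1 hk hk0
      ((hf z).mono hsub) fun t' ht' => ?_).trans
      (mul_le_mul_of_nonneg_left (Real.exp_le_exp.2 (hkt t ht)) hA0)
    refine (h z t' (hsub ht')).trans ?_
    have hkf : IntervalIntegrable (fun s => k s * f s z) volume a t' :=
      hk.intervalIntegrable.mul_continuousOn (by
        rw [uIcc_of_le ht'.1]; exact (hf z).mono (Icc_subset_Icc_right (hsub ht').2))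
    have e1 : ∫ s in a..t', k s * (f s z + F s)
        = (∫ s in a..t', k s * F s) + ∫ s in a..t', k s * f s z := by
      rw [← intervalIntegral.integral_add (hkF t' (hsub ht')) hkf]
      exact intervalIntegral.integral_congr fun s _ => by ring
    rw [e1]
    have e2 : ∫ s in a..t', k s * F s ≤ ∫ s in a..t, k s * F s := by
      refine intervalIntegral.integral_mono_interval le_rfl ht'.1 ht'.2 ?_ (hkF t ht)
      rw [EventuallyLE, ae_restrict_iff' measurableSet_Ioc]
      exact Eventually.of_forall fun s hs =>
        mul_nonneg (hk0 s) (hF0 s (hsub (Ioc_subset_Icc_self hs)))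
    linarith
  have h2 : ∀ t ∈ Icc a b, F t ≤ G * Real.exp J + ∫ s in a..t, Real.exp J * k s * F s := by
    intro t ht
    have e1 : ∫ s in a..t, Real.exp J * k s * F s = Real.exp J * ∫ s in a..t, k s * F s := by
      rw [← intervalIntegral.integral_const_mul]
      exact intervalIntegral.integral_congr fun q _ => by ring
    calc F t ≤ ∫ z, (g z + ∫ s in a..t, k s * F s) * Real.exp J ∂γ :=
          integral_mono (hfi t ht) ((hg.add (integrable_const _)).mul_const _) (h1 t ht)
      _ = (G + ∫ s in a..t, k s * F s) * Real.exp J := by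
          rw [integral_mul_const, integral_add hg (integrable_const _)]
          simp [hG]
      _ = _ := by rw [e1]; ring
  have h3 : ∀ t ∈ Icc a b, F t ≤ gronwallMean J * G := by
    intro t ht
    have hsub := Icc_subset_Icc_right (b := a) ht.2
    refine (gronwall_integral (f := F) (l := fun s => Real.exp J * k s) ht.1 (hk.const_mul _)
      (fun s => mul_nonneg hpos.le (hk0 s)) (hfc.mono hsub) fun s hs => h2 s (hsub hs)).trans ?_
    rw [intervalIntegral.integral_const_mul, gronwallMean]
    have h4 : Real.exp (Real.exp J * ∫ s in a..t, k s) ≤ Real.exp (Real.exp J * J) :=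
      Real.exp_le_exp.2 (mul_le_mul_of_nonneg_left (hkt t ht) hpos.le)
    calc _ ≤ G * Real.exp J * Real.exp (Real.exp J * J) := by gcongr
      _ = _ := by ring
  refine ⟨h3, fun t ht z => (h1 t ht z).trans ?_⟩
  have hsub := Icc_subset_Icc_right (b := a) ht.2
  have h4 : ∫ s in a..t, k s * F s ≤ J * (gronwallMean J * G) := by
    calc ∫ s in a..t, k s * F s ≤ ∫ s in a..t, k s * (gronwallMean J * G) :=
          intervalIntegral.integral_mono_on ht.1 (hkF t ht) (hk.mul_const _).intervalIntegrable
            fun s hs => mul_le_mul_of_nonneg_left (h3 s (hsub hs)) (hk0 s)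
      _ = (∫ s in a..t, k s) * (gronwallMean J * G) := intervalIntegral.integral_mul_const _ _
      _ ≤ _ := mul_le_mul_of_nonneg_right (hkt t ht)
          (mul_nonneg (gronwallMean_nonneg J) hG0)
  have h5 : 0 ≤ J * gronwallMean J * g z :=
    mul_nonneg (mul_nonneg hJ0 (gronwallMean_nonneg J)) (hg0 z)
  rw [flowLip]
  calc (g z + ∫ s in a..t, k s * F s) * Real.exp J
      ≤ ((1 + J * gronwallMean J) * (g z + G)) * Real.exp J := by
        gcongr
        linarith
    _ = _ := by ring

lemma sq_integral_le {f : Ω → ℝ} (hf : Integrable f γ) (hf2 : Integrable (fun z => f z ^ 2) γ) :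
    (∫ z, f z ∂γ) ^ 2 ≤ ∫ z, f z ^ 2 ∂γ := by
  set c := ∫ z, f z ∂γ with hc
  have h1 : 0 ≤ ∫ z, (f z ^ 2 - 2 * c * f z + c ^ 2) ∂γ :=
    integral_nonneg fun z => by
      have : f z ^ 2 - 2 * c * f z + c ^ 2 = (f z - c) ^ 2 := by ring
      simp only [Pi.zero_apply]
      rw [this]; positivity
  have hi : Integrable (fun z => f z ^ 2 - 2 * c * f z) γ := hf2.sub (hf.const_mul _)
  rw [integral_add hi (integrable_const _), integral_sub hf2 (hf.const_mul _), integral_const_mul, ← hc] at h1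
  simp only [integral_const, probReal_univ, smul_eq_mul, one_mul] at h1
  linarith

end gronwall

section stability

variable {U : Type*} [MetricSpace U] {T τ r R : ℝ} {v : ℝ → Pc d → U → E d → E d} {m : ℝ → ℝ}
  {l : ℕ → ℝ → ℝ} {u : ℝ → U} {μ₁ μ₂ μ₃ : ℝ → Pc d} {X₁ X₂ X₃ : ℝ → E d → E d}
  {Ω : Type*} [MetricSpace Ω] [SecondCountableTopology Ω] [MeasurableSpace Ω] [BorelSpace Ω]
  {γ : Measure Ω} [IsProbabilityMeasure γ] {π₁ π₂ π₃ : Ω → E d}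

lemma IsFlow.law_comp (h : IsFlow v τ T r R u μ₁ X₁) (hπ : Continuous π₁)
    (hm : γ.map π₁ = (μ₁ τ).meas) {t : ℝ} (ht : t ∈ Icc τ T) :
    μ₁ t = law γ (fun z => X₁ t (π₁ z)) := by
  rw [h.law_eq t ht]
  exact ((law_map hπ.aemeasurable hm (h.bddRV ht)).2).symm

variable [MeasurableSpace U] [BorelSpace U] [SecondCountableTopology U]

lemma IsFlow.intervalIntegrable (h : IsFlow v τ T r R u μ₁ X₁) (hC : Carath T v m l)
    (hτ : τ ∈ Icc 0 T) (hu : AEMeasurable u (leb T)) (z : E d) {t : ℝ} (ht : t ∈ Icc τ T) :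
    IntervalIntegrable (fun s => v s (μ₁ s) (u s) (X₁ s z)) volume τ t :=
  (intervalIntegrable_iff_integrableOn_Icc_of_le ht.1).2
    ((h.integrableOn hC hτ hu z).mono_set (Icc_subset_Icc_right ht.2))

/-- Two flows driven by the same control stay close, pointwise and in the mean. -/
theorem IsFlow.norm_sub_le (hC : Carath T v m l) (hτ : τ ∈ Icc 0 T) (hu : AEMeasurable u (leb T))
    {n : ℕ} (hn : R ≤ n) (h₁ : IsFlow v τ T r R u μ₁ X₁) (h₂ : IsFlow v τ T r R u μ₂ X₂)
    (hπ₁ : Continuous π₁) (hπ₂ : Continuous π₂) (hm₁ : γ.map π₁ = (μ₁ τ).meas)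
    (hm₂ : γ.map π₂ = (μ₂ τ).meas) {t : ℝ} (ht : t ∈ Icc τ T) (z : Ω) :
    ‖X₁ t (π₁ z) - X₂ t (π₂ z)‖ ≤ flowLip (∫ s, l n s) *
      (‖X₁ τ (π₁ z) - X₂ τ (π₂ z)‖ + ∫ z, ‖X₁ τ (π₁ z) - X₂ τ (π₂ z)‖ ∂γ) := by
  have hX₁ := h₁.cont
  have hX₂ := h₂.cont
  have hτI : τ ∈ Icc τ T := left_mem_Icc.2 hτ.2
  set f : ℝ → Ω → ℝ := fun t z => ‖X₁ t (π₁ z) - X₂ t (π₂ z)‖ with hf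
  have hcont : Continuous (Function.uncurry f) := by simp only [hf]; fun_prop
  have hfb : ∀ t ∈ Icc τ T, ∀ z, ‖f t z‖ ≤ R + R := fun t ht z => by
    simp only [hf, norm_norm]
    exact (_root_.norm_sub_le _ _).trans (add_le_add (h₁.bdd t ht _) (h₂.bdd t ht _))
  have hfi : ∀ t ∈ Icc τ T, Integrable (f t) γ := fun t ht => by
    have : Continuous (f t) := by fun_prop
    exact Integrable.of_bound (C := R + R) this.aestronglyMeasurable
      (Eventually.of_forall (hfb t ht))
  have hfc := continuousOn_integral (γ := γ) hcont hfb
  refine (meanField_gronwall (γ := γ) (f := f) (g := f τ) (hC.l_int n) (hC.l_nonneg n)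
    (fun z => by fun_prop) (fun t _ z => norm_nonneg _) hfi hfc (hfi τ hτI)
    (fun z => norm_nonneg _) fun z t ht => ?_).2 t ht z
  have e1 : X₁ t (π₁ z) - X₂ t (π₂ z) = (X₁ τ (π₁ z) - X₂ τ (π₂ z)) +
      ∫ s in τ..t, (v s (μ₁ s) (u s) (X₁ s (π₁ z)) - v s (μ₂ s) (u s) (X₂ s (π₂ z))) := by
    rw [h₁.eq t ht, h₂.eq t ht, intervalIntegral.integral_sub
      (h₁.intervalIntegrable hC hτ hu _ ht) (h₂.intervalIntegrable hC hτ hu _ ht)]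
    abel
  simp only [hf]
  rw [e1]
  refine (norm_add_le _ _).trans (add_le_add le_rfl
    (intervalIntegral.norm_integral_le_of_norm_le ht.1 ?_ ?_))
  · filter_upwards [hC.ae_good hτ.1] with s hs hst
    have hsI : s ∈ Icc τ T := ⟨hst.1.le, hst.2.trans ht.2⟩
    have hb₁ : BddRV γ (fun z => X₁ s (π₁ z)) R :=
      bddRV_of_continuous (by fun_prop) fun z => h₁.bdd s hsI _
    have hb₂ : BddRV γ (fun z => X₂ s (π₂ z)) R :=
      bddRV_of_continuous (by fun_prop) fun z => h₂.bdd s hsI _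
    refine ((hs hsI).lip n (u s) _ ((h₁.bddCurve hn).mem s hsI) _ ((h₂.bddCurve hn).mem s hsI) _ _
      ((h₁.bdd s hsI _).trans hn) ((h₂.bdd s hsI _).trans hn)).trans ?_
    refine mul_le_mul_of_nonneg_left (add_le_add le_rfl ?_) (hC.l_nonneg n s)
    rw [h₁.law_comp hπ₁ hm₁ hsI, h₂.law_comp hπ₂ hm₂ hsI]
    exact Wp_one_law_le hb₁ hb₂
  · refine (hC.l_int n).intervalIntegrable.mul_continuousOn ?_
    rw [uIcc_of_le ht.1]
    have hfz : Continuous fun s => f s z := by fun_prop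
    exact hfz.continuousOn.add (hfc.mono (Icc_subset_Icc_right ht.2))

/-- The interpolation of two flows stays close, in the mean, to a third flow with the same control,
if the velocity field is semiconcave. -/
theorem IsFlow.integral_defect_le (hC : Carath T v m l) (hτ : τ ∈ Icc 0 T)
    (hu : AEMeasurable u (leb T)) {n : ℕ} (hn : R ≤ n) (h₁ : IsFlow v τ T r R u μ₁ X₁)
    (h₂ : IsFlow v τ T r R u μ₂ X₂) (h₃ : IsFlow v τ T r R u μ₃ X₃)
    (hπ₁ : Continuous π₁) (hπ₂ : Continuous π₂) (hπ₃ : Continuous π₃)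
    (hm₁ : γ.map π₁ = (μ₁ τ).meas) (hm₂ : γ.map π₂ = (μ₂ τ).meas) (hm₃ : γ.map π₃ = (μ₃ τ).meas)
    {q : ℝ} (hq : q ∈ Icc (0 : ℝ) 1) {C : ℝ → ℝ} (hCi : Integrable C) (hC0 : ∀ t, 0 ≤ C t)
    (hsc : ∀ᵐ t, t ∈ Icc τ T → ∀ A B : Ω → E d, Continuous A → Continuous B →
      (∀ z, ‖A z‖ ≤ R) → (∀ z, ‖B z‖ ≤ R) → ∀ x y : E d, ‖x‖ ≤ R → ‖y‖ ≤ R →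
      ‖(1 - q) • v t (law γ A) (u t) x + q • v t (law γ B) (u t) y
          - v t (law γ fun z => (1 - q) • A z + q • B z) (u t) ((1 - q) • x + q • y)‖
        ≤ C t * (q * (1 - q)) * (‖x - y‖ ^ 2 + ∫ z, ‖A z - B z‖ ^ 2 ∂γ))
    {G : Ω → ℝ} (hGi : Integrable G γ)
    (hG : ∀ t ∈ Icc τ T, ∀ z, ‖X₁ t (π₁ z) - X₂ t (π₂ z)‖ ^ 2
      + ∫ z, ‖X₁ t (π₁ z) - X₂ t (π₂ z)‖ ^ 2 ∂γ ≤ G z)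
    {t : ℝ} (ht : t ∈ Icc τ T) :
    ∫ z, ‖(1 - q) • X₁ t (π₁ z) + q • X₂ t (π₂ z) - X₃ t (π₃ z)‖ ∂γ
      ≤ gronwallMean (∫ s, l n s) *
        ∫ z, (‖(1 - q) • X₁ τ (π₁ z) + q • X₂ τ (π₂ z) - X₃ τ (π₃ z)‖
          + (∫ s, C s) * (q * (1 - q)) * G z) ∂γ := by
  have hX₁ := h₁.cont
  have hX₂ := h₂.cont
  have hX₃ := h₃.cont
  have hτI : τ ∈ Icc τ T := left_mem_Icc.2 hτ.2
  have hq0 : 0 ≤ q * (1 - q) := mul_nonneg hq.1 (sub_nonneg.2 hq.2)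
  have hG0 : ∀ z, 0 ≤ G z := fun z => le_trans
    (add_nonneg (by positivity) (integral_nonneg fun _ => by positivity)) (hG τ hτI z)
  set S : ℝ → Ω → E d := fun t z => (1 - q) • X₁ t (π₁ z) + q • X₂ t (π₂ z) with hS
  have hSc : Continuous (Function.uncurry S) := by simp only [hS]; fun_prop
  have hSb : ∀ t ∈ Icc τ T, ∀ z, ‖S t z‖ ≤ R := fun t ht z =>
    norm_convexComb_le hq (h₁.bdd t ht _) (h₂.bdd t ht _)
  set f : ℝ → Ω → ℝ := fun t z => ‖S t z - X₃ t (π₃ z)‖ with hf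
  have hcont : Continuous (Function.uncurry f) := by simp only [hf]; fun_prop
  have hfb : ∀ t ∈ Icc τ T, ∀ z, ‖f t z‖ ≤ R + R := fun t ht z => by
    simp only [hf, norm_norm]
    exact (_root_.norm_sub_le _ _).trans (add_le_add (hSb t ht _) (h₃.bdd t ht _))
  have hfi : ∀ t ∈ Icc τ T, Integrable (f t) γ := fun t ht => by
    have : Continuous (f t) := by fun_prop
    exact Integrable.of_bound (C := R + R) this.aestronglyMeasurable
      (Eventually.of_forall (hfb t ht))
  have hfc := continuousOn_integral (γ := γ) hcont hfb
  refine (meanField_gronwall (γ := γ) (f := f)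
    (g := fun z => f τ z + (∫ s, C s) * (q * (1 - q)) * G z) (hC.l_int n) (hC.l_nonneg n)
    (fun z => by fun_prop) (fun t _ z => norm_nonneg _) hfi hfc
    ((hfi τ hτI).add (hGi.const_mul _))
    (fun z => add_nonneg (norm_nonneg _)
      (mul_nonneg (mul_nonneg (integral_nonneg hC0) hq0) (hG0 z))) fun z t ht => ?_).1 t ht
  have i₁ := h₁.intervalIntegrable hC hτ hu (π₁ z) ht
  have i₂ := h₂.intervalIntegrable hC hτ hu (π₂ z) ht
  have i₃ := h₃.intervalIntegrable hC hτ hu (π₃ z) ht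
  have e1 : S t z - X₃ t (π₃ z) = (S τ z - X₃ τ (π₃ z)) +
      ∫ s in τ..t, ((1 - q) • v s (μ₁ s) (u s) (X₁ s (π₁ z)) + q • v s (μ₂ s) (u s) (X₂ s (π₂ z))
        - v s (μ₃ s) (u s) (X₃ s (π₃ z))) := by
    have i₁' : IntervalIntegrable (fun s => (1 - q) • v s (μ₁ s) (u s) (X₁ s (π₁ z)))
      volume τ t := i₁.smul (1 - q)
    have i₂' : IntervalIntegrable (fun s => q • v s (μ₂ s) (u s) (X₂ s (π₂ z)))
      volume τ t := i₂.smul q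
    have i₁₂ : IntervalIntegrable (fun s => (1 - q) • v s (μ₁ s) (u s) (X₁ s (π₁ z))
      + q • v s (μ₂ s) (u s) (X₂ s (π₂ z))) volume τ t := i₁'.add i₂'
    rw [intervalIntegral.integral_sub i₁₂ i₃, intervalIntegral.integral_add i₁' i₂', intervalIntegral.integral_smul,
      intervalIntegral.integral_smul]
    simp only [hS]
    rw [h₁.eq t ht, h₂.eq t ht, h₃.eq t ht]
    module
  have hfz : Continuous fun s => f s z := by fun_prop
  have iL : IntervalIntegrable (fun s => l n s * (f s z + ∫ z', f s z' ∂γ)) volume τ t := by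
    refine (hC.l_int n).intervalIntegrable.mul_continuousOn ?_
    rw [uIcc_of_le ht.1]
    exact hfz.continuousOn.add (hfc.mono (Icc_subset_Icc_right ht.2))
  have iC : IntervalIntegrable (fun s => C s * ((q * (1 - q)) * G z)) volume τ t :=
    (hCi.mul_const _).intervalIntegrable
  have h5 : ‖∫ s in τ..t, ((1 - q) • v s (μ₁ s) (u s) (X₁ s (π₁ z))
        + q • v s (μ₂ s) (u s) (X₂ s (π₂ z)) - v s (μ₃ s) (u s) (X₃ s (π₃ z)))‖
      ≤ ∫ s in τ..t, (C s * ((q * (1 - q)) * G z) + l n s * (f s z + ∫ z', f s z' ∂γ)) := by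
    refine intervalIntegral.norm_integral_le_of_norm_le ht.1 ?_ (iC.add iL)
    filter_upwards [hC.ae_good hτ.1, hsc] with s hs hss hst
    have hsI : s ∈ Icc τ T := ⟨hst.1.le, hst.2.trans ht.2⟩
    have hb₁ : BddRV γ (S s) R := bddRV_of_continuous (by fun_prop) (hSb s hsI)
    have hb₃ : BddRV γ (fun z => X₃ s (π₃ z)) R :=
      bddRV_of_continuous (by fun_prop) fun z => h₃.bdd s hsI _
    have k1 := hss hsI (fun z => X₁ s (π₁ z)) (fun z => X₂ s (π₂ z)) (by fun_prop) (by fun_prop)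
      (fun z => h₁.bdd s hsI _) (fun z => h₂.bdd s hsI _) (X₁ s (π₁ z)) (X₂ s (π₂ z))
      (h₁.bdd s hsI _) (h₂.bdd s hsI _)
    rw [← h₁.law_comp hπ₁ hm₁ hsI, ← h₂.law_comp hπ₂ hm₂ hsI] at k1
    have k2 := (hs hsI).lip n (u s) _ (hb₁.mono hn).law_mem _ ((h₃.bddCurve hn).mem s hsI) _ _
      ((hSb s hsI z).trans hn) ((h₃.bdd s hsI (π₃ z)).trans hn)
    have k3 : Wp 1 (law γ (S s)) (μ₃ s) ≤ ∫ z', f s z' ∂γ := by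
      rw [h₃.law_comp hπ₃ hm₃ hsI]
      exact Wp_one_law_le hb₁ hb₃
    refine (norm_sub_le_norm_sub_add_norm_sub _ (v s (law γ (S s)) (u s) (S s z)) _).trans
      (add_le_add ?_ ?_)
    · refine k1.trans ?_
      rw [mul_assoc]
      exact mul_le_mul_of_nonneg_left (mul_le_mul_of_nonneg_left (hG s hsI z) hq0) (hC0 s)
    · exact k2.trans (mul_le_mul_of_nonneg_left (add_le_add le_rfl k3) (hC.l_nonneg n s))
  rw [intervalIntegral.integral_add iC iL, intervalIntegral.integral_mul_const] at h5
  have h6 : ∫ s in τ..t, C s ≤ ∫ s, C s := by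
    rw [intervalIntegral.integral_of_le ht.1]
    exact setIntegral_le_integral hCi (Eventually.of_forall hC0)
  have h7 := mul_le_mul_of_nonneg_right h6 (mul_nonneg hq0 (hG0 z))
  have h8 : f t z ≤ f τ z + ‖∫ s in τ..t, ((1 - q) • v s (μ₁ s) (u s) (X₁ s (π₁ z))
        + q • v s (μ₂ s) (u s) (X₂ s (π₂ z)) - v s (μ₃ s) (u s) (X₃ s (π₃ z)))‖ := by
    simp only [hf]
    rw [e1]
    exact norm_add_le _ _
  linarith

end stability

/-! ### Semiconcavity of the value function -/

lemma flowRadius_pos {r M : ℝ} (hr : 0 < r) (hM : 0 ≤ M) : 0 < flowRadius r M := by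
  unfold flowRadius flowMoment; positivity

lemma interp_mem_PcOn_ball {r : ℝ} {μ₁ μ₂ : Pc d} {γ : ProbabilityMeasure (E d × E d)}
    (hγ : γ ∈ plans μ₁ μ₂) (h₁ : μ₁ ∈ PcOn (ball0 d r)) (h₂ : μ₂ ∈ PcOn (ball0 d r)) {q : ℝ}
    (hq : q ∈ Icc (0 : ℝ) 1) : interp hγ q ∈ PcOn (ball0 d r) := by
  rw [interp_eq_law hγ]
  exact BddRV.law_mem (BddRV.convexComb hq (bddRV_fst hγ h₁) (bddRV_snd hγ h₂))

section value

variable {U : Type*} [MetricSpace U] [CompactSpace U] [Nonempty U] [MeasurableSpace U]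
  [BorelSpace U] {T τ r : ℝ} {v : ℝ → Pc d → U → E d → E d} {φ : Pc d → ℝ} {m : ℝ → ℝ}
  {l : ℕ → ℝ → ℝ} {u : ℝ → U} {μ₁ μ₂ μ₃ : ℝ → Pc d} {X₁ X₂ X₃ : ℝ → E d → E d}

/-- The final costs of three flows with the same control, the third of which starts on the
displacement interpolation of the initial data of the first two. -/
theorem IsFlow.cost_semiconcave (hC : Carath T v m l) (hv : VelocityHyp T v) (hφ : CostHyp φ)
    (hτ : τ ∈ Icc 0 T) (hu : AEMeasurable u (leb T)) {R : ℝ} (hR : 0 < R) {n : ℕ} (hn : R ≤ n)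
    {C : ℝ → ℝ} (hCi : IsL1Nonneg T C)
    (hsc : ∀ u, ∀ μ₁ ∈ PcOn (ball0 d R), ∀ μ₂ ∈ PcOn (ball0 d R), ∀ γ, ∀ hγ : γ ∈ optPlans μ₁ μ₂,
      ∀ x ∈ ball0 d R, ∀ y ∈ ball0 d R, ∀ᵐ t ∂(leb T), ∀ l ∈ Icc (0 : ℝ) 1,
        ‖(1 - l) • v t μ₁ u x + l • v t μ₂ u y
            - v t (interp hγ.1 l) u ((1 - l) • x + l • y)‖
          ≤ C t * (l * (1 - l)) * (‖x - y‖ ^ 2 + Wp 2 μ₁ μ₂ ^ 2))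
    {Cφ : ℝ} (hCφ0 : 0 ≤ Cφ)
    (hCφ : ∀ μ₁ ∈ PcOn (ball0 d R), ∀ μ₂ ∈ PcOn (ball0 d R),
      ∀ γ, ∀ hγ : γ ∈ optPlans μ₁ μ₂, ∀ l ∈ Icc (0 : ℝ) 1,
        (1 - l) * φ μ₁ + l * φ μ₂ - φ (interp hγ.1 l) ≤ Cφ * (l * (1 - l)) * Wp 2 μ₁ μ₂ ^ 2)
    {L : ℝ} (hL0 : 0 ≤ L) (hL : ∀ μ ∈ PcOn (ball0 d R), ∀ ν ∈ PcOn (ball0 d R),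
      |φ μ - φ ν| ≤ L * Wp 1 μ ν)
    (h₁ : IsFlow v τ T r R u μ₁ X₁) (h₂ : IsFlow v τ T r R u μ₂ X₂)
    (h₃ : IsFlow v τ T r R u μ₃ X₃) (hr₁ : μ₁ τ ∈ PcOn (ball0 d r))
    (hr₂ : μ₂ τ ∈ PcOn (ball0 d r)) {q : ℝ} (hq : q ∈ Icc (0 : ℝ) 1)
    {γ : ProbabilityMeasure (E d × E d)} (hγ : γ ∈ optPlans (μ₁ τ) (μ₂ τ))
    (hμ₃ : μ₃ τ = interp hγ.1 q) :
    (1 - q) * φ (μ₁ T) + q * φ (μ₂ T) - φ (μ₃ T)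
      ≤ (Cφ * (4 * flowLip (∫ s, l n s) ^ 2) + L * (gronwallMean (∫ s, l n s) *
          ((∫ s in Icc 0 T, C s) * (8 * flowLip (∫ s, l n s) ^ 2)))) * (q * (1 - q))
        * Wp 2 (μ₁ τ) (μ₂ τ) ^ 2 := by
  set c := flowLip (∫ s, l n s) with hc
  set W := Wp 2 (μ₁ τ) (μ₂ τ) ^ 2 with hW
  set g : Measure (E d × E d) := (γ : Measure (E d × E d)) with hg
  have hq0 : 0 ≤ q * (1 - q) := mul_nonneg hq.1 (sub_nonneg.2 hq.2)
  have hτI : τ ∈ Icc τ T := left_mem_Icc.2 hτ.2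
  have hTI : T ∈ Icc τ T := right_mem_Icc.2 hτ.2
  have hX₁ := h₁.cont
  have hX₂ := h₂.cont
  have hX₃ := h₃.cont
  have hm₁ : g.map Prod.fst = (μ₁ τ).meas := hγ.1.1
  have hm₂ : g.map Prod.snd = (μ₂ τ).meas := hγ.1.2
  have hm₃ : g.map (interpMap q) = (μ₃ τ).meas := by rw [hμ₃]; rfl
  have hz₁ : ∀ᵐ z ∂g, ‖z.1‖ ≤ r := plans_ae_fst hγ.1 (mem_PcOn_ball.1 hr₁)
  have hz₂ : ∀ᵐ z ∂g, ‖z.2‖ ≤ r := plans_ae_snd hγ.1 (mem_PcOn_ball.1 hr₂)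
  -- The distance of the two initial positions: it is bounded, and its square has mean `W`.
  set a : E d × E d → ℝ := fun z => ‖X₁ τ z.1 - X₂ τ z.2‖ with ha
  have hac : Continuous a := by fun_prop
  have hab : ∀ z, ‖a z‖ ≤ R + R := fun z => by
    simp only [ha, norm_norm]
    exact (_root_.norm_sub_le _ _).trans (add_le_add (h₁.bdd τ hτI _) (h₂.bdd τ hτI _))
  have hai : Integrable a g :=
    Integrable.of_bound (C := R + R) hac.aestronglyMeasurable (Eventually.of_forall hab)
  have ha2i : Integrable (fun z => a z ^ 2) g :=
    Integrable.of_bound (C := (R + R) ^ 2) (hac.pow 2).aestronglyMeasurable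
      (Eventually.of_forall fun z => by
        rw [norm_pow]; exact pow_le_pow_left₀ (norm_nonneg _) (hab z) 2)
  have haW : ∫ z, a z ^ 2 ∂g = W := by
    rw [hW, Wp_two_sq_of_optPlans hγ]
    refine integral_congr_ae ?_
    filter_upwards [hz₁, hz₂] with z k₁ k₂
    simp only [ha]
    rw [h₁.init _ k₁, h₂.init _ k₂]
  have haW1 : (∫ z, a z ∂g) ^ 2 ≤ W := (sq_integral_le hai ha2i).trans haW.le
  have hdist : ∀ t ∈ Icc τ T, ∀ z : E d × E d,
      ‖X₁ t z.1 - X₂ t z.2‖ ^ 2 ≤ 2 * c ^ 2 * (a z ^ 2 + W) := fun t ht z => by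
    have k := IsFlow.norm_sub_le hC hτ hu hn h₁ h₂ continuous_fst continuous_snd hm₁ hm₂ ht z
    refine (pow_le_pow_left₀ (norm_nonneg _) k 2).trans ?_
    rw [mul_pow, mul_comm (2 : ℝ), mul_assoc]
    refine mul_le_mul_of_nonneg_left ?_ (sq_nonneg c)
    have : (a z + ∫ z, a z ∂g) ^ 2 ≤ 2 * (a z ^ 2 + (∫ z, a z ∂g) ^ 2) := by
      nlinarith [sq_nonneg (a z - ∫ z, a z ∂g)]
    linarith
  have hbi : Integrable (fun z => 2 * c ^ 2 * (a z ^ 2 + W)) g :=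
    (ha2i.add (integrable_const W)).const_mul _
  have hbint : ∫ z, 2 * c ^ 2 * (a z ^ 2 + W) ∂g = 4 * c ^ 2 * W := by
    rw [integral_const_mul, integral_add ha2i (integrable_const W), haW]
    simp only [integral_const, probReal_univ, smul_eq_mul, one_mul]
    ring
  have hmean : ∀ t ∈ Icc τ T, ∫ z, ‖X₁ t z.1 - X₂ t z.2‖ ^ 2 ∂g ≤ 4 * c ^ 2 * W := fun t ht => by
    rw [← hbint]
    exact integral_mono_of_nonneg (Eventually.of_forall fun _ => sq_nonneg _) hbi
      (Eventually.of_forall fun z => hdist t ht z)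
  set G : E d × E d → ℝ := fun z => 2 * c ^ 2 * (a z ^ 2 + W) + 4 * c ^ 2 * W with hG
  have hGi : Integrable G g := hbi.add (integrable_const _)
  have hGint : ∫ z, G z ∂g = 8 * c ^ 2 * W := by
    simp only [hG]
    rw [integral_add hbi (integrable_const _), hbint]
    simp only [integral_const, probReal_univ, smul_eq_mul, one_mul]
    ring
  -- The velocity field is semiconcave along every pair of random variables.
  set C' : ℝ → ℝ := (Icc 0 T).indicator C with hC'
  have hC'0 : ∀ t, 0 ≤ C' t := fun t => indicator_nonneg hCi.2 t
  have hC'i : Integrable C' := hCi.1.integrable_indicator measurableSet_Icc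
  have hC'int : ∫ s, C' s = ∫ s in Icc 0 T, C s := integral_indicator measurableSet_Icc
  have hscg := (ae_restrict_iff' measurableSet_Icc).1
    (hC.ae_semiconcave (γ := g) hv hCi.2 hsc)
  have hdef := IsFlow.integral_defect_le (γ := g) (C := C') (G := G) hC hτ hu hn h₁ h₂ h₃
    continuous_fst continuous_snd (continuous_interpMap q) hm₁ hm₂ hm₃ hq hC'i hC'0
    (by
      filter_upwards [hscg] with t k ht A B hA hB hAR hBR x y hx hy
      have htT : t ∈ Icc 0 T := ⟨hτ.1.trans ht.1, ht.2⟩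
      rw [hC', indicator_of_mem htT]
      exact k htT (u t) A B hA hB hAR hBR x y hx hy q hq)
    hGi (fun t ht z => add_le_add (hdist t ht z) (hmean t ht)) hTI
  -- The third flow starts on the interpolation, so that there is no initial defect.
  have hinit : ∫ z, (‖(1 - q) • X₁ τ z.1 + q • X₂ τ z.2 - X₃ τ (interpMap q z)‖
      + (∫ s, C' s) * (q * (1 - q)) * G z) ∂g
        = (∫ s, C' s) * (q * (1 - q)) * (8 * c ^ 2 * W) := by
    rw [← hGint, ← integral_const_mul]
    refine integral_congr_ae ?_
    filter_upwards [hz₁, hz₂] with z k₁ k₂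
    rw [h₁.init _ k₁, h₂.init _ k₂, h₃.init (interpMap q z) (norm_convexComb_le hq k₁ k₂)]
    simp [interpMap]
  rw [hinit] at hdef
  have hA : Continuous fun z : E d × E d => X₁ T z.1 := by fun_prop
  have hB : Continuous fun z : E d × E d => X₂ T z.2 := by fun_prop
  have hA₃ : Continuous fun z : E d × E d => X₃ T (interpMap q z) :=
    (h₃.continuous_apply T).comp (continuous_interpMap q)
  have hcost := hφ.semiconcave (γ := g) hR hCφ hA (fun z => h₁.bdd T hTI _) hB
    (fun z => h₂.bdd T hTI _) hq
  have b₁₂ : BddRV g (fun z => (1 - q) • X₁ T z.1 + q • X₂ T z.2) R :=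
    bddRV_of_continuous (by fun_prop) fun z =>
      norm_convexComb_le hq (h₁.bdd T hTI _) (h₂.bdd T hTI _)
  have b₃ : BddRV g (fun z => X₃ T (interpMap q z)) R :=
    bddRV_of_continuous hA₃ fun z => h₃.bdd T hTI _
  have hlip := hL _ b₁₂.law_mem _ b₃.law_mem
  rw [← h₁.law_comp continuous_fst hm₁ hTI, ← h₂.law_comp continuous_snd hm₂ hTI] at hcost
  rw [← h₃.law_comp (continuous_interpMap q) hm₃ hTI] at hlip
  have hlip' := (abs_le.1 (hlip.trans (mul_le_mul_of_nonneg_left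
    (h₃.law_comp (continuous_interpMap q) hm₃ hTI ▸ Wp_one_law_le b₁₂ b₃) hL0))).2
  have e1 := mul_le_mul_of_nonneg_left (hmean T hTI) (mul_nonneg hCφ0 hq0)
  have e2 := mul_le_mul_of_nonneg_left hdef hL0
  rw [hC'int] at e2
  linarith

lemma attainableCosts_nonempty (hC : Carath T v m l) (hτ : τ ∈ Icc 0 T) (μ : Pc d) :
    (attainableCosts T v φ τ μ).Nonempty := by
  obtain ⟨r, hr, hμr⟩ := exists_mem_PcOn_ball μ
  have hu : AEMeasurable (fun _ : ℝ => Classical.arbitrary U) (leb T) := aemeasurable_const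
  obtain ⟨μ', X, h0, h⟩ := hC.exists_isFlow hτ hu hr hμr
  exact ⟨_, _, μ', hu, h.solvesContinuityEq hC hτ hu
    (flowRadius_pos hr (integral_nonneg hC.m_nonneg)).le, h0, rfl⟩

lemma bddBelow_attainableCosts (hC : Carath T v m l) (hφ : CostHyp φ) (hτ : τ ∈ Icc 0 T)
    (μ : Pc d) : BddBelow (attainableCosts T v φ τ μ) := by
  obtain ⟨r, hr, hμr⟩ := exists_mem_PcOn_ball μ
  set R := flowRadius r (∫ s, m s) with hR
  have hR0 : 0 < R := flowRadius_pos hr (integral_nonneg hC.m_nonneg)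
  obtain ⟨L, hL⟩ := hφ.lipschitz (max r R) (hr.trans_le (le_max_left _ _))
  refine ⟨φ μ - |L| * (r + R), ?_⟩
  rintro _ ⟨u, μ', hu, hsol, rfl, rfl⟩
  obtain ⟨X, h⟩ := hsol.exists_isFlow hC hτ hu hr hμr
  have hTI : T ∈ Icc τ T := right_mem_Icc.2 hτ.2
  have b₁ : BddRV (μ' τ).meas (fun x => x) (max r R) := (bddRV_id hμr).mono (le_max_left _ _)
  have b₂ : BddRV (μ' τ).meas (X T) (max r R) := (h.bddRV hTI).mono (le_max_right _ _)
  have k := hL (μ' τ) (PcOn_ball_mono (le_max_left _ _) hμr) (μ' T) (by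
    rw [h.law_eq T hTI]; exact b₂.law_mem)
  have k2 : Wp 1 (μ' τ) (μ' T) ≤ r + R := by
    rw [h.law_eq T hTI]
    nth_rw 1 [← law_id (μ' τ)]
    refine Wp_one_law_le_of_le b₁ b₂ ?_
    filter_upwards [mem_PcOn_ball.1 hμr] with x hx
    exact (norm_sub_le _ _).trans (add_le_add hx (h.bdd T hTI x))
  have k3 : L * Wp 1 (μ' τ) (μ' T) ≤ |L| * (r + R) :=
    (mul_le_mul_of_nonneg_right (le_abs_self L) (Wp_nonneg _ _ _)).trans
      (mul_le_mul_of_nonneg_left k2 (abs_nonneg L))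
  linarith [(abs_le.1 (k.trans k3)).2]

end value

end MeanFieldControl

end

open MeanFieldControl in
theorem mainTheorem1 {d : ℕ} {U : Type*} [MetricSpace U] [CompactSpace U] [Nonempty U]
    [MeasurableSpace U] [BorelSpace U] (T : ℝ) (hT : 0 < T)
    (v : ℝ → Pc d → U → E d → E d) (φ : Pc d → ℝ)
    (hOCP : OCP T v φ) (hSC : SC1 T v φ) :
    (∀ τ ∈ Icc 0 T, ∀ μ : Pc d,
      IsGLB (attainableCosts T v φ τ μ) (valueFunction T v φ τ μ)) ∧
    ∀ r > 0, ∃ C > 0, ∀ τ ∈ Icc 0 T,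
      ∀ μ₁ ∈ PcOn (ball0 d r), ∀ μ₂ ∈ PcOn (ball0 d r),
        ∀ l ∈ Icc (0 : ℝ) 1, ∀ γ, ∀ hγ : γ ∈ optPlans μ₁ μ₂,
          (1 - l) * valueFunction T v φ τ μ₁ + l * valueFunction T v φ τ μ₂
              - valueFunction T v φ τ (interp hγ.1 l)
            ≤ C * (l * (1 - l)) * Wp 2 μ₁ μ₂ ^ 2 := by
  obtain ⟨m, k, hC⟩ := hOCP.velocity.exists_carath
  have hglb : ∀ τ ∈ Icc 0 T, ∀ μ : Pc d,
      IsGLB (attainableCosts T v φ τ μ) (valueFunction T v φ τ μ) := fun τ hτ μ =>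
    isGLB_csInf (attainableCosts_nonempty hC hτ μ)
      (bddBelow_attainableCosts hC hOCP.cost hτ μ)
  refine ⟨hglb, fun r hr => ?_⟩
  set R := flowRadius r (∫ s, m s) with hR
  have hR0 : 0 < R := flowRadius_pos hr (integral_nonneg hC.m_nonneg)
  obtain ⟨n, hn⟩ := exists_nat_ge R
  obtain ⟨C, hCi, hsc⟩ := hSC.velocity R hR0
  obtain ⟨Cφ, hCφ0, hCφ⟩ := hSC.cost R hR0
  obtain ⟨L, hL⟩ := hOCP.cost.lipschitz R hR0
  have hL' : ∀ μ ∈ PcOn (ball0 d R), ∀ ν ∈ PcOn (ball0 d R), |φ μ - φ ν| ≤ |L| * Wp 1 μ ν :=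
    fun μ hμ ν hν => (hL μ hμ ν hν).trans
      (mul_le_mul_of_nonneg_right (le_abs_self L) (Wp_nonneg _ _ _))
  have hC0 : 0 ≤ ∫ s in Icc 0 T, C s := setIntegral_nonneg measurableSet_Icc hCi.2
  have hgr := gronwallMean_nonneg (∫ s, k n s)
  set K := Cφ * (4 * flowLip (∫ s, k n s) ^ 2) + |L| * (gronwallMean (∫ s, k n s) *
    ((∫ s in Icc 0 T, C s) * (8 * flowLip (∫ s, k n s) ^ 2))) with hK
  have hK0 : 0 ≤ K := by positivity
  refine ⟨K + 1, by positivity, fun τ hτ μ₁ hμ₁ μ₂ hμ₂ q hq γ hγ => ?_⟩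
  have hq0 : 0 ≤ q * (1 - q) := mul_nonneg hq.1 (sub_nonneg.2 hq.2)
  have hi := interp_mem_PcOn_ball hγ.1 hμ₁ hμ₂ hq
  have hmain : (1 - q) * valueFunction T v φ τ μ₁ + q * valueFunction T v φ τ μ₂
      - K * (q * (1 - q)) * Wp 2 μ₁ μ₂ ^ 2 ≤ valueFunction T v φ τ (interp hγ.1 q) := by
    refine (hglb τ hτ _).2 ?_
    -- Use the control of a competitor for the interpolation at the two endpoints as well.
    rintro _ ⟨u, μ', hu, hsol, h0, rfl⟩
    obtain ⟨X₃, h₃⟩ := hsol.exists_isFlow hC hτ hu hr (h0 ▸ hi)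
    obtain ⟨ν₁, X₁, rfl, h₁⟩ := hC.exists_isFlow hτ hu hr hμ₁
    obtain ⟨ν₂, X₂, rfl, h₂⟩ := hC.exists_isFlow hτ hu hr hμ₂
    have e₁ : valueFunction T v φ τ (ν₁ τ) ≤ φ (ν₁ T) :=
      (hglb τ hτ _).1 ⟨u, ν₁, hu, h₁.solvesContinuityEq hC hτ hu hR0.le, rfl, rfl⟩
    have e₂ : valueFunction T v φ τ (ν₂ τ) ≤ φ (ν₂ T) :=
      (hglb τ hτ _).1 ⟨u, ν₂, hu, h₂.solvesContinuityEq hC hτ hu hR0.le, rfl, rfl⟩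
    have e₃ := IsFlow.cost_semiconcave hC hOCP.velocity hOCP.cost hτ hu hR0 hn hCi hsc hCφ0.le hCφ
      (abs_nonneg L) hL' h₁ h₂ h₃ hμ₁ hμ₂ hq hγ h0
    have e₄ := mul_le_mul_of_nonneg_left e₁ (sub_nonneg.2 hq.2)
    have e₅ := mul_le_mul_of_nonneg_left e₂ hq.1
    linarith
  have : 0 ≤ q * (1 - q) * Wp 2 μ₁ μ₂ ^ 2 := mul_nonneg hq0 (sq_nonneg _)
  linarith
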